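/- Conventions. A W*-algebra is a C*-algebra isometrically isomorphic to the dual of a Banach space; a linear map between W*-algebras is normal if it is weak*-continuous; "ccp" means contractive completely positive. A W*-action of a group $G$ on a W*-algebra $M$ is an action $\gamma$ of $G$ on $M$ by $*$-automorphisms such that $t\mapsto\gamma_t(m)$ is weak*-continuous for every $m\in M$. If $M_1$ and $M_2$ are faithfully, normally and unitally represented on Hilbert spaces $X_1$ and $X_2$, then $M_1\bar\otimes M_2\subseteq\mathbb B(X_1\otimes X_2)$ is the von Neumann algebra generated by the operators $m_1\otimes m_2$ (it does not depend on the representations, up to isomorphism). For $T\in M_1\bar\otimes M_2$ and $z,w\in X_1$ let $T_{z,w}\in M_2$ be the operator given by $\langle T_{z,w}u,v\rangle=\langle T(w\otimes u),z\otimes v\rangle$; for an automorphism $\alpha$ of $M_2$, $(\operatorname{id}\bar\otimes\alpha)(T)$ is the operator with $(\operatorname{id}\bar\otimes\alpha)(T)_{z,w}=\alpha(T_{z,w})$ for all $z,w$, and $\alpha\bar\otimes\operatorname{id}$ is defined symmetrically. A conditional expectation of a W*-algebra onto a W*-subalgebra (a weak*-closed $*$-subalgebra, whose unit may differ from that of the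 larger algebra) is a ccp bimodule map onto the subalgebra that restricts to its identity. Theorem. For $i=1,2$ let $G_i$ be a locally compact Hausdorff group, let $\gamma^i$ and $\delta^i$ be W*-actions of $G_i$ on W*-algebras $M_i$ and $N_i$, and let $\pi_i\colon M_i\to N_i$ be a ccp map with $\pi_i\circ\gamma^i_t=\delta^i_t\circ\pi_i$ for all $t\in G_i$. 1. There is a unique W*-action $\gamma^1\bar\otimes\gamma^2$ of $G_1\times G_2$ on $M_1\bar\otimes M_2$ by normal automorphisms such that $(\gamma^1\bar\otimes\gamma^2)_{(t_1,t_2)}(m_1\otimes m_2)=\gamma^1_{t_1}(m_1)\otimes\gamma^2_{t_2}(m_2)$ for all $m_1,m_2$, and it is given by $(\gamma^1\bar\otimes\gamma^2)_{(t_1,t_2)}(T)=(\gamma^1_{t_1}\bar\otimes\operatorname{id})\big((\operatorname{id}\bar\otimes\gamma^2_{t_2})(T)\big)$. The same holds for $\delta^1\bar\otimes\delta^2$ on $N_1\bar\otimes N_2$. Moreover, there is a map $\rho\colon M_1\bar\otimes M_2\to N_1\bar\otimes N_2$ with all of the following properties. 2. $\rho$ is linear and ccp, it is equivariant with respect to $\gamma^1\bar\otimes\gamma^2$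 and $\delta^1\bar\otimes\delta^2$, and $\rho(m_1\otimes m_2)=\pi_1(m_1)\otimes\pi_2(m_2)$ for all $m_1\in M_1$, $m_2\in M_2$. 3. If $\pi_1$ and $\pi_2$ are normal, then $\rho$ is normal. 4. If each $N_i$ is a W*-subalgebra of $M_i$ and $\pi_1,\pi_2$ are conditional expectations, then $\rho$ is a conditional expectation, where $N_1\bar\otimes N_2$ is viewed as a W*-subalgebra of $M_1\bar\otimes M_2$ through the normal embedding that sends $n_1\otimes n_2$ to $n_1\otimes n_2$ (and $\rho$ is normal if $\pi_1$ and $\pi_2$ are). -/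

import Mathlib

open scoped TensorProduct Topology InnerProductSpace

noncomputable section

namespace VNTensor

/-! ### The weak-star topology and the ultraweak topology -/

/-- The weak-star topology of a W*-algebra `M`: a predual of `M` is picked, `M` is identified with
its dual, and the topology is that of pointwise convergence on the predual. -/
@[reducible] def weakStar (M : Type*) [CStarAlgebra M] [h : WStarAlgebra M] : TopologicalSpace M :=
  let X := h.exists_predual.choose
  let _ : NormedAddCommGroup X := h.exists_predual.choose_spec.choose
  let _ : NormedSpace ℂ X := h.exists_predual.choose_spec.choose_spec.choose
  let e : StrongDual ℂ X ≃ₗᵢ⋆[ℂ] M :=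
    h.exists_predual.choose_spec.choose_spec.choose_spec.choose_spec.some
  ⨅ x : X, TopologicalSpace.induced (fun m : M => e.symm m x) inferInstance

section Hilbert

variable (H : Type*) [NormedAddCommGroup H] [InnerProductSpace ℂ H]

/-- The ultraweak (that is, weak-star) topology of `B(H)`: the coarsest topology that makes every
functional `T ↦ ∑ₙ ⟪xₙ, T yₙ⟫` with `∑ₙ ‖xₙ‖² < ∞` and `∑ₙ ‖yₙ‖² < ∞` continuous. -/
@[reducible] def ultraweak : TopologicalSpace (H →L[ℂ] H) :=
  ⨅ (x : ℕ → H) (y : ℕ → H) (_ : Summable fun n => ‖x n‖ ^ 2) (_ : Summable fun n => ‖y n‖ ^ 2),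
    TopologicalSpace.induced (fun T : H →L[ℂ] H => ∑' n, ⟪x n, T (y n)⟫_ℂ) inferInstance

variable {H} [CompleteSpace H]

/-- The weak-star topology of a von Neumann algebra acting on `H`. -/
@[reducible] def ultraweakOn (A : VonNeumannAlgebra H) : TopologicalSpace A.toStarSubalgebra :=
  TopologicalSpace.induced Subtype.val (ultraweak H)

theorem isClosed_vonNeumannAlgebra (A : VonNeumannAlgebra H) :
    IsClosed (A.toStarSubalgebra : Set (H →L[ℂ] H)) := by
  rw [VonNeumannAlgebra.coe_toStarSubalgebra, ← VonNeumannAlgebra.centralizer_centralizer]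
  exact Set.isClosed_centralizer _

/-- A von Neumann algebra is a C*-algebra. -/
instance instCStarAlgebra (A : VonNeumannAlgebra H) : CStarAlgebra A.toStarSubalgebra :=
  StarSubalgebra.cstarAlgebra A.toStarSubalgebra (h_closed := isClosed_vonNeumannAlgebra A)

end Hilbert

/-! ### Completely positive contractions and conditional expectations -/

section Maps

variable {A B : Type*} [CStarAlgebra A] [CStarAlgebra B]

/-- `f` is a contractive completely positive map, for the canonical orders of the C*-algebras. -/
def IsCCP (f : A →ₗ[ℂ] B) : Prop :=
  (letI := CStarAlgebra.spectralOrder A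
   letI := CStarAlgebra.spectralOrder B
   haveI := CStarAlgebra.spectralOrderedRing A
   haveI := CStarAlgebra.spectralOrderedRing B
   ∃ F : CompletelyPositiveMap A B, F.toLinearMap = f) ∧
  ∀ a, ‖f a‖ ≤ ‖a‖

/-- `f : A → B` is a conditional expectation, where `B` is viewed as a subalgebra of `A` through
the (not necessarily unital) embedding `j`: a contractive completely positive `B`-bimodule map that
restricts to the identity of `B`. -/
structure IsConditionalExpectation (j : B →⋆ₙₐ[ℂ] A) (f : A →ₗ[ℂ] B) : Prop where
  isCCP : IsCCP f
  apply_coe : ∀ b, f (j b) = b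
  bimodule : ∀ b a b', f (j b * a * j b') = b * f a * b'

/-- `j` embeds `B` as a W*-subalgebra of `A` (with respect to the weak-star topologies `τB`, `τA`):
an injective normal `*`-homomorphism, not necessarily unital. Its range is weak-star closed. -/
structure IsWStarEmbedding (τB : TopologicalSpace B) (τA : TopologicalSpace A)
    (j : B →⋆ₙₐ[ℂ] A) : Prop where
  injective : Function.Injective j
  normal : Continuous[τB, τA] j

/-- A W*-action of `G` on `A`, where `τ` is the weak-star topology of `A`: an action by
`*`-automorphisms with weak-star continuous orbit maps. -/
def IsWStarAction {G : Type*} [Group G] [TopologicalSpace G] (τ : TopologicalSpace A)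
    (γ : G →* (A ≃⋆ₐ[ℂ] A)) : Prop :=
  ∀ a, Continuous[inferInstance, τ] fun t => γ t a

end Maps

section Hilbert

/-- A faithful normal unital representation of the W*-algebra `M` on `H`. -/
structure IsFaithfulNormal {M H : Type*} [CStarAlgebra M] [WStarAlgebra M]
    [NormedAddCommGroup H] [InnerProductSpace ℂ H] [CompleteSpace H]
    (φ : M →⋆ₐ[ℂ] (H →L[ℂ] H)) : Prop where
  injective : Function.Injective φ
  normal : Continuous[weakStar M, ultraweak H] φ

/-! ### Hilbert space tensor products -/

/-- The Hilbert space tensor product. -/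
abbrev HilbertTensor (H K : Type*) [NormedAddCommGroup H] [InnerProductSpace ℂ H]
    [NormedAddCommGroup K] [InnerProductSpace ℂ K] : Type _ :=
  UniformSpace.Completion (H ⊗[ℂ] K)

variable {H K : Type*} [NormedAddCommGroup H] [InnerProductSpace ℂ H]
  [NormedAddCommGroup K] [InnerProductSpace ℂ K]

/-- The operator `S ⊗ T`, with `(S ⊗ T) (x ⊗ y) = S x ⊗ T y`. -/
def opTensor (S : H →L[ℂ] H) (T : K →L[ℂ] K) : HilbertTensor H K →L[ℂ] HilbertTensor H K :=
  (TensorProduct.mapL S T).completion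

/-- The operator `K → H ⊗ K`, `y ↦ x ⊗ y`. -/
def leftTensor (x : H) : K →L[ℂ] HilbertTensor H K :=
  UniformSpace.Completion.toComplL ∘L TensorProduct.mkL ℂ H K x

/-- The operator `H → H ⊗ K`, `x ↦ x ⊗ y`. -/
def rightTensor (y : K) : H →L[ℂ] HilbertTensor H K :=
  UniformSpace.Completion.toComplL ∘L (TensorProduct.mkL ℂ H K).flip y

variable [CompleteSpace H] [CompleteSpace K]

/-- The coefficient in `B(K)` of an operator on `H ⊗ K`, for `x, x' ∈ H`:
`⟪coeffRight T x x' u, v⟫ = ⟪T (x' ⊗ u), x ⊗ v⟫`. -/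
def coeffRight (T : HilbertTensor H K →L[ℂ] HilbertTensor H K) (x x' : H) : K →L[ℂ] K :=
  (leftTensor x).adjoint ∘L T ∘L leftTensor x'

/-- The coefficient in `B(H)` of an operator on `H ⊗ K`, for `y, y' ∈ K`:
`⟪coeffLeft T y y' u, v⟫ = ⟪T (u ⊗ y'), v ⊗ y⟫`. -/
def coeffLeft (T : HilbertTensor H K →L[ℂ] HilbertTensor H K) (y y' : K) : H →L[ℂ] H :=
  (rightTensor y).adjoint ∘L T ∘L rightTensor y'

/-! ### The von Neumann tensor product -/

variable {M N : Type*} [CStarAlgebra M] [CStarAlgebra N]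

/-- `R = (id ⊗ α) T`, where `N` acts on `K` through `ψ`: all the coefficients of `T` in `B(K)` lie
in `N`, and those of `R` are their images under `α`. -/
def IsIdTensor (ψ : N →⋆ₐ[ℂ] (K →L[ℂ] K)) (α : N ≃⋆ₐ[ℂ] N)
    (T R : HilbertTensor H K →L[ℂ] HilbertTensor H K) : Prop :=
  ∀ x x' : H, ∃ n : N, coeffRight T x x' = ψ n ∧ coeffRight R x x' = ψ (α n)

/-- `R = (α ⊗ id) T`, where `M` acts on `H` through `φ`: all the coefficients of `T` in `B(H)` lie
in `M`, and those of `R` are their images under `α`. -/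
def IsTensorId (φ : M →⋆ₐ[ℂ] (H →L[ℂ] H)) (α : M ≃⋆ₐ[ℂ] M)
    (T R : HilbertTensor H K →L[ℂ] HilbertTensor H K) : Prop :=
  ∀ y y' : K, ∃ m : M, coeffLeft T y y' = φ m ∧ coeffLeft R y y' = φ (α m)

variable (φ : M →⋆ₐ[ℂ] (H →L[ℂ] H)) (ψ : N →⋆ₐ[ℂ] (K →L[ℂ] K))

/-- The operators `m ⊗ n` on `H ⊗ K`, where `M` acts on `H` and `N` acts on `K`. -/
def elementary : Set (HilbertTensor H K →L[ℂ] HilbertTensor H K) :=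
  Set.range fun p : M × N => opTensor (φ p.1) (ψ p.2)

/-- The von Neumann tensor product of `M` and `N`, represented on `H ⊗ K`: the bicommutant of the
set of all `m ⊗ n`. -/
def vnTensor : VonNeumannAlgebra (HilbertTensor H K) where
  toStarSubalgebra :=
    StarSubalgebra.centralizer ℂ
      (StarSubalgebra.centralizer ℂ (elementary φ ψ) :
        Set (HilbertTensor H K →L[ℂ] HilbertTensor H K))
  centralizer_centralizer' := by simp

/-- The von Neumann tensor product as a C*-algebra. -/
abbrev VN : Type _ := (vnTensor φ ψ).toStarSubalgebra

theorem opTensor_mem (m : M) (n : N) :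
    opTensor (φ m) (ψ n) ∈ (vnTensor φ ψ).toStarSubalgebra := by
  have key : ∀ g ∈ StarSubalgebra.centralizer ℂ (elementary φ ψ),
      g * opTensor (φ m) (ψ n) = opTensor (φ m) (ψ n) * g := fun g hg =>
    (((StarSubalgebra.mem_centralizer_iff ℂ).1 hg) _ ⟨(m, n), rfl⟩).1.symm
  exact (StarSubalgebra.mem_centralizer_iff ℂ).2 fun g hg => ⟨key g hg, key _ (star_mem hg)⟩

/-- The element `m ⊗ n` of the von Neumann tensor product. -/
def tmul (m : M) (n : N) : VN φ ψ := ⟨opTensor (φ m) (ψ n), opTensor_mem φ ψ m n⟩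

/-- `Γ` is the von Neumann tensor product of the actions `γ₁` and `γ₂`: the W*-action by normal
automorphisms that satisfies `Γ (s, t) (m ⊗ n) = γ₁ s m ⊗ γ₂ t n`. -/
structure IsTensorAction {G₁ G₂ : Type*} [Group G₁] [TopologicalSpace G₁] [Group G₂]
    [TopologicalSpace G₂] (γ₁ : G₁ →* (M ≃⋆ₐ[ℂ] M)) (γ₂ : G₂ →* (N ≃⋆ₐ[ℂ] N))
    (Γ : G₁ × G₂ →* (VN φ ψ ≃⋆ₐ[ℂ] VN φ ψ)) : Prop where
  isWStarAction : IsWStarAction (ultraweakOn (vnTensor φ ψ)) Γ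
  normal : ∀ t, Continuous[ultraweakOn (vnTensor φ ψ), ultraweakOn (vnTensor φ ψ)] (Γ t)
  apply_tmul : ∀ t m n, Γ t (tmul φ ψ m n) = tmul φ ψ (γ₁ t.1 m) (γ₂ t.2 n)

end Hilbert

end VNTensor

end

open VNTensor

noncomputable section

namespace VNTensor

/-! The map ρ is the composite `(π₁ ⊗ id) ∘ (id ⊗ π₂)` of two slice maps. As π₂ need not be normal,
`id ⊗ π₂` cannot be extended by continuity from elementary tensors. It is defined on coefficients:
an operator `T` is the family of its coefficients in the second algebra, indexed by pairs of vectors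
of the first Hilbert space, and π₂ is applied to each of them. For finitely many vectors, the bound
`‖T‖ ≤ C` says that a 2 × 2 block matrix, with `C` times a Gram matrix on the diagonal and the
coefficients off it, is positive; complete positivity carries this over to the new coefficients,
which therefore define a bounded operator (`exists_slice`). Positivity of matrices is transported in
the same way (`isCCP_idSlice`).

That the new operator lies in the tensor product is read off its coefficients through
`mem_vnTensor_iff`: the tensor product consists of the operators commuting with `M' ⊗ 1` and `1 ⊗
N'`. This is the commutation theorem, proved by a real-subspace argument in the style of Rieffel and
van Daele. Its core is that the self-adjoint elements of an algebra and `i` times those of its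
commutant move a vector to a real-total set of the cyclic subspace (`eq_zero_of_realOrbit`).

Two slice maps in different factors commute as soon as one of them is normal (`idSlice_sliceId`),
because a normal slice turns coefficients into norm convergent series of coefficients. Automorphisms
are normal (`isNormalMap_of_starAlgEquiv`), since the positive normal functionals are exactly those
that respect suprema of chains. Hence tensor products of automorphisms multiply correctly, ρ is
equivariant, and ρ is a left inverse of the normal embedding in the case of conditional
expectations; the bimodule property then follows from the multiplicative domain
(`isConditionalExpectation_of_leftInverse`). Uniqueness of the actions holds because normal maps are
determined on elementary tensors.

Weak-star continuity of the product action is a joint continuity statement. It holds because each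
action is norm continuous on the predual (`continuous_dualAct`), which is shown by averaging
functionals with Haar measure.

Everything is expressed through `IsDualRep`: a faithful representation in which the algebra is the
dual of the norm closed span of the vector functionals. Faithful normal representations of
W*-algebras and the von Neumann tensor products both have this property. -/

theorem summable_inner_apply {ι H : Type*} [NormedAddCommGroup H] {x y : ι → H} (hx : Summable fun i => ‖x i‖ ^ 2)
    (hy : Summable fun i => ‖y i‖ ^ 2) : Summable fun i => ‖x i‖ * ‖y i‖ := by
  refine Summable.of_nonneg_of_le (fun i => by positivity) (fun i => ?_) (hx.add hy)
  nlinarith [sq_nonneg (‖x i‖ - ‖y i‖), sq_nonneg (‖x i‖), sq_nonneg (‖y i‖)]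

theorem summable_geometric_prod {f : ℕ → ℕ → ℝ} (h0 : ∀ k i, 0 ≤ f k i)
    (hf : ∀ k, Summable (f k)) (h1 : ∀ k, ∑' i, f k i ≤ 1) :
    (Summable fun p : ℕ × ℕ => (1 / 2 : ℝ) ^ p.1 * f p.1 p.2) ∧
      ∑' p : ℕ × ℕ, (1 / 2 : ℝ) ^ p.1 * f p.1 p.2 ≤ 2 := by
  have hle : ∀ k, (1 / 2 : ℝ) ^ k * ∑' i, f k i ≤ (1 / 2) ^ k :=
    fun k => mul_le_of_le_one_right (by positivity) (h1 k)
  have h2 : Summable fun k => (1 / 2 : ℝ) ^ k * ∑' i, f k i :=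
    Summable.of_nonneg_of_le (fun k => mul_nonneg (by positivity) (tsum_nonneg (h0 k))) hle
      summable_geometric_two
  have hs : Summable fun p : ℕ × ℕ => (1 / 2 : ℝ) ^ p.1 * f p.1 p.2 := by
    refine (summable_prod_of_nonneg fun p => ?_).2 ⟨fun k => ?_, ?_⟩
    · exact mul_nonneg (by positivity) (h0 _ _)
    · exact (hf k).mul_left ((1 / 2 : ℝ) ^ k)
    · simpa only [tsum_mul_left] using h2
  refine ⟨hs, ?_⟩
  rw [hs.tsum_prod]
  simp only [tsum_mul_left]
  exact (h2.tsum_le_tsum hle summable_geometric_two).trans tsum_geometric_two.le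

/-! ### Normal functionals of a representation and the predual that they form -/

section Predual

variable {A H : Type*} [CStarAlgebra A] [NormedAddCommGroup H] [InnerProductSpace ℂ H]
  [CompleteSpace H]

/-- The vector functional `a ↦ ⟪x, φ a y⟫`. -/
def vecFun (φ : A →⋆ₐ[ℂ] (H →L[ℂ] H)) (x y : H) : StrongDual ℂ A :=
  LinearMap.mkContinuous
    { toFun := fun a => ⟪x, φ a y⟫_ℂ
      map_add' := fun a b => by simp
      map_smul' := fun c a => by simp } (‖x‖ * ‖y‖) fun a => by
    calc ‖⟪x, φ a y⟫_ℂ‖ ≤ ‖x‖ * ‖φ a y‖ := norm_inner_le_norm _ _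
      _ ≤ ‖x‖ * (‖φ a‖ * ‖y‖) := by gcongr; exact (φ a).le_opNorm y
      _ ≤ ‖x‖ * (‖a‖ * ‖y‖) := by gcongr; exact NonUnitalStarAlgHom.norm_apply_le φ a
      _ = ‖x‖ * ‖y‖ * ‖a‖ := by ring

variable (φ : A →⋆ₐ[ℂ] (H →L[ℂ] H))

@[simp] theorem vecFun_apply (x y : H) (a : A) : vecFun φ x y a = ⟪x, φ a y⟫_ℂ := rfl

theorem norm_vecFun_le (x y : H) : ‖vecFun φ x y‖ ≤ ‖x‖ * ‖y‖ :=
  LinearMap.mkContinuous_norm_le _ (by positivity) _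

/-- The normal functionals: the norm closure of the span of the vector functionals. -/
def normalDual : Submodule ℂ (StrongDual ℂ A) :=
  (Submodule.span ℂ (Set.range fun p : H × H => vecFun φ p.1 p.2)).topologicalClosure

theorem isClosed_normalDual : IsClosed (normalDual φ : Set (StrongDual ℂ A)) :=
  Submodule.isClosed_topologicalClosure _

theorem vecFun_mem (x y : H) : vecFun φ x y ∈ normalDual φ :=
  Submodule.le_topologicalClosure _ (Submodule.subset_span ⟨(x, y), rfl⟩)

theorem normalDual_le {P : Submodule ℂ (StrongDual ℂ A)} (hP : IsClosed (P : Set (StrongDual ℂ A)))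
    (h : ∀ x y, vecFun φ x y ∈ P) : normalDual φ ≤ P :=
  Submodule.topologicalClosure_minimal _
    (Submodule.span_le.2 (by rintro _ ⟨p, rfl⟩; exact h _ _)) hP

/-- `ω` is a sum of vector functionals `∑ ⟪x i, φ a (y i)⟫` with square sums at most `c`. -/
def IsSumForm (ι : Type*) (c : ℝ) (ω : StrongDual ℂ A) : Prop :=
  ∃ x y : ι → H, (Summable fun i => ‖x i‖ ^ 2) ∧ ∑' i, ‖x i‖ ^ 2 ≤ c ∧
    (Summable fun i => ‖y i‖ ^ 2) ∧ ∑' i, ‖y i‖ ^ 2 ≤ c ∧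
    ∀ a, HasSum (fun i => ⟪x i, φ a (y i)⟫_ℂ) (ω a)

variable {φ}

theorem _root_.HasSum.congr_fun' {ι E : Type*} [AddCommMonoid E] [TopologicalSpace E]
    {f g : ι → E} {a : E} (h : HasSum f a) (hfg : ∀ i, g i = f i) : HasSum g a := by
  rwa [funext hfg]

theorem IsSumForm.reindex {ι κ : Type*} (e : κ ≃ ι) {c : ℝ} {ω : StrongDual ℂ A}
    (h : IsSumForm φ ι c ω) : IsSumForm φ κ c ω := by
  obtain ⟨x, y, hx, hxc, hy, hyc, h⟩ := h
  exact ⟨fun i => x (e i), fun i => y (e i), (e.summable_iff (f := fun i => ‖x i‖ ^ 2)).2 hx,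
    (e.tsum_eq fun i => ‖x i‖ ^ 2).trans_le hxc, (e.summable_iff (f := fun i => ‖y i‖ ^ 2)).2 hy,
    (e.tsum_eq fun i => ‖y i‖ ^ 2).trans_le hyc,
    fun a => (e.hasSum_iff (f := fun i => ⟪x i, φ a (y i)⟫_ℂ)).2 (h a)⟩

/-- Putting the factor `√s` on both vectors of each term scales both square sums by `s`. With `s + t
= 1` and `c = d = 1` this gives convexity of the set of functionals of square sums at most `1`. -/
theorem IsSumForm.combo {ι κ : Type*} {c d s t : ℝ} (hs : 0 ≤ s) (ht : 0 ≤ t)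
    {ω ω' : StrongDual ℂ A} (h : IsSumForm φ ι c ω) (h' : IsSumForm φ κ d ω') :
    IsSumForm φ (ι ⊕ κ) (s * c + t * d) (s • ω + t • ω') := by
  obtain ⟨x, y, hx, hxc, hy, hyc, h⟩ := h
  obtain ⟨x', y', hx', hxc', hy', hyc', h'⟩ := h'
  have key : ∀ (z : ι → H) (z' : κ → H), Summable (fun i => ‖z i‖ ^ 2) →
      Summable (fun i => ‖z' i‖ ^ 2) → ∑' i, ‖z i‖ ^ 2 ≤ c → ∑' i, ‖z' i‖ ^ 2 ≤ d →
      (Summable fun i => ‖Sum.elim (fun i => (√s : ℂ) • z i) (fun i => (√t : ℂ) • z' i) i‖ ^ 2) ∧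
      ∑' i, ‖Sum.elim (fun i => (√s : ℂ) • z i) (fun i => (√t : ℂ) • z' i) i‖ ^ 2 ≤
        s * c + t * d := by
    intro z z' hz hz' hc hd
    have := HasSum.sum (f := fun i =>
      ‖Sum.elim (fun i => (√s : ℂ) • z i) (fun i => (√t : ℂ) • z' i) i‖ ^ 2)
      (a := s * ∑' i, ‖z i‖ ^ 2) (b := t * ∑' i, ‖z' i‖ ^ 2)
      (by
        refine (hz.hasSum.mul_left s).congr_fun' fun i => ?_
        simp [norm_smul, mul_pow, Real.sq_sqrt hs])
      (by
        refine (hz'.hasSum.mul_left t).congr_fun' fun i => ?_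
        simp [norm_smul, mul_pow, Real.sq_sqrt ht])
    refine ⟨this.summable, this.tsum_eq.le.trans ?_⟩
    gcongr
  refine ⟨_, _, (key x x' hx hx' hxc hxc').1, (key x x' hx hx' hxc hxc').2,
    (key y y' hy hy' hyc hyc').1, (key y y' hy hy' hyc hyc').2, fun a => ?_⟩
  have e : ∀ r : ℝ, 0 ≤ r → ∀ z : ℂ, (√r : ℂ) * ((√r : ℂ) * z) = r * z := by
    intro r hr z
    rw [← mul_assoc, ← Complex.ofReal_mul, Real.mul_self_sqrt hr]
  refine HasSum.sum (f := fun i => ⟪Sum.elim (fun i => (√s : ℂ) • x i) (fun i => (√t : ℂ) • x' i) i,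
    φ a (Sum.elim (fun i => (√s : ℂ) • y i) (fun i => (√t : ℂ) • y' i) i)⟫_ℂ)
    (a := s • ω a) (b := t • ω' a) ?_ ?_
  · refine ((h a).mul_left (s : ℂ)).congr_fun' fun i => ?_
    simp [e s hs]
  · refine ((h' a).mul_left (t : ℂ)).congr_fun' fun i => ?_
    simp [e t ht]

/-- The weight `2⁻ᵏ` is split as a square root on each side, so that the series becomes one
double-indexed sum form; the constant `2` is the sum of the weights. -/
theorem IsSumForm.flatten {ω : ℕ → StrongDual ℂ A} {Ω : StrongDual ℂ A}
    (h : ∀ k, IsSumForm φ ℕ 1 (ω k)) (hΩ : HasSum (fun k => ((1 / 2 : ℝ) ^ k) • ω k) Ω) :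
    IsSumForm φ (ℕ × ℕ) 2 Ω := by
  choose x y hx hxc hy hyc h using h
  set r : ℕ → ℝ := fun k => √((1 / 2) ^ k) with hr
  have hr2 : ∀ k, r k ^ 2 = (1 / 2) ^ k := fun k => Real.sq_sqrt (by positivity)
  have key : ∀ z : ℕ → ℕ → H, (∀ k, Summable fun i => ‖z k i‖ ^ 2) →
      (∀ k, ∑' i, ‖z k i‖ ^ 2 ≤ 1) →
      (Summable fun p : ℕ × ℕ => ‖(r p.1 : ℂ) • z p.1 p.2‖ ^ 2) ∧
      ∑' p : ℕ × ℕ, ‖(r p.1 : ℂ) • z p.1 p.2‖ ^ 2 ≤ 2 := by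
    intro z hz hz1
    have e : ∀ k i, ‖(r k : ℂ) • z k i‖ ^ 2 = (1 / 2) ^ k * ‖z k i‖ ^ 2 := by
      intro k i
      rw [norm_smul, mul_pow, ← hr2]; simp
    simp_rw [e]
    exact summable_geometric_prod (fun k i => sq_nonneg ‖z k i‖) hz hz1
  refine ⟨fun p => (r p.1 : ℂ) • x p.1 p.2, fun p => (r p.1 : ℂ) • y p.1 p.2, (key x hx hxc).1,
    (key x hx hxc).2, (key y hy hyc).1, (key y hy hyc).2, fun a => ?_⟩
  -- Absolute summability of the double family allows the double sum to be compared with the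
  -- iterated one.
  have hs : Summable fun p : ℕ × ℕ =>
      ⟪(r p.1 : ℂ) • x p.1 p.2, φ a ((r p.1 : ℂ) • y p.1 p.2)⟫_ℂ := by
    refine Summable.of_norm_bounded
      ((summable_inner_apply (key x hx hxc).1 (key y hy hyc).1).mul_left ‖φ a‖) fun p => ?_
    calc _ ≤ ‖(r p.1 : ℂ) • x p.1 p.2‖ * ‖φ a ((r p.1 : ℂ) • y p.1 p.2)‖ := norm_inner_le_norm _ _
      _ ≤ ‖(r p.1 : ℂ) • x p.1 p.2‖ * (‖φ a‖ * ‖(r p.1 : ℂ) • y p.1 p.2‖) := by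
        gcongr; exact (φ a).le_opNorm _
      _ = _ := by ring
  have h1 : ∀ k, HasSum (fun i => ⟪(r k : ℂ) • x k i, φ a ((r k : ℂ) • y k i)⟫_ℂ)
      (((1 / 2 : ℝ) ^ k) • ω k a) := by
    intro k
    refine ((h k a).const_smul ((1 / 2 : ℝ) ^ k)).congr_fun' fun i => ?_
    rw [map_smul, inner_smul_left, inner_smul_right, ← mul_assoc, ← hr2]
    simp [sq]
  have h2 : HasSum (fun k => ((1 / 2 : ℝ) ^ k) • ω k a) (Ω a) := by
    simpa using hΩ.mapL (ContinuousLinearMap.apply ℂ ℂ a)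
  have h3 := hs.hasSum.prod_fiberwise h1
  rw [← h3.unique h2]
  exact hs.hasSum

/-- A sum of vector functionals with finite square sums is normal. -/
theorem exists_mem_normalDual_hasSum (φ : A →⋆ₐ[ℂ] (H →L[ℂ] H)) {ι : Type*} {x y : ι → H}
    (hx : Summable fun i => ‖x i‖ ^ 2) (hy : Summable fun i => ‖y i‖ ^ 2) :
    ∃ ω ∈ normalDual φ, ∀ a, HasSum (fun i => ⟪x i, φ a (y i)⟫_ℂ) (ω a) := by
  have hs : Summable fun i => vecFun φ (x i) (y i) :=
    Summable.of_norm_bounded (summable_inner_apply hx hy) fun i => norm_vecFun_le φ _ _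
  refine ⟨_, ?_, fun a => hs.hasSum.mapL (ContinuousLinearMap.apply ℂ ℂ a)⟩
  refine (isClosed_normalDual φ).mem_of_tendsto hs.hasSum (Filter.Eventually.of_forall fun s => ?_)
  exact Submodule.sum_mem _ fun i _ => vecFun_mem φ _ _

theorem IsSumForm.mem_normalDual {ι : Type*} {c : ℝ} {ω : StrongDual ℂ A}
    (h : IsSumForm φ ι c ω) : ω ∈ normalDual φ := by
  obtain ⟨x, y, hx, -, hy, -, h⟩ := h
  obtain ⟨ω', hω', h'⟩ := exists_mem_normalDual_hasSum φ hx hy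
  convert hω'
  ext a
  exact (h a).unique (h' a)

variable (φ) in
/-- The Banach space of normal functionals. -/
def NormalDual : Type _ := normalDual φ

instance : NormedAddCommGroup (NormalDual φ) :=
  inferInstanceAs (NormedAddCommGroup (normalDual φ))

instance : NormedSpace ℂ (NormalDual φ) := inferInstanceAs (NormedSpace ℂ (normalDual φ))

instance : CompleteSpace (NormalDual φ) :=
  (isClosed_normalDual φ).completeSpace_coe

/-- A normal functional, as a bounded functional. -/
def NormalDual.val : NormalDual φ →L[ℂ] StrongDual ℂ A :=
  LinearMap.mkContinuous
    { toFun := fun w : NormalDual φ => Subtype.val (p := fun ω => ω ∈ normalDual φ) w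
      map_add' := fun _ _ => rfl
      map_smul' := fun _ _ => rfl } 1 fun w => (one_mul ‖w‖).ge

/-- The element of the Banach space of normal functionals given by a normal functional. -/
def NormalDual.mk (ω : StrongDual ℂ A) (h : ω ∈ normalDual φ) : NormalDual φ := ⟨ω, h⟩

@[simp] theorem NormalDual.val_mk (ω : StrongDual ℂ A) (h : ω ∈ normalDual φ) :
    (NormalDual.mk ω h).val = ω := rfl

theorem NormalDual.val_mem (w : NormalDual φ) : w.val ∈ normalDual φ := w.2

theorem NormalDual.val_injective : Function.Injective (NormalDual.val (φ := φ)) :=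
  Subtype.val_injective

variable (φ) in
/-- A faithful representation such that the algebra is the dual of its normal functionals. -/
structure IsDualRep : Prop where
  injective : Function.Injective φ
  exists_eq : ∀ F : StrongDual ℂ (NormalDual φ), ∃ a : A, ∀ ω : NormalDual φ, F ω = ω.val a

end Predual

/-- The successive approximation of the open mapping theorem: a point of the unit ball is
approximated by `S` up to `1/2`, and the doubled error lies in the unit ball again. -/
theorem exists_hasSum_of_ball_subset_closure {X : Type*} [NormedAddCommGroup X] [NormedSpace ℝ X]
    [CompleteSpace X]
    {S : Set X} (hS : Metric.ball 0 1 ⊆ closure S) {x : X} (hx : ‖x‖ < 1) :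
    ∃ s : ℕ → X, (∀ k, s k ∈ S) ∧ HasSum (fun k => ((1 / 2 : ℝ) ^ k) • s k) x := by
  have step : ∀ y : Metric.ball (0 : X) 1, ∃ s ∈ S, (2 : ℝ) • (y.1 - s) ∈ Metric.ball (0 : X) 1 := by
    intro y
    obtain ⟨s, hs, hd⟩ := Metric.mem_closure_iff.1 (hS y.2) (1 / 2) (by norm_num)
    refine ⟨s, hs, ?_⟩
    rw [dist_eq_norm] at hd
    rw [mem_ball_zero_iff, norm_smul]
    norm_num at hd ⊢
    linarith
  choose f hf hb using step
  let y : ℕ → Metric.ball (0 : X) 1 := fun k =>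
    Nat.rec ⟨x, by simpa using hx⟩ (fun _ z => ⟨_, hb z⟩) k
  have hy : ∀ k, (y (k + 1)).1 = (2 : ℝ) • ((y k).1 - f (y k)) := fun k => rfl
  refine ⟨fun k => f (y k), fun k => hf _, ?_⟩
  have hsum : ∀ n, ∑ k ∈ Finset.range n, ((1 / 2 : ℝ) ^ k) • f (y k) =
      x - ((1 / 2 : ℝ) ^ n) • (y n).1 := by
    intro n
    induction n with
    | zero => simp [y]
    | succ n ih =>
      rw [Finset.sum_range_succ, ih, hy, smul_smul, pow_succ, mul_assoc]
      norm_num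
      rw [smul_sub]
      abel
  have hlim : Filter.Tendsto (fun n => ((1 / 2 : ℝ) ^ n) • (y n).1) Filter.atTop (𝓝 0) := by
    have h0 : Filter.Tendsto (fun n => (1 / 2 : ℝ) ^ n) Filter.atTop (𝓝 0) :=
      tendsto_pow_atTop_nhds_zero_of_lt_one (by norm_num) (by norm_num)
    refine squeeze_zero_norm (fun n => ?_) h0
    rw [norm_smul, norm_pow]
    have := (mem_ball_zero_iff.1 (y n).2).le
    rw [Real.norm_of_nonneg (by norm_num : (0 : ℝ) ≤ 1 / 2)]
    exact mul_le_of_le_one_right (by positivity) this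
  have hS' : Summable fun k => ((1 / 2 : ℝ) ^ k) • f (y k) := by
    refine Summable.of_norm_bounded (summable_geometric_two.mul_left 2) fun k => ?_
    have h1 : ‖(y k).1 - f (y k)‖ < 1 := by
      have := mem_ball_zero_iff.1 (hb (y k))
      rw [norm_smul, Real.norm_two] at this
      linarith [norm_nonneg ((y k).1 - f (y k))]
    have h2 : ‖f (y k)‖ ≤ 2 := by
      have := norm_sub_le (y k).1 ((y k).1 - f (y k))
      rw [sub_sub_cancel] at this
      linarith [mem_ball_zero_iff.1 (y k).2]
    rw [norm_smul, norm_pow, mul_comm, Real.norm_of_nonneg (by norm_num : (0 : ℝ) ≤ 1 / 2)]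
    exact mul_le_mul_of_nonneg_right h2 (by positivity)
  rw [hS'.hasSum_iff_tendsto_nat]
  simp_rw [hsum]
  simpa using hlim.const_sub x

/-! ### Amplifications and their matrix entries -/

section Amplification

variable {H : Type*} [NormedAddCommGroup H] [InnerProductSpace ℂ H]

theorem starProjection_comm_of_invariant {L : Type*} [NormedAddCommGroup L]
    [InnerProductSpace ℂ L] [CompleteSpace L] (W : Submodule ℂ L) [W.HasOrthogonalProjection]
    {S : L →L[ℂ] L} (h1 : ∀ w ∈ W, S w ∈ W) (h2 : ∀ w ∈ W, S.adjoint w ∈ W) (z : L) :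
    W.starProjection (S z) = S (W.starProjection z) := by
  refine Submodule.eq_starProjection_of_mem_of_inner_eq_zero
    (h1 _ (W.starProjection_apply_mem z)) fun w hw => ?_
  rw [← map_sub, ← ContinuousLinearMap.adjoint_inner_right]
  exact W.starProjection_inner_eq_zero _ _ (h2 w hw)

omit [InnerProductSpace ℂ H] in
theorem memℓp_two_iff {ι : Type*} {f : ι → H} :
    Memℓp f 2 ↔ Summable fun i => ‖f i‖ ^ 2 := by
  rw [memℓp_gen_iff (by norm_num)]
  norm_num

omit [InnerProductSpace ℂ H] in
theorem lp_norm_sq {ι : Type*} (f : lp (fun _ : ι => H) 2) :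
    HasSum (fun i => ‖f i‖ ^ 2) (‖f‖ ^ 2) := by
  have := lp.hasSum_norm (p := 2) (by norm_num) f
  norm_num at this
  exact this

variable (ι : Type*)

theorem norm_sq_map_le (T : H →L[ℂ] H) (f : lp (fun _ : ι => H) 2) (i : ι) :
    ‖T (f i)‖ ^ 2 ≤ ‖T‖ ^ 2 * ‖f i‖ ^ 2 := by
  rw [← mul_pow]; gcongr; exact T.le_opNorm _

/-- The linear map `T ⊕ T ⊕ ⋯` on `H ⊕ H ⊕ ⋯`. -/
def ampLinear (T : H →L[ℂ] H) : lp (fun _ : ι => H) 2 →ₗ[ℂ] lp (fun _ : ι => H) 2 where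
  toFun := fun f => ⟨fun i => T (f i), memℓp_two_iff.2 <|
    ((lp_norm_sq f).summable.mul_left (‖T‖ ^ 2)).of_nonneg_of_le (fun i => by positivity)
      (norm_sq_map_le ι T f)⟩
  map_add' := fun f g => by ext i; exact map_add T _ _
  map_smul' := fun c f => by ext i; exact map_smul T _ _

/-- The operator `T ⊕ T ⊕ ⋯` on `H ⊕ H ⊕ ⋯`. -/
def amp (T : H →L[ℂ] H) : lp (fun _ : ι => H) 2 →L[ℂ] lp (fun _ : ι => H) 2 :=
  (ampLinear ι T).mkContinuous ‖T‖ fun f => by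
    refine (sq_le_sq₀ (norm_nonneg _) (by positivity)).1 ?_
    rw [mul_pow]
    have h1 := lp_norm_sq (ampLinear ι T f)
    have h2 := (lp_norm_sq f).mul_left (‖T‖ ^ 2)
    exact hasSum_le (norm_sq_map_le ι T f) h1 h2

@[simp] theorem amp_apply (T : H →L[ℂ] H) (f : lp (fun _ : ι => H) 2) (i : ι) :
    amp ι T f i = T (f i) := rfl

variable [CompleteSpace H]

theorem adjoint_amp (T : H →L[ℂ] H) : (amp ι T).adjoint = amp ι T.adjoint := by
  symm
  rw [ContinuousLinearMap.eq_adjoint_iff]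
  intro f g
  simp [lp.inner_eq_tsum, ContinuousLinearMap.adjoint_inner_left]

variable {ι} [DecidableEq ι]

/-- The matrix entries of an operator on `H ⊕ H ⊕ ⋯`. -/
def entry (P : lp (fun _ : ι => H) 2 →L[ℂ] lp (fun _ : ι => H) 2) (i j : ι) : H →L[ℂ] H :=
  lp.evalCLM ℂ (fun _ : ι => H) 2 i ∘L P ∘L
    (lp.singleContinuousLinearMap ℂ (fun _ : ι => H) 2 j)

theorem entry_apply (P : lp (fun _ : ι => H) 2 →L[ℂ] lp (fun _ : ι => H) 2) (i j : ι) (v : H) :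
    entry P i j v = P (lp.single 2 j v) i := rfl

theorem amp_single (T : H →L[ℂ] H) (j : ι) (v : H) :
    amp ι T (lp.single 2 j v) = lp.single 2 j (T v) := by
  ext i
  by_cases h : i = j
  · subst h; simp
  · simp [h]

/-- Vectors supported on one coordinate are total, and an amplification acts on them coordinatewise,
so commutation can be tested entry by entry. -/
theorem commute_amp_iff (P : lp (fun _ : ι => H) 2 →L[ℂ] lp (fun _ : ι => H) 2) (T : H →L[ℂ] H) :
    (∀ z, P (amp ι T z) = amp ι T (P z)) ↔ ∀ i j v, entry P i j (T v) = T (entry P i j v) := by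
  constructor
  · intro h i j v
    simp [entry_apply, ← amp_single, h]
  · intro h z
    have hz := lp.hasSum_single (p := 2) (by norm_num) z
    have h1 := hz.mapL (P ∘L amp ι T)
    have h2 := hz.mapL (amp ι T ∘L P)
    refine h1.unique (h2.congr_fun' fun j => ?_)
    ext i
    simpa [amp_single, entry_apply] using h i j (z j)

end Amplification

/-! ### The ultraweak double commutant theorem -/

section DoubleCommutant

variable {A H : Type*} [Ring A] [StarRing A] [Algebra ℂ A] [NormedAddCommGroup H] [InnerProductSpace ℂ H]
  [CompleteSpace H]

/-- The closed cyclic subspace of `H ⊕ H ⊕ ⋯` generated by `y`. -/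
def cyclic (φ : A →⋆ₐ[ℂ] (H →L[ℂ] H)) {ι : Type*} (y : lp (fun _ : ι => H) 2) :
    Submodule ℂ (lp (fun _ : ι => H) 2) :=
  (LinearMap.range ({ toFun := fun a => amp ι (φ a) y
                      map_add' := fun a b => by ext; simp
                      map_smul' := fun c a => by ext; simp } :
    A →ₗ[ℂ] lp (fun _ : ι => H) 2)).topologicalClosure

variable (φ : A →⋆ₐ[ℂ] (H →L[ℂ] H)) {ι : Type*} (y : lp (fun _ : ι => H) 2)

theorem amp_mem_cyclic (a : A) : amp ι (φ a) y ∈ cyclic φ y :=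
  Submodule.le_topologicalClosure _ ⟨a, rfl⟩

theorem self_mem_cyclic : y ∈ cyclic φ y := by
  convert amp_mem_cyclic φ y 1
  ext; simp

theorem cyclic_invariant (a : A) : ∀ w ∈ cyclic φ y, amp ι (φ a) w ∈ cyclic φ y := by
  intro w hw
  refine map_mem_closure (amp ι (φ a)).continuous hw ?_
  rintro _ ⟨b, rfl⟩
  refine ⟨a * b, ?_⟩
  ext; simp

theorem adjoint_map (a : A) : (φ a).adjoint = φ (star a) := by
  rw [map_star, ContinuousLinearMap.star_eq_adjoint]

instance : (cyclic φ y).HasOrthogonalProjection :=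
  haveI : CompleteSpace (cyclic φ y) := (Submodule.isClosed_topologicalClosure _).completeSpace_coe
  inferInstance

theorem starProjection_cyclic_comm (a : A) (z : lp (fun _ : ι => H) 2) :
    (cyclic φ y).starProjection (amp ι (φ a) z) = amp ι (φ a) ((cyclic φ y).starProjection z) := by
  refine starProjection_comm_of_invariant _ (cyclic_invariant φ y a) ?_ z
  rw [adjoint_amp, adjoint_map]
  exact cyclic_invariant φ y _

theorem entry_mem_centralizer [DecidableEq ι] (i j : ι) :
    entry (cyclic φ y).starProjection i j ∈ Set.centralizer (Set.range φ) := by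
  rintro _ ⟨a, rfl⟩
  ext v
  exact ((commute_amp_iff _ _).1 (starProjection_cyclic_comm φ y a) i j v).symm

/-- Von Neumann's argument: the projection on the cyclic subspace commutes with the amplified
algebra, so its entries lie in the commutant and commute with `T`. Hence it commutes with the
amplification of `T`, which therefore keeps `y` inside the cyclic subspace. -/
theorem amp_mem_cyclic_of_mem {T : H →L[ℂ] H}
    (hT : T ∈ Set.centralizer (Set.centralizer (Set.range φ))) : amp ι T y ∈ cyclic φ y := by
  classical
  have := (commute_amp_iff (cyclic φ y).starProjection T).2 fun i j v =>
    DFunLike.congr_fun (hT _ (entry_mem_centralizer φ y i j)) v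
  rw [← Submodule.starProjection_eq_self_iff, this,
    Submodule.starProjection_eq_self_iff.2 (self_mem_cyclic φ y)]

/-- The ultraweak double commutant theorem, for functionals. -/
theorem tsum_eq_zero_of_mem_centralizer {x y : ι → H} (hx : Summable fun i => ‖x i‖ ^ 2)
    (hy : Summable fun i => ‖y i‖ ^ 2) (h : ∀ a, ∑' i, ⟪x i, φ a (y i)⟫_ℂ = 0) {T : H →L[ℂ] H}
    (hT : T ∈ Set.centralizer (Set.centralizer (Set.range φ))) :
    ∑' i, ⟪x i, T (y i)⟫_ℂ = 0 := by
  let x' : lp (fun _ : ι => H) 2 := ⟨x, memℓp_two_iff.2 hx⟩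
  let y' : lp (fun _ : ι => H) 2 := ⟨y, memℓp_two_iff.2 hy⟩
  have h1 : ∀ w ∈ cyclic φ y', ⟪x', w⟫_ℂ = 0 := by
    intro w hw
    have hc : IsClosed {w | ⟪x', w⟫_ℂ = 0} := isClosed_eq (by fun_prop) continuous_const
    refine closure_minimal ?_ hc hw
    rintro _ ⟨a, rfl⟩
    exact (lp.inner_eq_tsum _ _).trans (h a)
  exact (lp.inner_eq_tsum _ _).symm.trans (h1 _ (amp_mem_cyclic_of_mem φ y' hT))

end DoubleCommutant

/-- By Hahn–Banach separation: a point of the ball outside the closure would be separated by a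
functional whose norm is at most the separating level. -/
theorem ball_subset_closure_of_dual {X : Type*} [NormedAddCommGroup X] [NormedSpace ℂ X]
    {S : Set X} (hS : Convex ℝ S)
    (h : ∀ (F : StrongDual ℂ X) (u : ℝ), (∀ s ∈ S, (F s).re < u) → ‖F‖ ≤ u) :
    Metric.ball (0 : X) 1 ⊆ closure S := by
  intro w hw
  by_contra hcl
  obtain ⟨F, u, hFu, huw⟩ := RCLike.geometric_hahn_banach_closed_point (𝕜 := ℂ)
    hS.closure isClosed_closure hcl
  have hF := h F u fun s hs => hFu s (subset_closure hs)
  have : (F w).re ≤ u := by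
    calc (F w).re ≤ ‖F w‖ := Complex.re_le_norm _
      _ ≤ ‖F‖ * ‖w‖ := F.le_opNorm w
      _ ≤ ‖F‖ * 1 := by gcongr; exact (mem_ball_zero_iff.1 hw).le
      _ ≤ u := by rwa [mul_one]
  exact absurd huw (not_lt.2 this)

/-! ### Representations in which an algebra is the dual of its normal functionals -/

section

variable {A H : Type*} [CStarAlgebra A] [NormedAddCommGroup H] [InnerProductSpace ℂ H]
  [CompleteSpace H] {φ : A →⋆ₐ[ℂ] (H →L[ℂ] H)}

theorem isSumForm_vecFun {x y : H} (hx : ‖x‖ ≤ 1) (hy : ‖y‖ ≤ 1) :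
    IsSumForm φ ℕ 1 (vecFun φ x y) := by
  have key : ∀ z : H, ‖z‖ ≤ 1 → HasSum (fun i : ℕ => ‖if i = 0 then z else 0‖ ^ 2) (‖z‖ ^ 2) := by
    intro z hz
    convert hasSum_single (f := fun i : ℕ => ‖if i = 0 then z else 0‖ ^ 2) 0 ?_ using 1
    · simp
    · intro i hi
      simp [hi]
  refine ⟨fun i => if i = 0 then x else 0, fun i => if i = 0 then y else 0, (key x hx).summable,
    ?_, (key y hy).summable, ?_, fun a => ?_⟩
  · rw [(key x hx).tsum_eq]; exact pow_le_one₀ (norm_nonneg _) hx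
  · rw [(key y hy).tsum_eq]; exact pow_le_one₀ (norm_nonneg _) hy
  · convert hasSum_single (f := fun i : ℕ => ⟪if i = 0 then x else 0,
      φ a (if i = 0 then y else 0)⟫_ℂ) 0 ?_ using 1
    · simp
    · intro i hi
      simp [hi]

theorem IsSumForm.convex : Convex ℝ {w : NormalDual φ | IsSumForm φ ℕ 1 w.val} := by
  intro v hv w hw s t hs ht hst
  have := (IsSumForm.combo hs ht hv hw).reindex Equiv.natSumNatEquivNat.symm
  rw [mul_one, mul_one, hst] at this
  exact this

theorem IsDualRep.norm_map (h : IsDualRep φ) (a : A) : ‖φ a‖ = ‖a‖ :=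
  NonUnitalStarAlgHom.norm_map φ h.injective a

/-- A functional on the predual is evaluation at some `a`. Its real part on the vector functionals
of unit vectors already recovers the operator norm of `φ a`, which equals `‖a‖` and dominates the
norm of the functional. -/
theorem IsDualRep.ball_subset (h : IsDualRep φ) :
    Metric.ball (0 : NormalDual φ) 1 ⊆ closure {w : NormalDual φ | IsSumForm φ ℕ 1 w.val} := by
  refine ball_subset_closure_of_dual IsSumForm.convex fun F u hFu => ?_
  obtain ⟨a, ha⟩ := h.exists_eq F
  have hS : ∀ x y : H, ‖x‖ ≤ 1 → ‖y‖ ≤ 1 → (⟪x, φ a y⟫_ℂ).re < u := by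
    intro x y hx hy
    have := hFu (.mk (vecFun φ x y) (vecFun_mem φ x y)) (isSumForm_vecFun hx hy)
    rwa [ha] at this
  have hu : 0 ≤ u := by simpa using (hS 0 0 (by simp) (by simp)).le
  have hau : ‖φ a‖ ≤ u := by
    refine ContinuousLinearMap.opNorm_le_of_unit_norm hu fun y hy => ?_
    by_cases h0 : φ a y = 0
    · simpa [h0] using hu
    -- Pairing with the normalised vector `φ a y` turns the real part into `‖φ a y‖`.
    have := hS ((‖φ a y‖⁻¹ : ℂ) • φ a y) y (by simp [norm_smul, h0]) hy.le
    rw [inner_smul_left, inner_self_eq_norm_sq_to_K] at this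
    have h1 : ‖φ a y‖ ≠ 0 := norm_ne_zero_iff.2 h0
    have e : (starRingEnd ℂ) (‖φ a y‖⁻¹ : ℂ) * ((‖φ a y‖ : ℂ)) ^ 2 = (‖φ a y‖ : ℂ) := by
      rw [map_inv₀, Complex.conj_ofReal]
      have : (‖φ a y‖ : ℂ) ≠ 0 := by exact_mod_cast h1
      field_simp
    erw [e] at this
    exact this.le
  rw [h.norm_map] at hau
  refine (ContinuousLinearMap.opNorm_le_bound _ (norm_nonneg a) fun w => ?_).trans hau
  rw [ha, mul_comm]
  exact w.val.le_opNorm a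

theorem IsSumForm.smul {ι : Type*} {c s : ℝ} (hs : 0 ≤ s) {ω : StrongDual ℂ A}
    (h : IsSumForm φ ι c ω) : IsSumForm φ (ι ⊕ ι) (s * c) (s • ω) := by
  have := h.combo hs le_rfl h
  rwa [zero_mul, add_zero, zero_smul ℝ ω, add_zero] at this

/-- Every normal functional is a sum of vector functionals. -/
theorem IsDualRep.exists_isSumForm (h : IsDualRep φ) {ω : StrongDual ℂ A} (hω : ω ∈ normalDual φ) :
    ∃ c, IsSumForm φ ℕ c ω := by
  -- The added `1` puts `t⁻¹ • ω` in the open unit ball, also when `ω = 0`; the successive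
  -- approximation then yields a sum form with constant `2`.
  set t : ℝ := ‖ω‖ + 1 with ht
  have ht0 : 0 < t := by positivity
  let w : NormalDual φ := .mk (t⁻¹ • ω) ((normalDual φ).smul_of_tower_mem _ hω)
  have hw : ‖w‖ < 1 := by
    change ‖t⁻¹ • ω‖ < 1
    rw [norm_smul, Real.norm_of_nonneg (by positivity), inv_mul_lt_one₀ ht0]
    linarith
  obtain ⟨s, hs, hsum⟩ := exists_hasSum_of_ball_subset_closure h.ball_subset hw
  have := ((IsSumForm.flatten (fun k => hs k)
    (hsum.mapL (NormalDual.val.restrictScalars ℝ))).reindex Nat.pairEquiv.symm).smul ht0.le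
  have e : t • (t⁻¹ • ω) = ω := by
    rw [smul_smul, mul_inv_cancel₀ ht0.ne', one_smul]
  refine ⟨t * 2, ?_⟩
  rw [← e]
  exact this.reindex Equiv.natSumNatEquivNat.symm

theorem mem_normalDual_iff (h : IsDualRep φ) {ω : StrongDual ℂ A} :
    ω ∈ normalDual φ ↔ ∃ x y : ℕ → H, (Summable fun i => ‖x i‖ ^ 2) ∧
      (Summable fun i => ‖y i‖ ^ 2) ∧ ∀ a, HasSum (fun i => ⟪x i, φ a (y i)⟫_ℂ) (ω a) := by
  constructor
  · intro hω
    obtain ⟨c, x, y, hx, -, hy, -, h⟩ := h.exists_isSumForm hω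
    exact ⟨x, y, hx, hy, h⟩
  · rintro ⟨x, y, hx, hy, h⟩
    exact IsSumForm.mem_normalDual ⟨x, y, hx, le_max_left _ (∑' i, ‖y i‖ ^ 2), hy,
      le_max_right _ _, h⟩



theorem exists_operator_of_form (b : H → H → ℂ) (C : ℝ)
    (h1 : ∀ x x' y, b (x + x') y = b x y + b x' y)
    (h2 : ∀ (c : ℂ) x y, b (c • x) y = (starRingEnd ℂ) c * b x y)
    (h3 : ∀ x y y', b x (y + y') = b x y + b x y')
    (h4 : ∀ (c : ℂ) x y, b x (c • y) = c * b x y)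
    (hC : ∀ x y, ‖b x y‖ ≤ C * ‖x‖ * ‖y‖) :
    ∃ T : H →L[ℂ] H, ∀ x y, ⟪x, T y⟫_ℂ = b x y := by
  let B : H →L⋆[ℂ] H →L[ℂ] ℂ :=
    LinearMap.mkContinuous₂ (LinearMap.mk₂'ₛₗ (starRingEnd ℂ) (RingHom.id ℂ) b h1 h2 h3 h4) C hC
  refine ⟨(InnerProductSpace.continuousLinearMapOfBilin B).adjoint, fun x y => ?_⟩
  rw [ContinuousLinearMap.adjoint_inner_right]
  exact InnerProductSpace.continuousLinearMapOfBilin_apply B x y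

/-- The functionals on which `F` and the evaluation at `a` agree form a closed subspace, and the
vector functionals span a dense one. -/
theorem NormalDual.eq_apply_of_vecFun (F : StrongDual ℂ (NormalDual φ)) (a : A)
    (h : ∀ x y, F (.mk (vecFun φ x y) (vecFun_mem φ x y)) = ⟪x, φ a y⟫_ℂ) (ω : NormalDual φ) :
    F ω = ω.val a := by
  let P : Submodule ℂ (NormalDual φ) := LinearMap.ker
    ((F - ContinuousLinearMap.apply ℂ ℂ a ∘L NormalDual.val : NormalDual φ →L[ℂ] ℂ) :
      NormalDual φ →ₗ[ℂ] ℂ)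
  have hP : normalDual φ ≤ P.map (NormalDual.val (φ := φ) : NormalDual φ →ₗ[ℂ] StrongDual ℂ A) := by
    refine normalDual_le φ ?_ fun x y => ⟨.mk _ (vecFun_mem φ x y), ?_, rfl⟩
    · have hi : Topology.IsClosedEmbedding (NormalDual.val (φ := φ)) :=
        (isClosed_normalDual φ).isClosedEmbedding_subtypeVal
      exact hi.isClosedMap _ (ContinuousLinearMap.isClosed_ker _)
    · exact sub_eq_zero.2 (h x y)
  obtain ⟨w, hw, hwω⟩ := hP ω.val_mem
  rw [← NormalDual.val_injective hwω]
  exact sub_eq_zero.1 hw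

/-- A functional `F` on the predual gives the bounded sesquilinear form `F (vecFun φ x y)`, hence an
operator `T`. For `c` in the commutant, `vecFun φ (c* x) y = vecFun φ x (c y)`, so `T` commutes with
`c` and lies in the bicommutant. -/
theorem isDualRep_of_centralizer (hinj : Function.Injective φ)
    (hφ : Set.centralizer (Set.centralizer (Set.range φ)) = Set.range φ) : IsDualRep φ := by
  refine ⟨hinj, fun F => ?_⟩
  let v : H → H → NormalDual φ := fun x y => .mk (vecFun φ x y) (vecFun_mem φ x y)
  have hv : ∀ x y, ‖v x y‖ ≤ ‖x‖ * ‖y‖ := fun x y => norm_vecFun_le φ x y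
  obtain ⟨T, hT⟩ := exists_operator_of_form (fun x y => F (v x y)) ‖F‖
    (fun x x' y => by
      rw [← map_add]; congr 1; refine NormalDual.val_injective ?_; ext a; exact inner_add_left _ _ _)
    (fun c x y => by
      rw [← smul_eq_mul, ← map_smul]; congr 1; refine NormalDual.val_injective ?_; ext a; exact inner_smul_left _ _ _)
    (fun x y y' => by
      rw [← map_add]; congr 1; refine NormalDual.val_injective ?_; ext a
      exact (congrArg _ (map_add (φ a) y y')).trans (inner_add_right _ _ _))
    (fun c x y => by
      rw [← smul_eq_mul, ← map_smul]; congr 1; refine NormalDual.val_injective ?_; ext a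
      exact (congrArg _ (map_smul (φ a) c y)).trans (inner_smul_right _ _ _))
    (fun x y => by
      rw [mul_assoc]; exact (F.le_opNorm _).trans (by gcongr; exact hv x y))
  have hTA : T ∈ Set.range φ := by
    rw [← hφ]
    intro c hc
    ext y
    refine ext_inner_left ℂ fun x => ?_
    change ⟪x, c (T y)⟫_ℂ = ⟪x, T (c y)⟫_ℂ
    rw [← ContinuousLinearMap.adjoint_inner_left, hT, hT]
    congr 1
    refine NormalDual.val_injective ?_
    ext a
    have := DFunLike.congr_fun (hc (φ a) ⟨a, rfl⟩) y
    change ⟪c.adjoint x, φ a y⟫_ℂ = ⟪x, φ a (c y)⟫_ℂ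
    rw [ContinuousLinearMap.adjoint_inner_left]
    exact congrArg _ this.symm
  obtain ⟨a, rfl⟩ := hTA
  refine ⟨a, fun ω => ?_⟩
  exact NormalDual.eq_apply_of_vecFun F a (fun x y => (hT x y).symm) ω

theorem isDualRep_id : IsDualRep (StarAlgHom.id ℂ (H →L[ℂ] H)) := by
  refine isDualRep_of_centralizer Function.injective_id ?_
  refine Set.Subset.antisymm (fun T _ => ⟨T, rfl⟩) Set.subset_centralizer_centralizer

/-- Restriction to the algebra maps the normal functionals of `B(H)` onto those of `φ`, by their
description as sums of vector functionals. Evaluation at an element `T` of the bicommutant vanishes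
on the kernel, by the double commutant theorem; it descends to the predual of the algebra and is
evaluation at some `a` with `φ a = T`. -/
theorem range_map_eq_centralizer (h : IsDualRep φ) :
    Set.centralizer (Set.centralizer (Set.range φ)) = Set.range φ := by
  refine Set.Subset.antisymm (fun T hT => ?_) Set.subset_centralizer_centralizer
  let I : (H →L[ℂ] H) →⋆ₐ[ℂ] (H →L[ℂ] H) := StarAlgHom.id ℂ _
  let φL : A →L[ℂ] (H →L[ℂ] H) :=
    LinearMap.mkContinuous (φ : A →ₗ[ℂ] (H →L[ℂ] H)) 1 fun a => by
      rw [one_mul]; exact NonUnitalStarAlgHom.norm_apply_le φ a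
  let R : StrongDual ℂ (H →L[ℂ] H) →L[ℂ] StrongDual ℂ A :=
    ContinuousLinearMap.precomp ℂ φL
  have hR : ∀ w : NormalDual I, R w.val ∈ normalDual φ := by
    intro w
    have : normalDual I ≤ (normalDual φ).comap (R : _ →ₗ[ℂ] _) :=
      normalDual_le I ((isClosed_normalDual φ).preimage R.continuous) fun x y => vecFun_mem φ x y
    exact this w.val_mem
  let r : NormalDual I →L[ℂ] NormalDual φ :=
    LinearMap.mkContinuous
      { toFun := fun w => .mk (R w.val) (hR w)
        map_add' := fun v w => rfl
        map_smul' := fun c w => rfl } ‖R‖ fun w => R.le_opNorm w.val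
  have hr : Function.Surjective r := by
    intro w
    obtain ⟨x, y, hx, hy, hw⟩ := (mem_normalDual_iff h).1 w.val_mem
    obtain ⟨v, hv, hsum⟩ := exists_mem_normalDual_hasSum I hx hy
    refine ⟨.mk v hv, NormalDual.val_injective ?_⟩
    ext a
    exact (hsum (φ a)).unique (hw a)
  have hker : ∀ w : NormalDual I, r w = 0 → w.val T = 0 := by
    intro w hw
    obtain ⟨x, y, hx, hy, hw'⟩ := (mem_normalDual_iff isDualRep_id).1 w.val_mem
    rw [← (hw' T).tsum_eq]
    refine tsum_eq_zero_of_mem_centralizer φ hx hy (fun a => ?_) hT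
    refine (hw' (φ a)).tsum_eq.trans ?_
    exact DFunLike.congr_fun (congrArg NormalDual.val hw) a
  let evT : NormalDual I →L[ℂ] ℂ :=
    ContinuousLinearMap.apply ℂ ℂ T ∘L NormalDual.val
  obtain ⟨F, hF⟩ : ∃ F : NormalDual φ →ₗ[ℂ] ℂ, ∀ w, F (r w) = evT w := by
    let e := LinearMap.quotKerEquivOfSurjective (r : NormalDual I →ₗ[ℂ] NormalDual φ) hr
    refine ⟨(Submodule.liftQ (LinearMap.ker (r : NormalDual I →ₗ[ℂ] NormalDual φ))
      (evT : NormalDual I →ₗ[ℂ] ℂ) hker) ∘ₗ (e.symm : _ →ₗ[ℂ] _), fun w => ?_⟩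
    have : e.symm (r w) = Submodule.Quotient.mk w := by
      rw [LinearEquiv.symm_apply_eq]; rfl
    rw [LinearMap.comp_apply, LinearEquiv.coe_coe, this]
    exact Submodule.liftQ_apply _ _ _
  -- By the open mapping theorem the restriction map is a quotient map, so the descended functional
  -- is continuous.
  have hFc : Continuous F := by
    have hq : IsOpenMap r := r.isOpenMap hr
    refine (hq.isQuotientMap r.continuous hr).continuous_iff.2 ?_
    exact evT.continuous.congr fun w => (hF w).symm
  obtain ⟨a, ha⟩ := h.exists_eq ⟨F, hFc⟩
  refine ⟨a, ?_⟩
  ext y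
  refine ext_inner_left ℂ fun x => ?_
  rw [← vecFun_apply, ← NormalDual.val_mk (vecFun φ x y) (vecFun_mem φ x y), ← ha (.mk (vecFun φ x y) (vecFun_mem φ x y))]
  exact hF (.mk (vecFun I x y) (vecFun_mem I x y))

end

theorem exists_dual_eq_zero_ne_zero {X : Type*} [NormedAddCommGroup X] [NormedSpace ℂ X]
    {N : Submodule ℂ X} (hN : IsClosed (N : Set X)) {x : X} (hx : x ∉ N) :
    ∃ F : StrongDual ℂ X, (∀ n ∈ N, F n = 0) ∧ F x ≠ 0 := by
  obtain ⟨F, u, hF, hu⟩ := RCLike.geometric_hahn_banach_closed_point (𝕜 := ℂ)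
    (N.restrictScalars ℝ).convex hN hx
  have hu0 : 0 < u := by simpa using hF 0 N.zero_mem
  refine ⟨F, fun n hn => ?_, fun h => ?_⟩
  · by_contra h0
    have := hF ((u / F n : ℂ) • n) (N.smul_mem _ hn)
    rw [map_smul, smul_eq_mul, div_mul_cancel₀ _ h0] at this
    simp at this
  · rw [h] at hu
    simp at hu
    linarith

/-! ### The weak-star topology read in a representation -/

section Topologies

variable {H : Type*} [NormedAddCommGroup H] [InnerProductSpace ℂ H]

theorem continuous_ultraweak_iff {α : Type*} [TopologicalSpace α] {g : α → H →L[ℂ] H} :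
    Continuous[inferInstance, ultraweak H] g ↔ ∀ x y : ℕ → H, (Summable fun n => ‖x n‖ ^ 2) →
      (Summable fun n => ‖y n‖ ^ 2) → Continuous fun a => ∑' n, ⟪x n, g a (y n)⟫_ℂ := by
  simp only [continuous_iInf_rng, continuous_induced_rng]
  rfl

variable [CompleteSpace H] {A : Type*} [CStarAlgebra A] {φ : A →⋆ₐ[ℂ] (H →L[ℂ] H)}

theorem IsDualRep.continuous_iff (h : IsDualRep φ) {α : Type*} [TopologicalSpace α] {g : α → A} :
    Continuous[inferInstance, ultraweak H] (fun a => φ (g a)) ↔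
      ∀ ω ∈ normalDual φ, Continuous fun a => ω (g a) := by
  rw [continuous_ultraweak_iff]
  constructor
  · intro hg ω hω
    obtain ⟨x, y, hx, hy, hs⟩ := (mem_normalDual_iff h).1 hω
    exact (hg x y hx hy).congr fun a => (hs _).tsum_eq
  · intro hg x y hx hy
    obtain ⟨ω, hω, hs⟩ := exists_mem_normalDual_hasSum φ hx hy
    exact (hg ω hω).congr fun a => (hs _).tsum_eq.symm

variable (φ) in
/-- The weak-star topology of an algebra given by a representation. -/
@[reducible] def repTopology : TopologicalSpace A :=
  TopologicalSpace.induced φ (ultraweak H)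

theorem repTopology_eq (h : IsDualRep φ) : repTopology φ =
    ⨅ ω : NormalDual φ, TopologicalSpace.induced (fun a : A => ω.val a) inferInstance := by
  refine le_antisymm (le_iInf fun ω => ?_) ?_
  · letI := repTopology φ
    exact continuous_iff_le_induced.1 ((h.continuous_iff.1 continuous_induced_dom) _ ω.val_mem)
  · letI : TopologicalSpace A :=
      ⨅ ω : NormalDual φ, TopologicalSpace.induced (fun a : A => ω.val a) inferInstance
    refine continuous_iff_le_induced.1 ((h.continuous_iff (g := id)).2 fun ω hω => ?_)
    exact continuous_iInf_dom (i := NormalDual.mk ω hω) continuous_induced_dom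

/-- A linear functional continuous for a weak topology lies in the span of the defining functionals,
and the normal functionals already form a subspace. -/
theorem IsDualRep.mem_normalDual_of_continuous (h : IsDualRep φ) (f : A →ₗ[ℂ] ℂ)
    (hf : Continuous[repTopology φ, inferInstance] f) : ∃ ω ∈ normalDual φ, ∀ a, ω a = f a := by
  rw [repTopology_eq h] at hf
  have := (LinearMap.mem_span_iff_continuous
    (f := fun ω : NormalDual φ => (ω.val : A →ₗ[ℂ] ℂ)) f).2 hf
  have hr : (Set.range fun ω : NormalDual φ => (ω.val : A →ₗ[ℂ] ℂ)) =
      ((normalDual φ).map (ContinuousLinearMap.coeLM ℂ) : Set (A →ₗ[ℂ] ℂ)) := by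
    ext g
    constructor
    · rintro ⟨ω, rfl⟩
      exact ⟨ω.val, ω.val_mem, rfl⟩
    · rintro ⟨ω, hω, rfl⟩
      exact ⟨.mk ω hω, rfl⟩
  rw [hr, Submodule.span_eq] at this
  obtain ⟨ω, hω, rfl⟩ := this
  exact ⟨ω, hω, fun _ => rfl⟩

end Topologies

/-! ### Faithful normal representations of abstract W*-algebras -/

section WStar

universe u

variable {M : Type u} [CStarAlgebra M] [WStarAlgebra M]

theorem weakStar_eq_iInf : ∃ (E : Type u) (_ : NormedAddCommGroup E) (_ : NormedSpace ℂ E)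
    (e : StrongDual ℂ E ≃ₗᵢ⋆[ℂ] M), weakStar M =
      ⨅ x : E, TopologicalSpace.induced (fun m : M => e.symm m x) inferInstance :=
  let h := ‹WStarAlgebra M›.exists_predual
  ⟨h.choose, h.choose_spec.choose, h.choose_spec.choose_spec.choose,
    h.choose_spec.choose_spec.choose_spec.choose_spec.some, rfl⟩

/-- The weak-star continuous functionals are given by the elements of a predual. -/
theorem exists_predual_embedding : ∃ (E : Type u) (_ : NormedAddCommGroup E) (_ : NormedSpace ℂ E)
    (e : StrongDual ℂ E ≃ₗᵢ⋆[ℂ] M) (κ : E →L⋆[ℂ] StrongDual ℂ M),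
      (∀ x m, κ x m = starRingEnd ℂ (e.symm m x)) ∧
      (weakStar M = ⨅ x : E, TopologicalSpace.induced (fun m : M => κ x m) inferInstance) ∧
      ∀ f : M →ₗ[ℂ] ℂ, Continuous[weakStar M, inferInstance] f → ∃ x, ∀ m, κ x m = f m := by
  obtain ⟨E, i1, i2, e, he⟩ := weakStar_eq_iInf (M := M)
  -- The identification of `M` with the dual of `E` is conjugate-linear; conjugating the evaluations
  -- makes them linear functionals on `M`.
  let κ : E →L⋆[ℂ] StrongDual ℂ M := LinearMap.mkContinuous₂
    (LinearMap.mk₂'ₛₗ (starRingEnd ℂ) (RingHom.id ℂ)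
      (fun (x : E) (m : M) => starRingEnd ℂ (e.symm m x))
      (fun x x' m => by simp) (fun c x m => by simp) (fun x m m' => by simp)
      (fun c x m => by simp [map_smulₛₗ])) 1 (fun x m => by
        change ‖starRingEnd ℂ (e.symm m x)‖ ≤ _
        rw [RCLike.norm_conj, one_mul, mul_comm]
        refine ((e.symm m).le_opNorm x).trans ?_
        rw [LinearIsometryEquiv.norm_map])
  have hκ : ∀ x m, κ x m = starRingEnd ℂ (e.symm m x) := fun x m => rfl
  have htop : weakStar M =
      ⨅ x : E, TopologicalSpace.induced (fun m : M => κ x m) inferInstance := by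
    rw [he]
    refine iInf_congr fun x => ?_
    have : (fun m : M => κ x m) = (starRingEnd ℂ : ℂ → ℂ) ∘ fun m => e.symm m x := rfl
    rw [this, ← induced_compose]
    congr 1
    exact (Complex.conjLIE.toHomeomorph.isInducing.eq_induced).symm.symm
  refine ⟨E, i1, i2, e, κ, hκ, htop, fun f hf => ?_⟩
  rw [htop] at hf
  have := (LinearMap.mem_span_iff_continuous (f := fun x : E => (κ x : M →ₗ[ℂ] ℂ)) f).2 hf
  clear hf
  induction this using Submodule.span_induction with
  | mem f h => obtain ⟨x, rfl⟩ := h; exact ⟨x, fun _ => rfl⟩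
  | zero => exact ⟨0, fun m => by simp⟩
  | add f g _ _ h1 h2 =>
    obtain ⟨x, hx⟩ := h1
    obtain ⟨y, hy⟩ := h2
    exact ⟨x + y, fun m => by rw [map_add]; exact congrArg₂ (· + ·) (hx m) (hy m)⟩
  | smul c f _ h1 =>
    obtain ⟨x, hx⟩ := h1
    refine ⟨starRingEnd ℂ c • x, fun m => ?_⟩
    rw [map_smulₛₗ, Complex.conj_conj]
    exact congrArg (c * ·) (hx m)

variable {H : Type*} [NormedAddCommGroup H] [InnerProductSpace ℂ H] [CompleteSpace H]
  {φ : M →⋆ₐ[ℂ] (H →L[ℂ] H)}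

omit [CompleteSpace H] in
theorem continuous_ultraweak_inner (x y : H) :
    Continuous[ultraweak H, inferInstance] fun T : H →L[ℂ] H => ⟪x, T y⟫_ℂ := by
  letI := ultraweak H
  have key : ∀ z : H, Summable fun n : ℕ => ‖if n = 0 then z else 0‖ ^ 2 := fun z =>
    summable_of_ne_finset_zero (s := {0}) fun n hn => by simp_all
  have := continuous_ultraweak_iff.1 (continuous_id (X := H →L[ℂ] H)) (fun n => if n = 0 then x else 0)
    (fun n => if n = 0 then y else 0) (key x) (key y)
  refine this.congr fun T => ?_
  rw [tsum_eq_single 0]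
  · simp
  · intro n hn; simp [hn]

/-- A faithful normal representation of a W*-algebra, in terms of functionals. -/
theorem IsFaithfulNormal.isDualRep_and (hφ : IsFaithfulNormal φ) :
    IsDualRep φ ∧ ∀ f : M →ₗ[ℂ] ℂ, Continuous[weakStar M, inferInstance] f →
      ∃ ω ∈ normalDual φ, ∀ m, ω m = f m := by
  obtain ⟨E, i1, i2, e, κ, hκ, htop, hfun⟩ := exists_predual_embedding (M := M)
  have hvec : ∀ x y : H, ∃ z, κ z = vecFun φ x y := by
    intro x y
    obtain ⟨z, hz⟩ := hfun (vecFun φ x y) (by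
      exact @Continuous.comp _ _ _ (weakStar M) (ultraweak H) _ _ _
        (continuous_ultraweak_inner x y) hφ.normal)
    exact ⟨z, ContinuousLinearMap.ext hz⟩
  -- The part of the given predual formed by limits of combinations of vector functionals; it turns
  -- out to be all of `E`.
  let N : Submodule ℂ E := (normalDual φ).comap (κ : E →ₗ⋆[ℂ] StrongDual ℂ M)
  have hN : IsClosed (N : Set E) := (isClosed_normalDual φ).preimage κ.continuous
  refine ⟨⟨hφ.injective, fun F => ?_⟩, fun f hf => ?_⟩
  · let K : N →ₗ[ℂ] ℂ :=
      { toFun := fun x => starRingEnd ℂ (F (.mk (κ x.1) x.2))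
        map_add' := fun x y => by
          rw [← map_add, ← map_add]; congr 2
          exact NormalDual.val_injective (map_add κ x.1 y.1)
        map_smul' := fun c x => by
          have : NormalDual.mk (κ (c • x).1) (c • x).2 =
              starRingEnd ℂ c • NormalDual.mk (κ x.1) x.2 :=
            NormalDual.val_injective (map_smulₛₗ κ c x.1)
          rw [this, map_smul]
          simp }
    let K' : N →L[ℂ] ℂ := K.mkContinuous (‖F‖ * ‖κ‖) fun x => by
      change ‖starRingEnd ℂ (F (.mk (κ x.1) x.2))‖ ≤ _
      rw [RCLike.norm_conj, mul_assoc]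
      exact (F.le_opNorm _).trans (by gcongr; exact κ.le_opNorm _)
    -- Transporting `F` to `N` and extending it by Hahn–Banach to `E` gives an element of the dual
    -- of `E`, that is, an element `e G` of `M`.
    obtain ⟨G, hG, -⟩ := exists_extension_norm_eq N K'
    refine ⟨e G, fun ω => NormalDual.eq_apply_of_vecFun F (e G) (fun x y => ?_) ω⟩
    obtain ⟨z, hz⟩ := hvec x y
    have hzN : z ∈ N := by
      change κ z ∈ normalDual φ
      rw [hz]; exact vecFun_mem φ x y
    have h1 := hG ⟨z, hzN⟩
    have h2 : K' ⟨z, hzN⟩ = starRingEnd ℂ (F (.mk (κ z) hzN)) := rfl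
    rw [h2] at h1
    rw [← vecFun_apply]
    have h3 := hκ z (e G)
    rw [LinearIsometryEquiv.symm_apply_apply, h1, Complex.conj_conj] at h3
    simp only [hz] at h3
    exact h3.symm
  · obtain ⟨x, hx⟩ := hfun f hf
    refine ⟨κ x, ?_, hx⟩
    -- A functional that separates `x` from `N` corresponds to an element of `M` killed by all
    -- vector functionals. Such an element is zero because the representation is faithful.
    by_contra hxN
    obtain ⟨G, hG, hGx⟩ := exists_dual_eq_zero_ne_zero hN (x := x) hxN
    have hzero : e G = 0 := by
      refine hφ.injective ?_
      rw [map_zero]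
      ext y
      refine ext_inner_left ℂ fun x => ?_
      obtain ⟨z, hz⟩ := hvec x y
      have hzN : z ∈ N := by
        change κ z ∈ normalDual φ
        rw [hz]; exact vecFun_mem φ x y
      rw [← vecFun_apply, ← hz, hκ, LinearIsometryEquiv.symm_apply_apply, hG z hzN]
      simp
    rw [map_eq_zero_iff e e.injective] at hzero
    simp [hzero] at hGx

theorem IsFaithfulNormal.isDualRep (hφ : IsFaithfulNormal φ) : IsDualRep φ := hφ.isDualRep_and.1

theorem IsFaithfulNormal.weakStar_eq (hφ : IsFaithfulNormal φ) :
    weakStar M = repTopology φ := by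
  refine le_antisymm (continuous_iff_le_induced.1 hφ.normal) ?_
  obtain ⟨E, i1, i2, e, κ, hκ, htop, hfun⟩ := exists_predual_embedding (M := M)
  rw [repTopology_eq hφ.isDualRep, htop]
  refine le_iInf fun x => ?_
  have hc : Continuous[weakStar M, inferInstance] (κ x : M →ₗ[ℂ] ℂ) := by
    rw [htop]
    exact continuous_iInf_dom (i := x) continuous_induced_dom
  obtain ⟨ω, hω, h⟩ := hφ.isDualRep_and.2 _ hc
  refine (iInf_le _ (NormalDual.mk ω hω)).trans (le_of_eq ?_)
  congr 1
  exact funext h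

end WStar

/-! ### Real subspaces -/

section Real

variable {E : Type*} [NormedAddCommGroup E] [InnerProductSpace ℝ E] [CompleteSpace E]

/-- The powers of a symmetric operator between `0` and `1` converge strongly to fixed points. -/
theorem exists_tendsto_iterate (A : E →L[ℝ] E) (hs : ∀ v w, ⟪A v, w⟫_ℝ = ⟪v, A w⟫_ℝ)
    (hA : ∀ v, ‖A v‖ ^ 2 ≤ ⟪A v, v⟫_ℝ) (v : E) :
    ∃ u, A u = u ∧ Filter.Tendsto (fun n => A^[n] v) Filter.atTop (𝓝 u) := by
  set f : ℕ → E := fun n => A^[n] v with hf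
  have hf1 : ∀ n, f (n + 1) = A (f n) := fun n => Function.iterate_succ_apply' _ _ _
  have hsymm : ∀ m n, ⟪f m, f n⟫_ℝ = ⟪f (m + n), v⟫_ℝ := by
    intro m n
    induction n generalizing m with
    | zero => rfl
    | succ n ih => rw [hf1, ← hs, ← hf1, ih, Nat.add_right_comm, Nat.add_assoc]
  set c : ℕ → ℝ := fun n => ⟪f n, v⟫_ℝ with hc
  have hle : ∀ w, ⟪A w, w⟫_ℝ ≤ ‖w‖ ^ 2 := by
    intro w
    have h1 := hA w
    have h2 := real_inner_le_norm (A w) w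
    nlinarith [sq_nonneg (‖A w‖ - ‖w‖), norm_nonneg (A w), norm_nonneg w]
  -- Even steps use `A ≤ 1`, odd steps use `A² ≤ A`.
  have hanti : Antitone c := by
    refine antitone_nat_of_succ_le fun n => ?_
    rcases Nat.even_or_odd' n with ⟨k, rfl | rfl⟩
    · have := hle (f k)
      rw [← hf1, hsymm, ← real_inner_self_eq_norm_sq, hsymm] at this
      rwa [show k + 1 + k = 2 * k + 1 by ring, show k + k = 2 * k by ring] at this
    · have := hA (f k)
      rw [← hf1, hsymm, ← real_inner_self_eq_norm_sq, hsymm] at this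
      rwa [show k + 1 + (k + 1) = 2 * k + 1 + 1 by ring, show k + 1 + k = 2 * k + 1 by ring]
        at this
  have hbdd : BddBelow (Set.range c) := by
    refine ⟨0, ?_⟩
    rintro _ ⟨n, rfl⟩
    refine le_trans ?_ (hanti (show n ≤ n + n by omega))
    change 0 ≤ ⟪f (n + n), v⟫_ℝ
    rw [← hsymm]
    exact real_inner_self_nonneg
  obtain ⟨l, hl⟩ : ∃ l, Filter.Tendsto c Filter.atTop (𝓝 l) :=
    ⟨_, tendsto_atTop_ciInf hanti hbdd⟩
  -- By symmetry `‖f n - f m‖² = c (2n) - 2 c (n + m) + c (2m)`, which is at most `c (2n) - l` for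
  -- `n ≤ m`.
  have hcau : CauchySeq f := by
    refine cauchySeq_of_le_tendsto_0' (fun n => √(c (n + n) - l)) (fun n m hnm => ?_) ?_
    · rw [dist_eq_norm]
      refine Real.le_sqrt_of_sq_le ?_
      rw [norm_sub_sq_real, ← real_inner_self_eq_norm_sq, ← real_inner_self_eq_norm_sq, hsymm,
        hsymm, hsymm]
      have h1 : c (m + m) ≤ c (n + m) := hanti (by omega)
      have h2 : l ≤ c (n + m) := hanti.le_of_tendsto hl _
      change c (n + n) - 2 * c (n + m) + c (m + m) ≤ c (n + n) - l
      linarith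
    · have h2 : Filter.Tendsto (fun n => c (n + n)) Filter.atTop (𝓝 l) :=
        hl.comp (Filter.tendsto_atTop_mono (fun n => by simp) Filter.tendsto_id)
      have := (Real.continuous_sqrt.tendsto _).comp (h2.sub_const l)
      simpa [Function.comp_def] using this
  obtain ⟨u, hu⟩ := cauchySeq_tendsto_of_complete hcau
  refine ⟨u, ?_, hu⟩
  refine tendsto_nhds_unique ?_ ((Filter.tendsto_add_atTop_iff_nat 1).2 hu)
  simp_rw [hf1]
  exact (A.continuous.tendsto u).comp hu

omit [CompleteSpace E] in
theorem sub_starProjection (p : Submodule ℝ E) [p.HasOrthogonalProjection] (x : E) :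
    x - p.starProjection x = pᗮ.starProjection x := by
  rw [Submodule.starProjection_orthogonal']; rfl

variable {F : Type*} [NormedAddCommGroup F] [InnerProductSpace ℝ F]

/-- A bounded bilinear form that vanishes on four pairs of real subspaces. -/
theorem bilin_eq_zero_of_four (p₁ q₁ : Submodule ℝ F) (p₂ q₂ : Submodule ℝ E)
    [p₁.HasOrthogonalProjection] [q₁.HasOrthogonalProjection] [p₂.HasOrthogonalProjection]
    [q₂.HasOrthogonalProjection] (β : F →L[ℝ] E →L[ℝ] ℝ)
    (h1 : ∀ x ∈ p₁, ∀ v ∈ p₂, β x v = 0) (h2 : ∀ x ∈ q₁, ∀ v ∈ q₂, β x v = 0)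
    (h3 : ∀ x ∈ p₁ᗮ, ∀ v ∈ q₂ᗮ, β x v = 0) (h4 : ∀ x ∈ q₁ᗮ, ∀ v ∈ p₂ᗮ, β x v = 0)
    (h5 : ∀ x, ∀ v ∈ p₂ᗮ, v ∈ q₂ᗮ → β x v = 0) : ∀ x ∈ p₁, ∀ v, β x v = 0 := by
  let A : E →L[ℝ] E := p₂ᗮ.starProjection ∘L q₂ᗮ.starProjection ∘L p₂ᗮ.starProjection
  let B : F → F := fun x => p₁.starProjection (q₁.starProjection x)
  have hBp : ∀ x, B x ∈ p₁ := fun x => p₁.starProjection_apply_mem _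
  have hBn : ∀ x, ‖B x‖ ≤ ‖x‖ := fun x =>
    (p₁.norm_starProjection_apply_le _).trans (q₁.norm_starProjection_apply_le _)
  -- The four vanishing conditions insert projections in alternation: on the second variable from
  -- `h1`, on the first from `h4`, then from `h2`, `h3` and `h1` again.
  have step : ∀ x ∈ p₁, ∀ v, β x v = β (B x) (A v) := by
    intro x hx v
    have e1 : ∀ y ∈ p₁, ∀ v, β y v = β y (p₂ᗮ.starProjection v) := by
      intro y hy v
      rw [← sub_starProjection, map_sub, h1 y hy _ (p₂.starProjection_apply_mem v), sub_zero]
    rw [e1 x hx]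
    set w := p₂ᗮ.starProjection v
    have hw : w ∈ p₂ᗮ := p₂ᗮ.starProjection_apply_mem v
    have e2 : β x w = β (q₁.starProjection x) w := by
      have := h4 _ (q₁ᗮ.starProjection_apply_mem x) w hw
      rw [← sub_starProjection, map_sub, sub_apply, sub_eq_zero] at this
      exact this
    have e3 : β (q₁.starProjection x) w = β (q₁.starProjection x) (q₂ᗮ.starProjection w) := by
      rw [← sub_starProjection, map_sub, h2 _ (q₁.starProjection_apply_mem x) _ (q₂.starProjection_apply_mem w),
        sub_zero]
    have e4 : β (q₁.starProjection x) (q₂ᗮ.starProjection w) = β (B x) (q₂ᗮ.starProjection w) := by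
      have := h3 _ (p₁ᗮ.starProjection_apply_mem (q₁.starProjection x)) _
        (q₂ᗮ.starProjection_apply_mem w)
      rw [← sub_starProjection, map_sub, sub_apply, sub_eq_zero] at this
      exact this
    rw [e2, e3, e4, e1 _ (hBp x)]
    rfl
  intro x hx v
  -- The iterates of `B` stay bounded while those of `A` converge to a vector of `p₂ᗮ ⊓ q₂ᗮ`, where
  -- `β` vanishes by `h5`.
  have iter : ∀ n, β x v = β (B^[n] x) (A^[n] v) ∧ B^[n] x ∈ p₁ ∧ ‖B^[n] x‖ ≤ ‖x‖ := by
    intro n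
    induction n with
    | zero => exact ⟨rfl, hx, le_rfl⟩
    | succ n ih =>
      rw [Function.iterate_succ_apply', Function.iterate_succ_apply', ← step _ ih.2.1]
      exact ⟨ih.1, hBp _, (hBn _).trans ih.2.2⟩
  have hAs : ∀ v w, ⟪A v, w⟫_ℝ = ⟪v, A w⟫_ℝ := by
    intro v w
    simp only [A, ContinuousLinearMap.comp_apply]
    rw [Submodule.inner_starProjection_left_eq_right, Submodule.inner_starProjection_left_eq_right,
      Submodule.inner_starProjection_left_eq_right]
  have hAv : ∀ v, ⟪A v, v⟫_ℝ = ‖q₂ᗮ.starProjection (p₂ᗮ.starProjection v)‖ ^ 2 := by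
    intro v
    simp only [A, ContinuousLinearMap.comp_apply]
    rw [← real_inner_self_eq_norm_sq, p₂ᗮ.inner_starProjection_left_eq_right,
      q₂ᗮ.inner_starProjection_left_eq_right, q₂ᗮ.inner_starProjection_left_eq_right,
      Submodule.starProjection_eq_self_iff.2 (q₂ᗮ.starProjection_apply_mem _)]
  obtain ⟨u, hu, hlim⟩ := exists_tendsto_iterate A hAs (fun v => by
    rw [hAv]
    gcongr
    exact p₂ᗮ.norm_starProjection_apply_le _) v
  have hup : u ∈ p₂ᗮ := by
    rw [← hu]; exact p₂ᗮ.starProjection_apply_mem _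
  have huq : u ∈ q₂ᗮ := by
    have h := hAv u
    rw [hu, real_inner_self_eq_norm_sq, Submodule.starProjection_eq_self_iff.2 hup] at h
    have h' : ‖q₂ᗮ.starProjection u‖ = ‖u‖ :=
      ((sq_eq_sq₀ (norm_nonneg _) (norm_nonneg _)).1 h).symm
    exact (Submodule.mem_iff_norm_starProjection _ _).2 h'
  have hlim' : Filter.Tendsto (fun n => ‖β‖ * ‖x‖ * ‖A^[n] v - u‖) Filter.atTop (𝓝 0) := by
    have := ((hlim.sub_const u).norm).const_mul (‖β‖ * ‖x‖)
    simpa using this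
  refine norm_le_zero_iff.1 (ge_of_tendsto' hlim' fun n => ?_)
  obtain ⟨h, -, h'⟩ := iter n
  rw [h, ← sub_zero (β (B^[n] x) (A^[n] v)), ← h5 (B^[n] x) u hup huq, ← map_sub]
  refine (β.le_opNorm₂ _ _).trans ?_
  gcongr

end Real

/-! ### Real orbits -/

section Orbit

attribute [local instance] InnerProductSpace.complexToReal

variable {A H : Type*} [CStarAlgebra A] [NormedAddCommGroup H] [InnerProductSpace ℂ H]
  [CompleteSpace H] (φ : A →⋆ₐ[ℂ] (H →L[ℂ] H)) (ξ : H)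

/-- The closed cyclic subspace generated by `ξ`. -/
def orbit : Submodule ℂ H :=
  (LinearMap.range ({ toFun := fun a => φ a ξ
                      map_add' := fun a b => by simp
                      map_smul' := fun c a => by simp } : A →ₗ[ℂ] H)).topologicalClosure

/-- The closed real subspace generated by the `a ξ` with `a` self-adjoint. -/
def realOrbit : Submodule ℝ H :=
  (Submodule.span ℝ {v | ∃ a, IsSelfAdjoint a ∧ φ a ξ = v}).topologicalClosure

instance : (orbit φ ξ).HasOrthogonalProjection :=
  haveI : CompleteSpace (orbit φ ξ) := (Submodule.isClosed_topologicalClosure _).completeSpace_coe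
  inferInstance

instance : (realOrbit φ ξ).HasOrthogonalProjection :=
  haveI : CompleteSpace (realOrbit φ ξ) :=
    (Submodule.isClosed_topologicalClosure _).completeSpace_coe
  inferInstance

variable {φ ξ}

theorem map_mem_orbit (a : A) : φ a ξ ∈ orbit φ ξ :=
  Submodule.le_topologicalClosure _ ⟨a, rfl⟩

theorem self_mem_orbit : ξ ∈ orbit φ ξ := by
  simpa using map_mem_orbit (φ := φ) (ξ := ξ) 1

theorem orbit_le {W : Submodule ℂ H} (hW : IsClosed (W : Set H)) (h : ∀ a, φ a ξ ∈ W) :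
    orbit φ ξ ≤ W :=
  Submodule.topologicalClosure_minimal _ (by rintro _ ⟨a, rfl⟩; exact h a) hW

theorem orbit_invariant (a : A) {v : H} (hv : v ∈ orbit φ ξ) : φ a v ∈ orbit φ ξ := by
  refine map_mem_closure (φ a).continuous hv ?_
  rintro _ ⟨b, rfl⟩
  exact ⟨a * b, by simp⟩

theorem map_mem_realOrbit {a : A} (ha : IsSelfAdjoint a) : φ a ξ ∈ realOrbit φ ξ :=
  Submodule.le_topologicalClosure _ (Submodule.subset_span ⟨a, ha, rfl⟩)

theorem starProjection_orbit_mem :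
    (orbit φ ξ).starProjection ∈ Set.centralizer (Set.range φ) := by
  rintro _ ⟨a, rfl⟩
  ext v
  refine (starProjection_comm_of_invariant (orbit φ ξ) (S := φ a)
    (fun w hw => orbit_invariant a hw) (fun w hw => ?_) v).symm
  rw [adjoint_map]
  exact orbit_invariant _ hw

theorem isSelfAdjoint_orbit : IsSelfAdjoint (orbit φ ξ).starProjection :=
  isSelfAdjoint_starProjection _

theorem inner_eq_zero_of_re {v : H}
    (h : ∀ a, IsSelfAdjoint a → (⟪φ a ξ, v⟫_ℂ).re = 0)
    (h' : ∀ a, IsSelfAdjoint a → (⟪φ a ξ, v⟫_ℂ).im = 0) (a : A) : ⟪φ a ξ, v⟫_ℂ = 0 := by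
  have h0 : ∀ a, IsSelfAdjoint a → ⟪φ a ξ, v⟫_ℂ = 0 := fun a ha => Complex.ext (h a ha) (h' a ha)
  rw [← realPart_add_I_smul_imaginaryPart a, map_add, map_smul, add_apply,
    smul_apply, inner_add_left, inner_smul_left, h0 _ (realPart a).2,
    h0 _ (imaginaryPart a).2]
  simp

theorem inner_add_inner_eq_zero {ζ : H} (h : ∀ a, IsSelfAdjoint a → (⟪φ a ξ, ζ⟫_ℂ).re = 0) (a : A) :
    ⟪φ a ξ, ζ⟫_ℂ + ⟪φ a ζ, ξ⟫_ℂ = 0 := by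
  have hsa : ∀ a, IsSelfAdjoint a → ⟪φ a ξ, ζ⟫_ℂ + ⟪φ a ζ, ξ⟫_ℂ = 0 := by
    intro a ha
    have : ⟪φ a ζ, ξ⟫_ℂ = (starRingEnd ℂ) ⟪φ a ξ, ζ⟫_ℂ := by
      rw [inner_conj_symm, ← ContinuousLinearMap.adjoint_inner_right, adjoint_map, ha.star_eq]
    rw [this, Complex.add_conj, h a ha]
    simp
  rw [← realPart_add_I_smul_imaginaryPart a, map_add, map_smul]
  simp only [add_apply, smul_apply, inner_add_left, inner_smul_left]
  have e1 := hsa _ (realPart a).2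
  have e2 := hsa _ (imaginaryPart a).2
  linear_combination e1 + (starRingEnd ℂ) Complex.I * e2

theorem star_mem_centralizer_range {y : H →L[ℂ] H} (hy : y ∈ Set.centralizer (Set.range φ)) :
    star y ∈ Set.centralizer (Set.range φ) := by
  rintro _ ⟨a, rfl⟩
  have := congrArg star (hy _ ⟨star a, rfl⟩)
  rw [star_mul, star_mul, map_star, star_star] at this
  exact this.symm

/-- For self-adjoint `y` the two sides are complex conjugates, so real values mean equality. The
general case follows from the self-adjoint combinations `y + y*` and `i (y - y*)`. -/
theorem inner_comm_of_im {ζ : H}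
    (h' : ∀ y ∈ Set.centralizer (Set.range φ), IsSelfAdjoint y → (⟪y ξ, ζ⟫_ℂ).im = 0) :
    ∀ y ∈ Set.centralizer (Set.range φ), ⟪y ξ, ζ⟫_ℂ = ⟪y ζ, ξ⟫_ℂ := by
  have hsa : ∀ y ∈ Set.centralizer (Set.range φ), IsSelfAdjoint y → ⟪y ξ, ζ⟫_ℂ = ⟪y ζ, ξ⟫_ℂ := by
    intro y hS hy
    have : ⟪y ζ, ξ⟫_ℂ = (starRingEnd ℂ) ⟪y ξ, ζ⟫_ℂ := by
      rw [inner_conj_symm, ← ContinuousLinearMap.adjoint_inner_right, hy.adjoint_eq]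
    rw [this]
    exact (Complex.conj_eq_iff_im.2 (h' _ hS hy)).symm
  have hmem : ∀ (c : ℂ) (y z : H →L[ℂ] H), y ∈ Set.centralizer (Set.range φ) →
      z ∈ Set.centralizer (Set.range φ) → c • (y + z) ∈ Set.centralizer (Set.range φ) := by
    intro c y z hy hz
    have h := (Subalgebra.centralizer ℂ (Set.range φ)).smul_mem
      ((Subalgebra.centralizer ℂ (Set.range φ)).add_mem hy hz) c
    exact h
  intro y hy
  have hy' := star_mem_centralizer_range hy
  have e1 := hsa _ (hmem 1 _ _ hy hy') (by simp [isSelfAdjoint_iff, add_comm])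
  have e2 := hsa _ (hmem Complex.I _ _ hy (hmem (-1) _ 0 hy' (by
    intro a _; simp))) (by simp [isSelfAdjoint_iff]; abel_nf)
  simp only [add_apply, smul_apply, inner_add_left, inner_smul_left, zero_apply, inner_zero_left,
    Complex.conj_I, map_neg, map_one, add_zero] at e1 e2
  linear_combination (1 / 2) * e1 + (Complex.I / 2) * e2 + (1 / 2) *
    (⟪y ξ, ζ⟫_ℂ - ⟪y ζ, ξ⟫_ℂ - ⟪star y ξ, ζ⟫_ℂ + ⟪star y ζ, ξ⟫_ℂ) * Complex.I_sq

theorem inner_entry_self {ι : Type*} [DecidableEq ι] (W : Submodule ℂ (lp (fun _ : ι => H) 2))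
    [W.HasOrthogonalProjection] (i : ι) (v : H) :
    ⟪entry W.starProjection i i v, v⟫_ℂ = (‖W.starProjection (lp.single 2 i v)‖ : ℂ) ^ 2 := by
  have : ⟪entry W.starProjection i i v, v⟫_ℂ =
      ⟪W.starProjection (lp.single 2 i v), lp.single 2 i v⟫_ℂ := by
    rw [lp.inner_single_right, entry_apply]
  rw [this, ← Submodule.starProjection_eq_self_iff.2 (W.starProjection_apply_mem (lp.single 2 i v)),
    Submodule.inner_starProjection_left_eq_right,
    Submodule.starProjection_eq_self_iff.2 (W.starProjection_apply_mem (lp.single 2 i v)),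
    inner_self_eq_norm_sq_to_K]
  rfl

/-- The element `(v, w)` of `H ⊕ H`. -/
def lpPair (v w : H) : lp (fun _ : Fin 2 => H) 2 := lp.single 2 0 v + lp.single 2 1 w

omit [CompleteSpace H] in
@[simp] theorem lpPair_zero (v w : H) : lpPair v w 0 = v := by simp [lpPair]

omit [CompleteSpace H] in
@[simp] theorem lpPair_one (v w : H) : lpPair v w 1 = w := by simp [lpPair]

omit [CompleteSpace H] in
theorem inner_fin_two (f g : lp (fun _ : Fin 2 => H) 2) :
    ⟪f, g⟫_ℂ = ⟪f 0, g 0⟫_ℂ + ⟪f 1, g 1⟫_ℂ := by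
  rw [lp.inner_eq_tsum, tsum_fintype, Fin.sum_univ_two]

theorem apply_lpPair (P : lp (fun _ : Fin 2 => H) 2 →L[ℂ] lp (fun _ : Fin 2 => H) 2) (v w : H)
    (i : Fin 2) : P (lpPair v w) i = entry P i 0 v + entry P i 1 w := by
  rw [lpPair, map_add, entry_apply, entry_apply]
  rfl

/-- Write `E` and `E'` for the entries `00` and `01` of the projection. The hypotheses give `E ξ +
E' ζ = ξ` and `E ζ + E' ξ = 0`, so `‖W (ζ, 0)‖² = ⟨E ζ, ζ⟩ = -⟨E' ξ, ζ⟩ = -⟨E' ζ, ξ⟩ = ‖W (ξ, 0)‖² -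
‖ξ‖² ≤ 0`. Both extreme cases of the inequality must then hold. -/
theorem starProjection_single_of_pair (W : Submodule ℂ (lp (fun _ : Fin 2 => H) 2))
    [W.HasOrthogonalProjection] {ξ ζ : H} (h1 : lpPair ξ ζ ∈ W) (h2 : lpPair ζ ξ ∈ Wᗮ)
    (h3 : ⟪entry W.starProjection 0 1 ξ, ζ⟫_ℂ = ⟪entry W.starProjection 0 1 ζ, ξ⟫_ℂ) :
    W.starProjection (lp.single 2 0 ζ) = 0 ∧
      W.starProjection (lp.single 2 0 ξ) = lp.single 2 0 ξ := by
  have eq1 : entry W.starProjection 0 0 ξ + entry W.starProjection 0 1 ζ = ξ := by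
    rw [← apply_lpPair, Submodule.starProjection_eq_self_iff.2 h1, lpPair_zero]
  have eq2 : entry W.starProjection 0 0 ζ + entry W.starProjection 0 1 ξ = 0 := by
    rw [← apply_lpPair, (Submodule.starProjection_apply_eq_zero_iff _).2 h2]
    rfl
  have key : (‖W.starProjection (lp.single 2 0 ζ)‖ : ℂ) ^ 2 =
      - ‖ξ‖ ^ 2 + (‖W.starProjection (lp.single 2 0 ξ)‖ : ℂ) ^ 2 := by
    rw [← inner_entry_self W, ← inner_entry_self W]
    generalize entry W.starProjection 0 0 = E at *
    generalize entry W.starProjection 0 1 = E' at *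
    have e1 := congrArg (fun v => ⟪v, ξ⟫_ℂ) eq1
    have e2 := congrArg (fun v => ⟪v, ζ⟫_ℂ) eq2
    simp only [inner_add_left, inner_zero_left] at e1 e2
    have e3 : ⟪ξ, ξ⟫_ℂ = (‖ξ‖ : ℂ) ^ 2 := inner_self_eq_norm_sq_to_K ξ
    linear_combination e2 - e1 - e3 - h3
  have key' : ‖W.starProjection (lp.single 2 0 ζ)‖ ^ 2 =
      - ‖ξ‖ ^ 2 + ‖W.starProjection (lp.single 2 0 ξ)‖ ^ 2 := by
    exact_mod_cast key
  have hn : ‖(lp.single 2 0 ξ : lp (fun _ : Fin 2 => H) 2)‖ = ‖ξ‖ :=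
    lp.norm_single (E := fun _ : Fin 2 => H) (p := 2) two_pos (0 : Fin 2) ξ
  have hle := W.norm_starProjection_apply_le (lp.single 2 0 ξ)
  rw [hn] at hle
  have hsq : ‖W.starProjection (lp.single 2 0 ξ)‖ ^ 2 ≤ ‖ξ‖ ^ 2 := by gcongr
  have hζ0 : ‖W.starProjection (lp.single 2 0 ζ)‖ = 0 := by
    refine pow_eq_zero_iff two_ne_zero |>.1 (le_antisymm (by linarith) (sq_nonneg _))
  refine ⟨norm_eq_zero.1 hζ0, ?_⟩
  refine Submodule.starProjection_eq_self_iff.2 ((Submodule.mem_iff_norm_starProjection _ _).2 ?_)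
  rw [hn]
  refine (sq_eq_sq₀ (norm_nonneg _) (norm_nonneg _)).1 ?_
  rw [hζ0] at key'
  linarith

/-- The real subspaces generated by the self-adjoint elements of an algebra and by `I` times those
of its commutant span a dense subspace. -/
theorem eq_zero_of_realOrbit {ζ : H} (hζ : ζ ∈ orbit φ ξ)
    (h : ∀ a, IsSelfAdjoint a → (⟪φ a ξ, ζ⟫_ℂ).re = 0)
    (h' : ∀ y ∈ Set.centralizer (Set.range φ), IsSelfAdjoint y → (⟪y ξ, ζ⟫_ℂ).im = 0) : ζ = 0 := by
  have hcomm := entry_mem_centralizer φ (lpPair ξ ζ)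
  -- The real orthogonality of `ζ` to the self-adjoint orbit says exactly that `(ζ, ξ)` is
  -- orthogonal to every `(a ξ, a ζ)`.
  have horth : lpPair ζ ξ ∈ (cyclic φ (lpPair ξ ζ))ᗮ := by
    rw [cyclic, Submodule.orthogonal_closure]
    rintro _ ⟨a, rfl⟩
    rw [inner_fin_two]
    change ⟪φ a (lpPair ξ ζ 0), lpPair ζ ξ 0⟫_ℂ + ⟪φ a (lpPair ξ ζ 1), lpPair ζ ξ 1⟫_ℂ = 0
    rw [lpPair_zero, lpPair_zero, lpPair_one, lpPair_one, inner_add_inner_eq_zero h]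
  obtain ⟨hζ0, hξ1⟩ := starProjection_single_of_pair _ (self_mem_cyclic φ (lpPair ξ ζ)) horth
    (inner_comm_of_im h' _ (hcomm 0 1))
  set E := entry (cyclic φ (lpPair ξ ζ)).starProjection 0 0 with hE
  have hξE : E ξ = ξ := by rw [hE, entry_apply, hξ1]; simp
  have hζE : E ζ = 0 := by rw [hE, entry_apply, hζ0]; rfl
  -- The entry `E` lies in the commutant and fixes `ξ`, so it fixes the cyclic subspace, which
  -- contains `ζ`; but it also kills `ζ`.
  have hfix : orbit φ ξ ≤ LinearMap.eqLocus (E : H →ₗ[ℂ] H) LinearMap.id := by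
    refine orbit_le (isClosed_eq E.continuous continuous_id) fun a => ?_
    have h2 := DFunLike.congr_fun (hcomm 0 0 _ ⟨a, rfl⟩) ξ
    change φ a (E ξ) = E (φ a ξ) at h2
    change E (φ a ξ) = φ a ξ
    rw [← h2, hξE]
  have : E ζ = ζ := hfix hζ
  rw [← this, hζE]

end Orbit

/-! ### Elementary properties of tensor products -/

section Tensor

variable {H K : Type*} [NormedAddCommGroup H] [InnerProductSpace ℂ H]
  [NormedAddCommGroup K] [InnerProductSpace ℂ K]

theorem leftTensor_apply (x : H) (y : K) :
    leftTensor x y = ((x ⊗ₜ[ℂ] y : H ⊗[ℂ] K) : HilbertTensor H K) := rfl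

theorem inner_leftTensor (x x' : H) (y y' : K) :
    ⟪leftTensor x y, leftTensor x' y'⟫_ℂ = ⟪x, x'⟫_ℂ * ⟪y, y'⟫_ℂ := by
  rw [leftTensor_apply, leftTensor_apply, UniformSpace.Completion.inner_coe,
    TensorProduct.inner_tmul]

theorem norm_leftTensor_apply (x : H) (y : K) : ‖leftTensor x y‖ = ‖x‖ * ‖y‖ := by
  rw [leftTensor_apply, UniformSpace.Completion.norm_coe, TensorProduct.norm_tmul]

theorem leftTensor_add (x x' : H) : leftTensor (K := K) (x + x') = leftTensor x + leftTensor x' := by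
  ext y
  simp [leftTensor_apply, TensorProduct.add_tmul, UniformSpace.Completion.coe_add]

theorem leftTensor_smul (c : ℂ) (x : H) : leftTensor (K := K) (c • x) = c • leftTensor x := by
  ext y
  change UniformSpace.Completion.toComplL (𝕜 := ℂ) ((c • x) ⊗ₜ[ℂ] y) =
    c • UniformSpace.Completion.toComplL (𝕜 := ℂ) (x ⊗ₜ[ℂ] y)
  rw [← map_smul, TensorProduct.smul_tmul']

theorem opTensor_leftTensor (S : H →L[ℂ] H) (T : K →L[ℂ] K) (x : H) (y : K) :
    opTensor S T (leftTensor x y) = leftTensor (S x) (T y) := by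
  rw [leftTensor_apply, opTensor, ContinuousLinearMap.completion_apply_coe]
  rfl

theorem dense_span_leftTensor :
    (Submodule.span ℂ (Set.range fun p : H × K => leftTensor p.1 p.2)).topologicalClosure = ⊤ := by
  rw [← Submodule.dense_iff_topologicalClosure_eq_top]
  refine (UniformSpace.Completion.denseRange_coe (α := H ⊗[ℂ] K)).mono ?_
  rintro _ ⟨t, rfl⟩
  induction t with
  | zero => rw [UniformSpace.Completion.coe_zero]; exact Submodule.zero_mem _
  | tmul x y => exact Submodule.subset_span ⟨(x, y), rfl⟩
  | add s t hs ht => rw [UniformSpace.Completion.coe_add]; exact Submodule.add_mem _ hs ht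

theorem eq_of_inner_leftTensor {η η' : HilbertTensor H K}
    (h : ∀ x y, ⟪leftTensor x y, η⟫_ℂ = ⟪leftTensor x y, η'⟫_ℂ) : η = η' := by
  have : (⊤ : Submodule ℂ (HilbertTensor H K)) ≤
      LinearMap.ker ((innerSL ℂ (η - η') : HilbertTensor H K →L[ℂ] ℂ) : _ →ₗ[ℂ] ℂ) := by
    rw [← dense_span_leftTensor]
    refine Submodule.topologicalClosure_minimal _ (Submodule.span_le.2 ?_)
      (ContinuousLinearMap.isClosed_ker _)
    rintro _ ⟨p, rfl⟩
    change ⟪η - η', leftTensor p.1 p.2⟫_ℂ = 0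
    rw [← inner_conj_symm, inner_sub_right, h, sub_self, map_zero]
  have h0 : ⟪η - η', η - η'⟫_ℂ = 0 := this (Submodule.mem_top (x := η - η'))
  exact sub_eq_zero.1 (inner_self_eq_zero.1 h0)

theorem ext_leftTensor {E : Type*} [NormedAddCommGroup E] [NormedSpace ℂ E]
    {S T : HilbertTensor H K →L[ℂ] E} (h : ∀ x y, S (leftTensor x y) = T (leftTensor x y)) :
    S = T := by
  have : (⊤ : Submodule ℂ (HilbertTensor H K)) ≤ LinearMap.eqLocus (S : _ →ₗ[ℂ] E) T := by
    rw [← dense_span_leftTensor]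
    refine Submodule.topologicalClosure_minimal _ (Submodule.span_le.2 ?_)
      (isClosed_eq S.continuous T.continuous)
    rintro _ ⟨p, rfl⟩
    exact h _ _
  ext z
  exact this (Submodule.mem_top (x := z))

theorem opTensor_mul (S S' : H →L[ℂ] H) (T T' : K →L[ℂ] K) :
    opTensor (S * S') (T * T') = opTensor S T * opTensor S' T' :=
  ext_leftTensor fun x y => by
    rw [mul_apply_eq_comp, opTensor_leftTensor, opTensor_leftTensor,
      opTensor_leftTensor]
    rfl

variable [CompleteSpace H] [CompleteSpace K]

theorem adjoint_opTensor (S : H →L[ℂ] H) (T : K →L[ℂ] K) :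
    (opTensor S T).adjoint = opTensor S.adjoint T.adjoint :=
  ext_leftTensor fun x y => eq_of_inner_leftTensor fun x' y' => by
    rw [ContinuousLinearMap.adjoint_inner_right, opTensor_leftTensor, opTensor_leftTensor,
      inner_leftTensor, inner_leftTensor, ContinuousLinearMap.adjoint_inner_right,
      ContinuousLinearMap.adjoint_inner_right]

theorem star_opTensor (S : H →L[ℂ] H) (T : K →L[ℂ] K) :
    star (opTensor S T) = opTensor (star S) (star T) := adjoint_opTensor S T

end Tensor

/-! ### The commutation theorem for tensor products -/

section Commutation

attribute [local instance] InnerProductSpace.complexToReal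

variable {A H : Type*} [CStarAlgebra A] [NormedAddCommGroup H] [InnerProductSpace ℂ H]
  [CompleteSpace H] {φ : A →⋆ₐ[ℂ] (H →L[ℂ] H)} {ξ : H}

omit [CompleteSpace H] in
theorem real_inner_eq_re (x y : H) : ⟪x, y⟫_ℝ = (⟪x, y⟫_ℂ).re := rfl

variable (φ ξ) in
/-- The closed real subspace generated by the projections on the cyclic subspace of the vectors
`y ξ`, with `y` self-adjoint in the commutant. -/
def commOrbit : Submodule ℝ H :=
  (Submodule.span ℝ {v | ∃ y ∈ Set.centralizer (Set.range φ), IsSelfAdjoint y ∧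
    (orbit φ ξ).starProjection (y ξ) = v}).topologicalClosure

instance : (commOrbit φ ξ).HasOrthogonalProjection :=
  haveI : CompleteSpace (commOrbit φ ξ) :=
    (Submodule.isClosed_topologicalClosure _).completeSpace_coe
  inferInstance

theorem starProjection_inner_eq {W : Submodule ℂ H} [W.HasOrthogonalProjection] {x : H}
    (hx : x ∈ W) (y : H) : ⟪x, W.starProjection y⟫_ℂ = ⟪x, y⟫_ℂ := by
  rw [← W.inner_starProjection_left_eq_right, Submodule.starProjection_eq_self_iff.2 hx]

theorem inner_comm_isSelfAdjoint_im {a : A} (ha : IsSelfAdjoint a) {y : H →L[ℂ] H}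
    (hy : y ∈ Set.centralizer (Set.range φ)) (hys : IsSelfAdjoint y) :
    (⟪φ a ξ, y ξ⟫_ℂ).im = 0 := by
  have e1 : ⟪y ξ, φ a ξ⟫_ℂ = ⟪ξ, y (φ a ξ)⟫_ℂ := by
    rw [← ContinuousLinearMap.adjoint_inner_right, hys.adjoint_eq]
  have e2 : ⟪φ a ξ, y ξ⟫_ℂ = ⟪ξ, φ a (y ξ)⟫_ℂ := by
    rw [← ContinuousLinearMap.adjoint_inner_right, adjoint_map, ha.star_eq]
  have := DFunLike.congr_fun (hy _ ⟨a, rfl⟩) ξ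
  rw [← Complex.conj_eq_iff_im, inner_conj_symm, e1, e2]
  exact (congrArg (fun v => ⟪ξ, v⟫_ℂ) this).symm

/-- The component of `I • x` orthogonal to `commOrbit φ ξ` becomes, after multiplication by `-I`, a
vector satisfying the hypotheses of `eq_zero_of_realOrbit`, so it vanishes. -/
theorem I_smul_mem_commOrbit {x : H} (hx : x ∈ orbit φ ξ)
    (h : ∀ a, IsSelfAdjoint a → (⟪φ a ξ, x⟫_ℂ).re = 0) : Complex.I • x ∈ commOrbit φ ξ := by
  set w := Complex.I • x
  set ζ := w - (commOrbit φ ξ).starProjection w with hζ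
  have hD : commOrbit φ ξ ≤ (orbit φ ξ).restrictScalars ℝ := by
    refine Submodule.topologicalClosure_minimal _ (Submodule.span_le.2 ?_)
      (Submodule.isClosed_topologicalClosure _)
    rintro _ ⟨y, -, -, rfl⟩
    exact (orbit φ ξ).starProjection_apply_mem _
  have hDim : ∀ a, IsSelfAdjoint a → ∀ d ∈ commOrbit φ ξ, (⟪φ a ξ, d⟫_ℂ).im = 0 := by
    intro a ha
    have : commOrbit φ ξ ≤ LinearMap.ker
        ((Complex.imCLM ∘L (innerSL ℂ (φ a ξ)).restrictScalars ℝ : H →L[ℝ] ℝ) : H →ₗ[ℝ] ℝ) := by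
      refine Submodule.topologicalClosure_minimal _ (Submodule.span_le.2 ?_)
        (ContinuousLinearMap.isClosed_ker _)
      rintro _ ⟨y, hy, hys, rfl⟩
      change (⟪φ a ξ, (orbit φ ξ).starProjection (y ξ)⟫_ℂ).im = 0
      rw [starProjection_inner_eq (map_mem_orbit a), inner_comm_isSelfAdjoint_im ha hy hys]
    exact fun d hd => this hd
  have hζo : ζ ∈ orbit φ ξ :=
    Submodule.sub_mem _ ((orbit φ ξ).smul_mem _ hx)
      (hD ((commOrbit φ ξ).starProjection_apply_mem w))
  have h0 : -Complex.I • ζ = 0 := by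
    refine eq_zero_of_realOrbit (φ := φ) (ξ := ξ) ((orbit φ ξ).smul_mem _ hζo) (fun a ha => ?_)
      (fun y hy hys => ?_)
    · rw [inner_smul_right, hζ, inner_sub_right, inner_smul_right]
      have e1 := h a ha
      have e2 := hDim a ha _ ((commOrbit φ ξ).starProjection_apply_mem w)
      simp [e1, e2]
    · have e1 : (⟪(orbit φ ξ).starProjection (y ξ), ζ⟫_ℂ).re = 0 := by
        have := (commOrbit φ ξ).starProjection_inner_eq_zero w _
          (Submodule.le_topologicalClosure _ (Submodule.subset_span ⟨y, hy, hys, rfl⟩))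
        rw [real_inner_comm] at this
        exact this
      rw [Submodule.inner_starProjection_left_eq_right,
        Submodule.starProjection_eq_self_iff.2 hζo] at e1
      rw [inner_smul_right]
      simp [e1]
  have h1 : ζ = 0 := by simpa using h0
  rw [sub_eq_zero] at h1
  rw [h1]
  exact (commOrbit φ ξ).starProjection_apply_mem w

theorem bilin_eq_zero_of_closure {E F : Type*} [NormedAddCommGroup E] [NormedSpace ℝ E]
    [NormedAddCommGroup F] [NormedSpace ℝ F] (β : E →L[ℝ] F →L[ℝ] ℝ) {s : Set E} {t : Set F}
    (h : ∀ x ∈ s, ∀ y ∈ t, β x y = 0) :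
    ∀ x ∈ (Submodule.span ℝ s).topologicalClosure, ∀ y ∈ (Submodule.span ℝ t).topologicalClosure,
      β x y = 0 := by
  have h1 : ∀ x ∈ s, ∀ y ∈ (Submodule.span ℝ t).topologicalClosure, β x y = 0 := by
    intro x hx y hy
    have : (Submodule.span ℝ t).topologicalClosure ≤ LinearMap.ker (β x : F →ₗ[ℝ] ℝ) :=
      Submodule.topologicalClosure_minimal _ (Submodule.span_le.2 fun y hy => h x hx y hy)
        (ContinuousLinearMap.isClosed_ker _)
    exact this hy
  intro x hx y hy
  have : (Submodule.span ℝ s).topologicalClosure ≤ LinearMap.ker (β.flip y : E →ₗ[ℝ] ℝ) :=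
    Submodule.topologicalClosure_minimal _ (Submodule.span_le.2 fun x hx => h1 x hx y hy)
      (ContinuousLinearMap.isClosed_ker _)
  exact this hx

variable (H) in
/-- Multiplication by `I`. -/
def mulI : H →L[ℝ] H := Complex.I • ContinuousLinearMap.id ℝ H

omit [CompleteSpace H] in
theorem mulI_apply (x : H) : mulI H x = Complex.I • x := rfl

variable (φ ξ) in
/-- The real subspace `I • realOrbit φ ξ`. -/
def imOrbit : Submodule ℝ H := (realOrbit φ ξ).comap (mulI H : H →ₗ[ℝ] H)

theorem mem_imOrbit {x : H} : x ∈ imOrbit φ ξ ↔ Complex.I • x ∈ realOrbit φ ξ := Iff.rfl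

instance : (imOrbit φ ξ).HasOrthogonalProjection :=
  haveI : CompleteSpace (imOrbit φ ξ) :=
    ((Submodule.isClosed_topologicalClosure _).preimage (mulI H).continuous).completeSpace_coe
  inferInstance

theorem re_eq_zero_of_mem {x : H} (hx : x ∈ (realOrbit φ ξ)ᗮ) {a : A} (ha : IsSelfAdjoint a) :
    (⟪φ a ξ, x⟫_ℂ).re = 0 := hx _ (map_mem_realOrbit ha)

theorem im_eq_zero_of_mem {x : H} (hx : x ∈ (imOrbit φ ξ)ᗮ) {a : A} (ha : IsSelfAdjoint a) :
    (⟪φ a ξ, x⟫_ℂ).im = 0 := by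
  have : -Complex.I • φ a ξ ∈ imOrbit φ ξ := by
    rw [mem_imOrbit, smul_smul]
    simpa using map_mem_realOrbit ha
  have h := hx _ this
  rw [real_inner_eq_re, inner_smul_left] at h
  simpa using h

theorem I_smul_mem_realOrbit_orthogonal {x : H} (hx : x ∈ (imOrbit φ ξ)ᗮ) :
    Complex.I • x ∈ (realOrbit φ ξ)ᗮ := by
  intro k hk
  have : -Complex.I • k ∈ imOrbit φ ξ := by
    rw [mem_imOrbit, smul_smul]; simpa using hk
  have h := hx _ this
  rw [real_inner_eq_re, inner_smul_left] at h
  rw [real_inner_eq_re, inner_smul_right]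
  simpa using h

theorem I_smul_mem_imOrbit_orthogonal {x : H} (hx : x ∈ (realOrbit φ ξ)ᗮ) :
    Complex.I • x ∈ (imOrbit φ ξ)ᗮ := by
  intro k hk
  have h := hx _ (mem_imOrbit.1 hk)
  rw [real_inner_eq_re, inner_smul_left] at h
  rw [real_inner_eq_re, inner_smul_right]
  simpa using h

variable {B K : Type*} [CStarAlgebra B] [NormedAddCommGroup K] [InnerProductSpace ℂ K]
  [CompleteSpace K] {ψ : B →⋆ₐ[ℂ] (K →L[ℂ] K)} {χ : K}

/-- The real bilinear form `Re ⟪η, x ⊗ y⟫`. -/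
def reForm (η : HilbertTensor H K) : H →L[ℝ] K →L[ℝ] ℝ :=
  LinearMap.mkContinuous₂ (LinearMap.mk₂ ℝ (fun (x : H) (y : K) => (⟪η, leftTensor x y⟫_ℂ).re)
    (fun x x' y => by simp [leftTensor_add, inner_add_right])
    (fun c x y => by
      have : leftTensor (c • x) y = (c : ℂ) • leftTensor x y := by
        rw [← smul_apply, ← leftTensor_smul, Complex.coe_smul]
      rw [this, inner_smul_right, Complex.re_ofReal_mul, smul_eq_mul])
    (fun x y y' => by simp [inner_add_right])
    (fun c x y => by
      rw [← Complex.coe_smul c y, map_smul, inner_smul_right, Complex.re_ofReal_mul, smul_eq_mul]))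
    ‖η‖ fun x y => by
      refine (Complex.abs_re_le_norm _).trans ((norm_inner_le_norm _ _).trans ?_)
      rw [norm_leftTensor_apply, mul_assoc]

omit [CompleteSpace H] [CompleteSpace K] in
theorem reForm_apply (η : HilbertTensor H K) (x : H) (y : K) :
    reForm η x y = (⟪η, leftTensor x y⟫_ℂ).re := rfl

omit [CompleteSpace H] [CompleteSpace K] in
theorem reForm_I (η : HilbertTensor H K) (x : H) (y : K) :
    reForm η (Complex.I • x) y = reForm η x (Complex.I • y) := by
  rw [reForm_apply, reForm_apply, leftTensor_smul, map_smul, smul_apply]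

omit [CompleteSpace H] [CompleteSpace K] in
theorem reForm_I_I (η : HilbertTensor H K) (x : H) (y : K) :
    reForm η x y = - reForm η (Complex.I • x) (Complex.I • y) := by
  rw [reForm_apply, reForm_apply, leftTensor_smul, map_smul, smul_apply, smul_smul,
    Complex.I_mul_I, neg_one_smul, inner_neg_right, Complex.neg_re, neg_neg]

theorem reForm_orbit {η : HilbertTensor H K}
    (hη : opTensor (orbit φ ξ).starProjection (orbit ψ χ).starProjection η = η) (x : H) (y : K) :
    reForm η x y = reForm η ((orbit φ ξ).starProjection x) ((orbit ψ χ).starProjection y) := by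
  rw [reForm_apply, reForm_apply, ← opTensor_leftTensor,
    ← ContinuousLinearMap.adjoint_inner_left (opTensor _ _),
    adjoint_opTensor, (isSelfAdjoint_orbit (φ := φ) (ξ := ξ)).adjoint_eq,
    (isSelfAdjoint_orbit (φ := ψ) (ξ := χ)).adjoint_eq, hη]

/-- The tensor version of `eq_zero_of_realOrbit`, from `bilin_eq_zero_of_four` applied to the
subspaces `realOrbit` and `imOrbit` of the two factors. The algebras control the form on the
subspaces themselves; the commutants control it on the orthogonal complements, which
`I_smul_mem_commOrbit` relates to them. -/
theorem eq_zero_of_reForm {η : HilbertTensor H K}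
    (hη : opTensor (orbit φ ξ).starProjection (orbit ψ χ).starProjection η = η)
    (h : ∀ a b, IsSelfAdjoint a → IsSelfAdjoint b →
      (⟪η, leftTensor (φ a ξ) (ψ b χ)⟫_ℂ).re = 0)
    (h' : ∀ y ∈ Set.centralizer (Set.range φ), ∀ z ∈ Set.centralizer (Set.range ψ),
      IsSelfAdjoint y → IsSelfAdjoint z → (⟪η, leftTensor (y ξ) (z χ)⟫_ℂ).im = 0) : η = 0 := by
  have f2 := reForm_orbit hη
  have h1 : ∀ x ∈ realOrbit φ ξ, ∀ v ∈ realOrbit ψ χ, reForm η x v = 0 := by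
    refine bilin_eq_zero_of_closure (reForm η) ?_
    rintro _ ⟨a, ha, rfl⟩ _ ⟨b, hb, rfl⟩
    exact h a b ha hb
  have hD : ∀ x ∈ commOrbit φ ξ, ∀ v ∈ commOrbit ψ χ, reForm η (Complex.I • x) v = 0 := by
    refine bilin_eq_zero_of_closure (reForm η ∘L mulI H) ?_
    rintro _ ⟨y, hy, hys, rfl⟩ _ ⟨z, hz, hzs, rfl⟩
    rw [ContinuousLinearMap.comp_apply, mulI_apply, ← map_smul, ← f2, reForm_apply,
      leftTensor_smul, smul_apply, inner_smul_right]
    simp [h' y hy z hz hys hzs]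
  -- As `η` is fixed by the projection on the cyclic subspaces, both variables may be projected
  -- there; they then become multiples by `I` of vectors of the commutant orbits.
  have h3 : ∀ x ∈ (realOrbit φ ξ)ᗮ, ∀ v ∈ (imOrbit ψ χ)ᗮ, reForm η x v = 0 := by
    intro x hx v hv
    rw [f2]
    have hx' := I_smul_mem_commOrbit (x := (orbit φ ξ).starProjection x)
      ((orbit φ ξ).starProjection_apply_mem x) fun a ha => by
        rw [starProjection_inner_eq (map_mem_orbit a), re_eq_zero_of_mem hx ha]
    have hv' := I_smul_mem_commOrbit (x := Complex.I • (orbit ψ χ).starProjection v)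
      ((orbit ψ χ).smul_mem _ ((orbit ψ χ).starProjection_apply_mem v)) fun a ha => by
        rw [inner_smul_right, starProjection_inner_eq (map_mem_orbit a)]
        simp [im_eq_zero_of_mem hv ha]
    rw [reForm_I_I, ← reForm_I, neg_eq_zero]
    have := hD _ hx' _ hv'
    rw [smul_smul Complex.I Complex.I ((orbit ψ χ).starProjection v), Complex.I_mul_I,
      neg_one_smul, map_neg, neg_eq_zero] at this
    exact this
  have h4 : ∀ x ∈ (imOrbit φ ξ)ᗮ, ∀ v ∈ (realOrbit ψ χ)ᗮ, reForm η x v = 0 := by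
    intro x hx v hv
    rw [reForm_I_I, h3 _ (I_smul_mem_realOrbit_orthogonal hx) _ (I_smul_mem_imOrbit_orthogonal hv),
      neg_zero]
  have hzero : ∀ v : K, (∀ b, ⟪ψ b χ, v⟫_ℂ = 0) → (orbit ψ χ).starProjection v = 0 := by
    intro v hv
    rw [Submodule.starProjection_apply_eq_zero_iff, orbit, Submodule.orthogonal_closure]
    rintro _ ⟨b, rfl⟩
    exact hv b
  have key := bilin_eq_zero_of_four (realOrbit φ ξ) (imOrbit φ ξ) (realOrbit ψ χ) (imOrbit ψ χ)
    (reForm η) h1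
    (fun x hx v hv => by rw [reForm_I_I, h1 _ (mem_imOrbit.1 hx) _ (mem_imOrbit.1 hv), neg_zero])
    h3 h4
    -- A vector orthogonal to both real subspaces is complex orthogonal to the cyclic subspace, so
    -- its projection vanishes.
    (fun x v hv hv' => by
      rw [f2, hzero v (inner_eq_zero_of_re (fun a ha => re_eq_zero_of_mem hv ha)
        fun a ha => im_eq_zero_of_mem hv' ha), map_zero])
  have hA : ∀ a v, reForm η (φ a ξ) v = 0 := by
    intro a v
    rw [← realPart_add_I_smul_imaginaryPart a, map_add, map_smul, add_apply, smul_apply, map_add,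
      add_apply, reForm_I, key _ (map_mem_realOrbit (realPart a).2),
      key _ (map_mem_realOrbit (imaginaryPart a).2), add_zero]
  have hO : ∀ x ∈ orbit φ ξ, ∀ v, reForm η x v = 0 := by
    intro x hx v
    refine closure_minimal (t := {x | reForm η x v = 0}) ?_
      (isClosed_eq ((reForm η).flip v).continuous continuous_const) hx
    rintro _ ⟨a, rfl⟩
    exact hA a v
  have hall : ∀ x v, reForm η x v = 0 := fun x v => by
    rw [f2, hO _ ((orbit φ ξ).starProjection_apply_mem x)]
  refine eq_of_inner_leftTensor fun x y => ?_
  rw [inner_zero_right, ← inner_conj_symm, map_eq_zero]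
  refine Complex.ext (hall x y) ?_
  have := hall (Complex.I • x) y
  rw [reForm_apply, leftTensor_smul, smul_apply, inner_smul_right] at this
  simpa using this

end Commutation

section Commutation

attribute [local instance] InnerProductSpace.complexToReal

variable {A H : Type*} [CStarAlgebra A] [NormedAddCommGroup H] [InnerProductSpace ℂ H]
  [CompleteSpace H] {φ : A →⋆ₐ[ℂ] (H →L[ℂ] H)}
  {B K : Type*} [CStarAlgebra B] [NormedAddCommGroup K] [InnerProductSpace ℂ K]
  [CompleteSpace K] {ψ : B →⋆ₐ[ℂ] (K →L[ℂ] K)}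

theorem inner_im_eq_zero_of_commute {S T : H →L[ℂ] H} (hS : IsSelfAdjoint S) (hT : IsSelfAdjoint T)
    (h : S * T = T * S) (v : H) : (⟪S v, T v⟫_ℂ).im = 0 := by
  have e1 : ⟪T v, S v⟫_ℂ = ⟪v, T (S v)⟫_ℂ := by
    rw [← ContinuousLinearMap.adjoint_inner_right, hT.adjoint_eq]
  have e2 : ⟪S v, T v⟫_ℂ = ⟪v, S (T v)⟫_ℂ := by
    rw [← ContinuousLinearMap.adjoint_inner_right, hS.adjoint_eq]
  rw [← Complex.conj_eq_iff_im, inner_conj_symm, e1, e2]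
  exact congrArg (fun v => ⟪_, v⟫_ℂ) (DFunLike.congr_fun h.symm v)

variable (φ ψ) in
/-- The tensor products of the elements of the commutants. -/
def commElementary : Set (HilbertTensor H K →L[ℂ] HilbertTensor H K) :=
  {R | ∃ y ∈ Set.centralizer (Set.range φ), ∃ z ∈ Set.centralizer (Set.range ψ), opTensor y z = R}

theorem isSelfAdjoint_opTensor {S : H →L[ℂ] H} {T : K →L[ℂ] K} (hS : IsSelfAdjoint S)
    (hT : IsSelfAdjoint T) : IsSelfAdjoint (opTensor S T) := by
  rw [isSelfAdjoint_iff, star_opTensor, hS.star_eq, hT.star_eq]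

/-- Let `V` be the closed real span of the `a ξ ⊗ b χ` with `a`, `b` self-adjoint. The vector `T' (ξ
⊗ χ)` equals its projection on `V`, since the difference satisfies the hypotheses of
`eq_zero_of_reForm`; and `T (ξ ⊗ χ)` has real inner products with all of `V`. -/
theorem inner_im_eq_zero_of_elementary {T T' : HilbertTensor H K →L[ℂ] HilbertTensor H K}
    (hT : T ∈ Set.centralizer (elementary φ ψ)) (hT' : T' ∈ Set.centralizer (commElementary φ ψ))
    (hTs : IsSelfAdjoint T) (hTs' : IsSelfAdjoint T') (ξ : H) (χ : K) :
    (⟪T (leftTensor ξ χ), T' (leftTensor ξ χ)⟫_ℂ).im = 0 := by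
  set s : Set (HilbertTensor H K) :=
    {v | ∃ a b, IsSelfAdjoint a ∧ IsSelfAdjoint b ∧ leftTensor (φ a ξ) (ψ b χ) = v}
  set V : Submodule ℝ (HilbertTensor H K) := (Submodule.span ℝ s).topologicalClosure with hV
  have hVc : IsClosed (V : Set (HilbertTensor H K)) := Submodule.isClosed_topologicalClosure _
  haveI : CompleteSpace V := hVc.completeSpace_coe
  have hVker : ∀ v : HilbertTensor H K,
      (∀ a b, IsSelfAdjoint a → IsSelfAdjoint b →
        (⟪v, leftTensor (φ a ξ) (ψ b χ)⟫_ℂ).im = 0) → ∀ w ∈ V, (⟪v, w⟫_ℂ).im = 0 := by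
    intro v h
    have : V ≤ LinearMap.ker ((Complex.imCLM ∘L (innerSL ℂ v).restrictScalars ℝ :
        HilbertTensor H K →L[ℝ] ℝ) : _ →ₗ[ℝ] ℝ) := by
      refine Submodule.topologicalClosure_minimal _ (Submodule.span_le.2 ?_)
        (ContinuousLinearMap.isClosed_ker _)
      rintro _ ⟨a, b, ha, hb, rfl⟩
      exact h a b ha hb
    exact fun w hw => this hw
  set E := opTensor (orbit φ ξ).starProjection (orbit ψ χ).starProjection with hE
  have hVE : V ≤ LinearMap.eqLocus ((E.restrictScalars ℝ : _ →L[ℝ] _) : _ →ₗ[ℝ] HilbertTensor H K)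
      LinearMap.id := by
    refine Submodule.topologicalClosure_minimal _ (Submodule.span_le.2 ?_)
      (isClosed_eq E.continuous continuous_id)
    rintro _ ⟨a, b, -, -, rfl⟩
    change E (leftTensor (φ a ξ) (ψ b χ)) = leftTensor (φ a ξ) (ψ b χ)
    rw [hE, opTensor_leftTensor, Submodule.starProjection_eq_self_iff.2 (map_mem_orbit a),
      Submodule.starProjection_eq_self_iff.2 (map_mem_orbit b)]
  have hη : E (T' (leftTensor ξ χ)) = T' (leftTensor ξ χ) := by
    have h1 := DFunLike.congr_fun
      (hT' E ⟨_, starProjection_orbit_mem, _, starProjection_orbit_mem, rfl⟩) (leftTensor ξ χ)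
    change E (T' (leftTensor ξ χ)) = T' (E (leftTensor ξ χ)) at h1
    rw [h1, hE, opTensor_leftTensor, Submodule.starProjection_eq_self_iff.2 self_mem_orbit,
      Submodule.starProjection_eq_self_iff.2 self_mem_orbit]
  have hmem : T' (leftTensor ξ χ) ∈ V := by
    rw [← Submodule.starProjection_eq_self_iff]
    refine (sub_eq_zero.1 (eq_zero_of_reForm (φ := φ) (ψ := ψ) (ξ := ξ) (χ := χ) ?_ ?_ ?_)).symm
    · rw [map_sub, hη]
      exact congrArg _ (hVE (V.starProjection_apply_mem _))
    · intro a b ha hb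
      exact V.starProjection_inner_eq_zero _ _
        (Submodule.le_topologicalClosure _ (Submodule.subset_span ⟨a, b, ha, hb, rfl⟩))
    · intro y hy z hz hys hzs
      rw [inner_sub_left, Complex.sub_im, ← opTensor_leftTensor,
        inner_im_eq_zero_of_commute hTs' (isSelfAdjoint_opTensor hys hzs)
          (hT' _ ⟨y, hy, z, hz, rfl⟩).symm, ← inner_conj_symm, Complex.conj_im, neg_eq_zero.2,
        sub_zero]
      refine hVker _ (fun a b ha hb => ?_) _ (V.starProjection_apply_mem _)
      rw [opTensor_leftTensor, inner_leftTensor, ← inner_conj_symm, ← inner_conj_symm (z χ),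
        Complex.conj_eq_iff_im.2 (inner_comm_isSelfAdjoint_im ha hy hys),
        Complex.conj_eq_iff_im.2 (inner_comm_isSelfAdjoint_im hb hz hzs), Complex.mul_im,
        inner_comm_isSelfAdjoint_im ha hy hys, inner_comm_isSelfAdjoint_im hb hz hzs]
      simp
  refine hVker _ (fun a b ha hb => ?_) _ hmem
  rw [← opTensor_leftTensor]
  refine inner_im_eq_zero_of_commute hTs (isSelfAdjoint_opTensor ?_ ?_)
    (hT _ ⟨(a, b), rfl⟩).symm _
  · rw [isSelfAdjoint_iff, ← map_star, ha.star_eq]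
  · rw [isSelfAdjoint_iff, ← map_star, hb.star_eq]

theorem coeffRight_inner (T : HilbertTensor H K →L[ℂ] HilbertTensor H K) (x x' : H) (u v : K) :
    ⟪v, coeffRight T x x' u⟫_ℂ = ⟪leftTensor x v, T (leftTensor x' u)⟫_ℂ :=
  ContinuousLinearMap.adjoint_inner_right (leftTensor x) v (T (leftTensor x' u))

theorem coeffLeft_inner (T : HilbertTensor H K →L[ℂ] HilbertTensor H K) (y y' : K) (u v : H) :
    ⟪v, coeffLeft T y y' u⟫_ℂ = ⟪leftTensor v y, T (leftTensor u y')⟫_ℂ :=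
  ContinuousLinearMap.adjoint_inner_right (rightTensor y) v (T (rightTensor y' u))

theorem ext_coeffRight {S T : HilbertTensor H K →L[ℂ] HilbertTensor H K}
    (h : ∀ x x', coeffRight S x x' = coeffRight T x x') : S = T :=
  ext_leftTensor fun x' u => eq_of_inner_leftTensor fun x v => by
    rw [← coeffRight_inner, ← coeffRight_inner, h]

theorem ext_coeffLeft {S T : HilbertTensor H K →L[ℂ] HilbertTensor H K}
    (h : ∀ y y', coeffLeft S y y' = coeffLeft T y y') : S = T :=
  ext_leftTensor fun x' u => eq_of_inner_leftTensor fun x v => by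
    rw [← coeffLeft_inner, ← coeffLeft_inner, h]

/-- Complex polarisation in each tensor factor separately: first the diagonal coefficients in the
second factor vanish, then all coefficients in the first. -/
theorem eq_zero_of_inner_elementary {D : HilbertTensor H K →L[ℂ] HilbertTensor H K}
    (h : ∀ x u, ⟪leftTensor x u, D (leftTensor x u)⟫_ℂ = 0) : D = 0 := by
  have h1 : ∀ x, coeffRight D x x = 0 := by
    intro x
    have := (inner_map_self_eq_zero (coeffRight D x x : K →ₗ[ℂ] K)).1 fun u => by
      rw [← inner_conj_symm]
      exact (congrArg _ ((coeffRight_inner D x x u u).trans (h x u))).trans (map_zero _)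
    ext u
    exact DFunLike.congr_fun this u
  refine ext_coeffLeft fun y y' => ?_
  have := (inner_map_self_eq_zero (coeffLeft D y y' : H →ₗ[ℂ] H)).1 fun x => by
    rw [← inner_conj_symm]
    refine (congrArg _ ((coeffLeft_inner D y y' x x).trans ?_)).trans (map_zero _)
    rw [← coeffRight_inner, h1]
    exact inner_zero_right _
  ext u
  rw [show coeffLeft D y y' u = 0 from DFunLike.congr_fun this u, coeffLeft,
    ContinuousLinearMap.zero_comp, ContinuousLinearMap.comp_zero]
  rfl

theorem star_mem_centralizer_of_star {L : Type*} [NormedAddCommGroup L] [InnerProductSpace ℂ L]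
    [CompleteSpace L] {s : Set (L →L[ℂ] L)} (hs : ∀ x ∈ s, star x ∈ s) {T : L →L[ℂ] L}
    (hT : T ∈ Set.centralizer s) : star T ∈ Set.centralizer s := by
  intro x hx
  have := congrArg star (hT _ (hs x hx))
  rw [star_mul, star_mul, star_star] at this
  exact this.symm

theorem commute_of_selfAdjoint {L : Type*} [NormedAddCommGroup L] [InnerProductSpace ℂ L]
    [CompleteSpace L] {s t : Set (L →L[ℂ] L)} (hs : ∀ x ∈ s, star x ∈ s) (ht : ∀ x ∈ t, star x ∈ t)
    (h : ∀ S ∈ Set.centralizer s, ∀ T ∈ Set.centralizer t, IsSelfAdjoint S → IsSelfAdjoint T →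
      S * T = T * S) {S T : L →L[ℂ] L} (hS : S ∈ Set.centralizer s) (hT : T ∈ Set.centralizer t) :
    S * T = T * S := by
  have hmem : ∀ (s : Set (L →L[ℂ] L)), (∀ x ∈ s, star x ∈ s) → ∀ S ∈ Set.centralizer s,
      (realPart S : L →L[ℂ] L) ∈ Set.centralizer s ∧
      (imaginaryPart S : L →L[ℂ] L) ∈ Set.centralizer s := by
    intro s hs S hS
    have hS' := star_mem_centralizer_of_star hs hS
    rw [realPart_apply_coe, imaginaryPart_apply_coe]
    have h1 : ∀ (c : ℂ), c • S ∈ Subalgebra.centralizer ℂ s := fun c =>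
      (Subalgebra.centralizer ℂ s).smul_mem hS c
    have h2 : ∀ (c : ℂ), c • star S ∈ Subalgebra.centralizer ℂ s := fun c =>
      (Subalgebra.centralizer ℂ s).smul_mem hS' c
    constructor
    · have := (Subalgebra.centralizer ℂ s).add_mem (h1 ((2 : ℝ)⁻¹ : ℝ)) (h2 ((2 : ℝ)⁻¹ : ℝ))
      rw [Complex.coe_smul, Complex.coe_smul, ← smul_add] at this
      exact this
    · have := (Subalgebra.centralizer ℂ s).sub_mem (h1 ((2 : ℝ)⁻¹ : ℝ)) (h2 ((2 : ℝ)⁻¹ : ℝ))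
      rw [Complex.coe_smul, Complex.coe_smul, ← smul_sub] at this
      exact (Subalgebra.centralizer ℂ s).smul_mem this _
  obtain ⟨a1, a2⟩ := hmem s hs S hS
  obtain ⟨b1, b2⟩ := hmem t ht T hT
  have e1 := h _ a1 _ b1 (realPart S).2 (realPart T).2
  have e2 := h _ a1 _ b2 (realPart S).2 (imaginaryPart T).2
  have e3 := h _ a2 _ b1 (imaginaryPart S).2 (realPart T).2
  have e4 := h _ a2 _ b2 (imaginaryPart S).2 (imaginaryPart T).2
  rw [← realPart_add_I_smul_imaginaryPart S, ← realPart_add_I_smul_imaginaryPart T]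
  simp only [add_mul, mul_add, smul_mul_assoc, mul_smul_comm, e1, e2, e3, e4]
  module

/-- The commutation theorem for tensor products. -/
theorem commute_of_centralizers {T T' : HilbertTensor H K →L[ℂ] HilbertTensor H K}
    (hT : T ∈ Set.centralizer (elementary φ ψ))
    (hT' : T' ∈ Set.centralizer (commElementary φ ψ)) : T * T' = T' * T := by
  refine commute_of_selfAdjoint ?_ ?_ (fun S hS S' hS' hs hs' => ?_) hT hT'
  · rintro _ ⟨⟨a, b⟩, rfl⟩
    exact ⟨(star a, star b), by simp only [star_opTensor, map_star]⟩
  · rintro _ ⟨y, hy, z, hz, rfl⟩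
    exact ⟨star y, star_mem_centralizer_range hy, star z, star_mem_centralizer_range hz,
      (star_opTensor y z).symm⟩
  -- For self-adjoint operators, reality of `⟨S v, S' v⟩` means that the commutator has zero
  -- quadratic form at `v`; elementary vectors `v` suffice.
  · refine sub_eq_zero.1 (eq_zero_of_inner_elementary fun x u => ?_)
    have key := inner_im_eq_zero_of_elementary hS hS' hs hs' x u
    rw [← Complex.conj_eq_iff_im, inner_conj_symm] at key
    rw [sub_apply, inner_sub_right, sub_eq_zero]
    change ⟪_, S (S' _)⟫_ℂ = ⟪_, S' (S _)⟫_ℂ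
    have e1 := ContinuousLinearMap.adjoint_inner_left S (S' (leftTensor x u)) (leftTensor x u)
    have e2 := ContinuousLinearMap.adjoint_inner_left S' (S (leftTensor x u)) (leftTensor x u)
    rw [hs.adjoint_eq] at e1
    rw [hs'.adjoint_eq] at e2
    rw [← e1, ← e2, key]

theorem opTensor_comm (y : H →L[ℂ] H) (z : K →L[ℂ] K) :
    opTensor y 1 * opTensor 1 z = opTensor y z := by
  rw [← opTensor_mul, one_mul, mul_one]

/-- The form in which the commutation theorem is used: commutation with `y ⊗ 1` and `1 ⊗ z` is a
condition on the coefficients of `T`. For the converse, an operator commuting with all `y ⊗ z`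
commutes with the commutant of the elementary tensors. -/
theorem mem_vnTensor_iff {T : HilbertTensor H K →L[ℂ] HilbertTensor H K} :
    T ∈ (vnTensor φ ψ).toStarSubalgebra ↔
      (∀ y ∈ Set.centralizer (Set.range φ), opTensor y 1 * T = T * opTensor y 1) ∧
      ∀ z ∈ Set.centralizer (Set.range ψ), opTensor 1 z * T = T * opTensor 1 z := by
  have hel : ∀ R ∈ elementary φ ψ, star R ∈ elementary φ ψ := by
    rintro _ ⟨⟨a, b⟩, rfl⟩
    exact ⟨(star a, star b), by simp only [star_opTensor, map_star]⟩
  have hcen : ∀ R, R ∈ StarSubalgebra.centralizer ℂ (elementary φ ψ) ↔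
      R ∈ Set.centralizer (elementary φ ψ) := by
    intro R
    rw [StarSubalgebra.mem_centralizer_iff]
    exact ⟨fun h g hg => (h g hg).1, fun h g hg => ⟨h g hg, h _ (hel g hg)⟩⟩
  have hT : T ∈ (vnTensor φ ψ).toStarSubalgebra ↔
      ∀ R ∈ Set.centralizer (elementary φ ψ), R * T = T * R := by
    refine (StarSubalgebra.mem_centralizer_iff ℂ).trans ⟨fun h R hR => (h R ((hcen R).2 hR)).1, ?_⟩
    intro h R hR
    exact ⟨h R ((hcen R).1 hR), h _ ((hcen _).1 (star_mem hR))⟩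
  rw [hT]
  constructor
  · intro h
    refine ⟨fun y hy => h _ ?_, fun z hz => h _ ?_⟩
    · rintro _ ⟨⟨a, b⟩, rfl⟩
      rw [← opTensor_mul, ← opTensor_mul, hy _ ⟨a, rfl⟩, one_mul, mul_one]
    · rintro _ ⟨⟨a, b⟩, rfl⟩
      rw [← opTensor_mul, ← opTensor_mul, hz _ ⟨b, rfl⟩, one_mul, mul_one]
  · rintro ⟨h1, h2⟩ R hR
    refine commute_of_centralizers hR ?_
    rintro _ ⟨y, hy, z, hz, rfl⟩
    rw [← opTensor_comm, mul_assoc, h2 z hz, ← mul_assoc, h1 y hy, mul_assoc]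

end Commutation

open scoped ComplexOrder

/-! ### Positivity in terms of representations -/

theorem ofReal_sq_nonneg (r : ℝ) : 0 ≤ (r : ℂ) ^ 2 := by
  rw [← Complex.ofReal_pow]
  exact Complex.zero_le_real.2 (sq_nonneg r)

theorem exists_eq_star_mul_self {D : Type*} [NonUnitalCStarAlgebra D] [PartialOrder D]
    [StarOrderedRing D] {a : D} (ha : 0 ≤ a) : ∃ c, a = star c * c :=
  CStarAlgebra.nonneg_iff_eq_star_mul_self.1 ha

/-- Conjugating `a` by its negative part `n` gives `-n³`, which satisfies `P`, so `n³ = 0` and hence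
`n = 0`. -/
theorem nonneg_of_conj {D : Type*} [NonUnitalCStarAlgebra D] [PartialOrder D] [StarOrderedRing D]
    {P : D → Prop} (h1 : ∀ a, P a → IsSelfAdjoint a) (h2 : ∀ a c, P a → P (star c * a * c))
    (h3 : ∀ b, 0 ≤ b → P (-b) → b = 0) {a : D} (ha : P a) : 0 ≤ a := by
  have hsa := h1 a ha
  set n := a⁻ with hn
  have hn0 : 0 ≤ n := CFC.negPart_nonneg a
  have hns : star n = n := (IsSelfAdjoint.of_nonneg hn0).star_eq
  have e : n * a * n = -(n * n * n) := by
    conv_lhs => rw [← CFC.posPart_sub_negPart a hsa]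
    rw [mul_sub, hn, CFC.negPart_mul_posPart, zero_sub, neg_mul]
  have hnnn : n * n * n = 0 := by
    refine h3 _ ?_ ?_
    · have := star_left_conjugate_nonneg hn0 n
      rwa [hns] at this
    · rw [← e]
      have := h2 a n ha
      rwa [hns] at this
  have hnn : n * n = 0 := by
    refine (CStarRing.star_mul_self_eq_zero_iff _).1 ?_
    rw [star_mul, hns, ← mul_assoc, hnnn, zero_mul]
  have h0 : n = 0 := by
    refine (CStarRing.star_mul_self_eq_zero_iff _).1 ?_
    rw [hns, hnn]
  rw [← CFC.posPart_sub_negPart a hsa, ← hn, h0, sub_zero]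
  exact CFC.posPart_nonneg a

section

variable {A H : Type*} [CStarAlgebra A] [NormedAddCommGroup H] [InnerProductSpace ℂ H]
  [CompleteSpace H] {φ : A →⋆ₐ[ℂ] (H →L[ℂ] H)} {ι : Type*} [Fintype ι]

variable (φ) in
/-- The quadratic form of a matrix over an algebra of operators. -/
def quadForm (a : ι → ι → A) (ξ : ι → H) : ℂ := ∑ k, ∑ l, ⟪ξ k, φ (a k l) (ξ l)⟫_ℂ

variable (φ) in
/-- Positivity of a matrix over an algebra of operators. -/
def OpPos (a : ι → ι → A) : Prop := ∀ ξ : ι → H, 0 ≤ quadForm φ a ξ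

theorem inner_map_eq_inner_star (a : A) (x y : H) : ⟪x, φ a y⟫_ℂ = ⟪φ (star a) x, y⟫_ℂ := by
  rw [← adjoint_map, ContinuousLinearMap.adjoint_inner_left]

theorem quadForm_sub (a b : ι → ι → A) (ξ : ι → H) :
    quadForm φ (fun k l => a k l - b k l) ξ = quadForm φ a ξ - quadForm φ b ξ := by
  simp only [quadForm, map_sub, sub_apply, inner_sub_right, Finset.sum_sub_distrib]

theorem quadForm_neg (a : ι → ι → A) (ξ : ι → H) :
    quadForm φ (fun k l => -a k l) ξ = -quadForm φ a ξ := by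
  simp only [quadForm, map_neg, neg_apply, inner_neg_right, Finset.sum_neg_distrib]

theorem quadForm_star (a : ι → ι → A) (ξ : ι → H) :
    quadForm φ (fun k l => star (a l k)) ξ = (starRingEnd ℂ) (quadForm φ a ξ) := by
  simp only [quadForm, map_sum, inner_conj_symm]
  rw [Finset.sum_comm]
  refine Finset.sum_congr rfl fun k _ => Finset.sum_congr rfl fun l _ => ?_
  rw [inner_map_eq_inner_star, star_star]

variable (φ) in
/-- The action of a matrix on a vector. -/
def matAct (a : ι → ι → A) (ξ : ι → H) : ι → H := fun k => ∑ l, φ (a k l) (ξ l)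

theorem quadForm_eq (a : ι → ι → A) (ξ : ι → H) :
    quadForm φ a ξ = ∑ k, ⟪ξ k, matAct φ a ξ k⟫_ℂ := by
  simp only [quadForm, matAct, inner_sum]

theorem matAct_mul (a b : ι → ι → A) (ξ : ι → H) :
    matAct φ (fun k l => ∑ m, a k m * b m l) ξ = matAct φ a (matAct φ b ξ) := by
  ext k
  simp only [matAct, map_sum, map_mul, sum_apply, mul_apply_eq_comp]
  rw [Finset.sum_comm]

/-- The entries of a matrix. -/
def entries (a : CStarMatrix ι ι A) : ι → ι → A := fun k l => a k l

theorem matAct_mul' (a b : CStarMatrix ι ι A) (ξ : ι → H) :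
    matAct φ (entries (a * b)) ξ = matAct φ (entries a) (matAct φ (entries b) ξ) := by
  rw [← matAct_mul]
  congr 1

theorem entries_star (c : CStarMatrix ι ι A) :
    (fun k l => star (entries (star c) l k)) = entries c := by
  ext k l
  exact star_star _

theorem sum_inner_matAct (a : ι → ι → A) (ξ η : ι → H) :
    ∑ k, ⟪ξ k, matAct φ a η k⟫_ℂ = ∑ k, ⟪matAct φ (fun k l => star (a l k)) ξ k, η k⟫_ℂ := by
  simp only [matAct, inner_sum, sum_inner]
  rw [Finset.sum_comm]
  exact Finset.sum_congr rfl fun k _ => Finset.sum_congr rfl fun l _ => inner_map_eq_inner_star _ _ _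

theorem quadForm_conj (a c : CStarMatrix ι ι A) (ξ : ι → H) :
    quadForm φ (entries (star c * a * c)) ξ = quadForm φ (entries a) (matAct φ (entries c) ξ) := by
  have e : matAct φ (entries (star c * a * c)) ξ = matAct φ (entries (star c)) (matAct φ (entries a) (matAct φ (entries c) ξ)) := by
    rw [← matAct_mul' a c, ← matAct_mul', mul_assoc]
  rw [quadForm_eq, e, sum_inner_matAct, quadForm_eq, entries_star]

theorem quadForm_star_mul_self (c : CStarMatrix ι ι A) (ξ : ι → H) :
    quadForm φ (entries (star c * c)) ξ = ∑ k, (‖matAct φ (entries c) ξ k‖ : ℂ) ^ 2 := by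
  have e : matAct φ (entries (star c * c)) ξ = matAct φ (entries (star c)) (matAct φ (entries c) ξ) := matAct_mul' _ _ _
  rw [quadForm_eq, e, sum_inner_matAct, entries_star]
  exact Finset.sum_congr rfl fun k _ => inner_self_eq_norm_sq_to_K _

theorem eq_zero_of_quadForm (hφ : Function.Injective φ) {a : ι → ι → A}
    (h : ∀ ξ, quadForm φ a ξ = 0) : a = 0 := by
  classical
  let T : PiLp 2 (fun _ : ι => H) →ₗ[ℂ] PiLp 2 (fun _ : ι => H) :=
    { toFun := fun ξ => WithLp.toLp 2 (matAct φ a ξ)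
      map_add' := fun ξ η => by
        ext k; simp [matAct, Finset.sum_add_distrib]
      map_smul' := fun c ξ => by
        ext k; simp [matAct, Finset.smul_sum] }
  have hT : T = 0 := by
    refine (inner_map_self_eq_zero T).1 fun ξ => ?_
    rw [← inner_conj_symm, PiLp.inner_apply]
    have := h ξ
    rw [quadForm_eq] at this
    exact (congrArg _ this).trans (map_zero _)
  ext k l
  refine hφ ?_
  ext v
  have := congrArg (fun w : PiLp 2 (fun _ : ι => H) => w k)
    (DFunLike.congr_fun hT (WithLp.toLp 2 (Pi.single l v)))
  have e : matAct φ a (Pi.single l v) k = φ (a k l) v := by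
    rw [matAct, Finset.sum_eq_single l]
    · simp
    · intro m _ hm; simp [hm]
    · simp
  rw [Pi.zero_apply, Pi.zero_apply, map_zero, zero_apply, ← e]
  exact this

theorem OpPos.star_eq (hφ : Function.Injective φ) {a : ι → ι → A} (h : OpPos φ a) (k l : ι) :
    star (a l k) = a k l := by
  have : (fun k l => star (a l k) - a k l) = 0 := by
    refine eq_zero_of_quadForm hφ fun ξ => ?_
    rw [quadForm_sub, quadForm_star, sub_eq_zero]
    exact (Complex.conj_eq_iff_im.2 (Complex.nonneg_iff.1 (h ξ)).2.symm)
  exact sub_eq_zero.1 (congrFun (congrFun this k) l)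

variable [PartialOrder A] [StarOrderedRing A]

/-- This allows complete positivity to be tested through quadratic forms in any faithful
representation. Positive quadratic form is preserved by conjugation and has the other properties
that `nonneg_of_conj` requires. -/
theorem opPos_iff_nonneg (hφ : Function.Injective φ) [DecidableEq ι] (a : CStarMatrix ι ι A) :
    OpPos φ (entries a) ↔ 0 ≤ a := by
  have hpos : ∀ a : CStarMatrix ι ι A, 0 ≤ a → OpPos φ (entries a) := by
    intro a ha ξ
    obtain ⟨c, rfl⟩ := exists_eq_star_mul_self ha
    rw [quadForm_star_mul_self]
    refine Finset.sum_nonneg fun k _ => ?_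
    exact ofReal_sq_nonneg _
  refine ⟨fun ha => ?_, hpos a⟩
  refine nonneg_of_conj (P := fun a : CStarMatrix ι ι A => OpPos φ (entries a)) (fun a ha => ?_)
    (fun a c ha ξ => ?_) (fun b hb hb' => ?_) ha
  · rw [isSelfAdjoint_iff]
    ext k l
    rw [CStarMatrix.star_apply]
    exact ha.star_eq hφ k l
  · rw [quadForm_conj]
    exact ha _
  · refine eq_zero_of_quadForm (φ := φ) hφ fun ξ => le_antisymm ?_ (hpos b hb ξ)
    have := hb' ξ
    have e : quadForm φ (entries (-b)) ξ = - quadForm φ (entries b) ξ := quadForm_neg (entries b) ξ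
    rw [e] at this
    exact neg_nonneg.1 this

theorem nonneg_iff_inner (hφ : Function.Injective φ) (a : A) :
    0 ≤ a ↔ ∀ ξ, 0 ≤ ⟪ξ, φ a ξ⟫_ℂ := by
  have e : ∀ a ξ, quadForm φ (fun _ _ : Unit => a) ξ = ⟪ξ (), φ a (ξ ())⟫_ℂ := fun a ξ => by
    simp [quadForm]
  constructor
  · intro ha ξ
    obtain ⟨c, rfl⟩ := exists_eq_star_mul_self ha
    rw [map_mul, mul_apply_eq_comp, inner_map_eq_inner_star, star_star, inner_self_eq_norm_sq_to_K]
    exact ofReal_sq_nonneg _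
  · intro h
    refine nonneg_of_conj (P := fun a : A => ∀ ξ, 0 ≤ ⟪ξ, φ a ξ⟫_ℂ) (fun a ha => ?_)
      (fun a c ha ξ => ?_) (fun b hb hb' => ?_) h
    · exact OpPos.star_eq (φ := φ) (ι := Unit) (a := fun _ _ => a) hφ
        (fun ξ => by rw [e]; exact ha _) () ()
    · rw [map_mul, map_mul, mul_apply_eq_comp, mul_apply_eq_comp, inner_map_eq_inner_star,
        star_star]
      exact ha _
    · have : (fun _ _ : Unit => b) = 0 := by
        refine eq_zero_of_quadForm (φ := φ) hφ fun ξ => ?_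
        rw [e]
        refine le_antisymm ?_ ?_
        · have := hb' (ξ ())
          rw [map_neg, neg_apply, inner_neg_right] at this
          exact neg_nonneg.1 this
        · obtain ⟨c, rfl⟩ := exists_eq_star_mul_self hb
          rw [map_mul, mul_apply_eq_comp, inner_map_eq_inner_star, star_star,
            inner_self_eq_norm_sq_to_K]
          exact ofReal_sq_nonneg _
      exact congrFun (congrFun this ()) ()

end

/-! ### Completely positive contractions -/

section CCP

variable {A H : Type*} [CStarAlgebra A] [NormedAddCommGroup H] [InnerProductSpace ℂ H]
  [CompleteSpace H] {φ : A →⋆ₐ[ℂ] (H →L[ℂ] H)}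
  {B K : Type*} [CStarAlgebra B] [NormedAddCommGroup K] [InnerProductSpace ℂ K]
  [CompleteSpace K] {ψ : B →⋆ₐ[ℂ] (K →L[ℂ] K)} {f : A →ₗ[ℂ] B}

theorem IsCCP.opPos (h : IsCCP f) (hφ : Function.Injective φ) (hψ : Function.Injective ψ)
    {ι : Type*} [Fintype ι] {a : ι → ι → A} (ha : OpPos φ a) : OpPos ψ fun k l => f (a k l) := by
  classical
  letI := CStarAlgebra.spectralOrder A
  letI := CStarAlgebra.spectralOrder B
  haveI := CStarAlgebra.spectralOrderedRing A
  haveI := CStarAlgebra.spectralOrderedRing B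
  obtain ⟨F, hF⟩ := h.1
  have h1 := (opPos_iff_nonneg hφ (a : CStarMatrix ι ι A)).1 ha
  have h2 := (opPos_iff_nonneg hψ _).2 (F.map_cstarMatrix_nonneg _ h1)
  rw [← hF]
  exact h2

theorem isCCP_of_opPos (hφ : Function.Injective φ) (hψ : Function.Injective ψ)
    (h : ∀ (n : ℕ) (a : Fin n → Fin n → A), OpPos φ a → OpPos ψ fun k l => f (a k l))
    (hf : ∀ a, ‖f a‖ ≤ ‖a‖) : IsCCP f := by
  letI := CStarAlgebra.spectralOrder A
  letI := CStarAlgebra.spectralOrder B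
  haveI := CStarAlgebra.spectralOrderedRing A
  haveI := CStarAlgebra.spectralOrderedRing B
  refine ⟨⟨⟨f, fun n M hM => ?_⟩, rfl⟩, hf⟩
  exact (opPos_iff_nonneg hψ _).1 (h n M ((opPos_iff_nonneg hφ M).2 hM))

end CCP

/-! ### The operator with coefficients transformed by a completely positive contraction -/

/-- The bound makes the kernel a well defined bounded form on the dense span of the `e p`. It is
extended in one variable, represented by the Riesz theorem, and extended in the other. -/
theorem exists_operator_of_kernel {ι Z : Type*} [NormedAddCommGroup Z] [InnerProductSpace ℂ Z]
    [CompleteSpace Z] (e : ι → Z) (he : (Submodule.span ℂ (Set.range e)).topologicalClosure = ⊤)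
    (G : ι → ι → ℂ) {C : ℝ} (h0 : 0 ≤ C)
    (hC : ∀ (s : Finset ι) (a b : ι → ℂ),
      ‖∑ p ∈ s, ∑ q ∈ s, (starRingEnd ℂ) (a p) * b q * G p q‖ ≤
        C * ‖∑ p ∈ s, a p • e p‖ * ‖∑ q ∈ s, b q • e q‖) :
    ∃ R : Z →L[ℂ] Z, (∀ p q, ⟪e p, R (e q)⟫_ℂ = G p q) ∧ ‖R‖ ≤ C := by
  let L : (ι →₀ ℂ) →ₗ[ℂ] Z := Finsupp.linearCombination ℂ e
  have hL : DenseRange L := by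
    have := Submodule.dense_iff_topologicalClosure_eq_top.2 he
    rw [← Finsupp.range_linearCombination] at this
    exact this
  let F : (ι →₀ ℂ) → (ι →₀ ℂ) →ₗ[ℂ] ℂ := fun c =>
    Finsupp.linearCombination ℂ fun q => c.sum fun p a => (starRingEnd ℂ) a * G p q
  have hF : ∀ c c', ‖F c c'‖ ≤ C * ‖L c‖ * ‖L c'‖ := by
    intro c c'
    classical
    have := hC (c.support ∪ c'.support) c c'
    have e1 : ∀ d : ι →₀ ℂ, d.support ⊆ c.support ∪ c'.support →
        L d = ∑ p ∈ c.support ∪ c'.support, d p • e p := fun d hd => by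
      rw [Finsupp.linearCombination_apply, Finsupp.sum_of_support_subset _ hd _ (by simp)]
    have e2 : F c c' = ∑ p ∈ c.support ∪ c'.support, ∑ q ∈ c.support ∪ c'.support,
        (starRingEnd ℂ) (c p) * c' q * G p q := by
      rw [Finset.sum_comm, Finsupp.linearCombination_apply,
        Finsupp.sum_of_support_subset _ Finset.subset_union_right _ (by simp)]
      refine Finset.sum_congr rfl fun q _ => ?_
      rw [Finsupp.sum_of_support_subset _ Finset.subset_union_left _ (by simp), smul_eq_mul,
        Finset.mul_sum]
      exact Finset.sum_congr rfl fun p _ => by ring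
    rw [e2, e1 c Finset.subset_union_left, e1 c' Finset.subset_union_right]
    exact this
  let g : (ι →₀ ℂ) → Z →L[ℂ] ℂ := fun c => (F c).extendOfNorm L
  have hg : ∀ c c', g c (L c') = F c c' := fun c c' =>
    LinearMap.extendOfNorm_eq hL ⟨_, hF c⟩ c'
  have hgn : ∀ c, ‖g c‖ ≤ C * ‖L c‖ := fun c =>
    ContinuousLinearMap.opNorm_le_bound _ (by positivity) fun x =>
      LinearMap.norm_extendOfNorm_apply_le hL _ (hF c) x
  let z : (ι →₀ ℂ) → Z := fun c => (InnerProductSpace.toDual ℂ Z).symm (g c)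
  have hz : ∀ c c', ⟪z c, L c'⟫_ℂ = F c c' := fun c c' => by
    rw [InnerProductSpace.toDual_symm_apply, hg]
  have hext : ∀ v w : Z, (∀ c, ⟪v, L c⟫_ℂ = ⟪w, L c⟫_ℂ) → v = w := by
    intro v w h
    refine ext_inner_right ℂ fun u => ?_
    refine hL.induction_on (p := fun u => ⟪v, u⟫_ℂ = ⟪w, u⟫_ℂ) u
      (isClosed_eq (by fun_prop) (by fun_prop)) h
  let W : (ι →₀ ℂ) →ₗ[ℂ] Z :=
    { toFun := z
      map_add' := fun c d => by
        refine hext _ _ fun c' => ?_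
        rw [inner_add_left, hz, hz, hz]
        simp only [F, Finsupp.linearCombination_apply]
        rw [← Finsupp.sum_add]
        refine Finsupp.sum_congr fun q _ => ?_
        rw [Finsupp.sum_add_index' (by simp) (by intros; simp [add_mul]), smul_add]
      map_smul' := fun c d => by
        refine hext _ _ fun c' => ?_
        rw [RingHom.id_apply, inner_smul_left, hz, hz]
        simp only [F, Finsupp.linearCombination_apply]
        rw [Finsupp.mul_sum]
        refine Finsupp.sum_congr fun q _ => ?_
        rw [Finsupp.sum_smul_index' (by simp), smul_eq_mul, smul_eq_mul, Finsupp.mul_sum,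
          Finsupp.mul_sum, Finsupp.mul_sum]
        refine Finsupp.sum_congr fun p _ => ?_
        simp
        ring }
  have hW : ∀ c, ‖W c‖ ≤ C * ‖L c‖ := fun c => by
    change ‖z c‖ ≤ _
    rw [LinearIsometryEquiv.norm_map]
    exact hgn c
  let R' : Z →L[ℂ] Z := W.extendOfNorm L
  have hR' : ∀ c, R' (L c) = z c := fun c => LinearMap.extendOfNorm_eq hL ⟨_, hW⟩ c
  refine ⟨R'.adjoint, fun p q => ?_, ?_⟩
  · have hp : ∀ p, L (Finsupp.single p 1) = e p := fun p => by simp [L]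
    rw [ContinuousLinearMap.adjoint_inner_right, ← hp, hR', ← hp, hz]
    simp [F]
  · rw [LinearIsometryEquiv.norm_map]
    exact ContinuousLinearMap.opNorm_le_bound _ h0 fun x =>
      LinearMap.norm_extendOfNorm_apply_le hL _ hW x

theorem norm_le_of_quadratic {X : ℂ} {C a b : ℝ} (hC : 0 ≤ C) (ha : 0 ≤ a) (hb : 0 ≤ b)
    (h : ∀ r s : ℂ, 0 ≤ C * (‖r‖ * a) ^ 2 + 2 * ((starRingEnd ℂ) r * s * X).re +
      C * (‖s‖ * b) ^ 2) : ‖X‖ ≤ C * a * b := by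
  by_cases hX : X = 0
  · rw [hX, norm_zero]; positivity
  have hX' : 0 < ‖X‖ := norm_pos_iff.2 hX
  have key : ∀ t u : ℝ, 0 ≤ t → 0 ≤ u → 2 * (t * u * ‖X‖) ≤ C * (t * a) ^ 2 + C * (u * b) ^ 2 := by
    intro t u ht hu
    -- The phase of the second scalar is chosen so that the cross term becomes `-t u ‖X‖`.
    have := h t (-(u : ℂ) * (starRingEnd ℂ) X / ‖X‖)
    have e1 : ‖(-(u : ℂ) * (starRingEnd ℂ) X / ‖X‖)‖ = u := by
      rw [norm_div, norm_mul, norm_neg, RCLike.norm_conj]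
      simp [hX'.ne', abs_of_nonneg hu]
    have e2 : (starRingEnd ℂ) (t : ℂ) * (-(u : ℂ) * (starRingEnd ℂ) X / ‖X‖) * X =
        ((-(t * u * ‖X‖) : ℝ) : ℂ) := by
      rw [Complex.conj_ofReal]
      have : (starRingEnd ℂ) X * X = (‖X‖ : ℂ) ^ 2 := Complex.conj_mul' X
      have h0 : (‖X‖ : ℂ) ≠ 0 := by exact_mod_cast hX'.ne'
      push_cast
      field_simp
      linear_combination (-(t * u : ℂ)) * this
    rw [e1, e2, Complex.ofReal_re, Complex.norm_real, Real.norm_of_nonneg ht] at this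
    linarith
  have hε : ∀ ε : ℝ, 0 < ε → ‖X‖ ≤ C * (a + ε) * (b + ε) := by
    intro ε hε
    -- The optimal scalars are `t = b` and `u = a`; the `ε` keeps them positive when a length
    -- vanishes.
    have h1 := key (b + ε) (a + ε) (by positivity) (by positivity)
    have h2 : (b + ε) * a ≤ (b + ε) * (a + ε) := by gcongr; linarith
    have h3 : (a + ε) * b ≤ (b + ε) * (a + ε) := by rw [mul_comm (b + ε)]; gcongr; linarith
    have h4 : C * ((b + ε) * a) ^ 2 ≤ C * ((b + ε) * (a + ε)) ^ 2 := by gcongr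
    have h5 : C * ((a + ε) * b) ^ 2 ≤ C * ((b + ε) * (a + ε)) ^ 2 := by gcongr
    have hp : 0 < (b + ε) * (a + ε) := by positivity
    have h6 : (b + ε) * (a + ε) * ‖X‖ ≤ (b + ε) * (a + ε) * (C * (a + ε) * (b + ε)) := by
      nlinarith
    exact le_of_mul_le_mul_left h6 hp
  have hlim : Filter.Tendsto (fun ε : ℝ => C * (a + ε) * (b + ε)) (𝓝[>] 0) (𝓝 (C * a * b)) := by
    have : Continuous fun ε : ℝ => C * (a + ε) * (b + ε) := by fun_prop
    simpa using (this.tendsto 0).mono_left nhdsWithin_le_nhds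
  exact ge_of_tendsto hlim (Filter.eventually_of_mem self_mem_nhdsWithin fun ε h => hε ε h)

section

variable {A H : Type*} [CStarAlgebra A] [NormedAddCommGroup H] [InnerProductSpace ℂ H]
  [CompleteSpace H] {φ : A →⋆ₐ[ℂ] (H →L[ℂ] H)} {I : Type*} [Fintype I]

/-- The block matrix `[P, b; star b, P]`. -/
def blockMatrix (P b : I → I → A) : I ⊕ I → I ⊕ I → A :=
  Sum.elim (fun p => Sum.elim (P p) (b p)) (fun p => Sum.elim (fun q => star (b q p)) (P p))

theorem quadForm_blockMatrix (P b : I → I → A) (ξ : I ⊕ I → H) :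
    quadForm φ (blockMatrix P b) ξ = quadForm φ P (fun p => ξ (.inl p)) +
      ∑ p, ∑ q, ⟪ξ (.inl p), φ (b p q) (ξ (.inr q))⟫_ℂ +
      (starRingEnd ℂ) (∑ p, ∑ q, ⟪ξ (.inl p), φ (b p q) (ξ (.inr q))⟫_ℂ) +
      quadForm φ P (fun p => ξ (.inr p)) := by
  have e : (starRingEnd ℂ) (∑ p, ∑ q, ⟪ξ (.inl p), φ (b p q) (ξ (.inr q))⟫_ℂ) =
      ∑ p, ∑ q, ⟪ξ (.inr p), φ (star (b q p)) (ξ (.inl q))⟫_ℂ := by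
    simp only [map_sum, inner_conj_symm]
    rw [Finset.sum_comm]
    refine Finset.sum_congr rfl fun k _ => Finset.sum_congr rfl fun l _ => ?_
    rw [inner_map_eq_inner_star, star_star]
  rw [e]
  simp only [quadForm, Fintype.sum_sum_type, blockMatrix, Sum.elim_inl, Sum.elim_inr,
    Finset.sum_add_distrib]
  ring

theorem IsCCP.map_star {B : Type*} [CStarAlgebra B] {f : A →ₗ[ℂ] B} (h : IsCCP f) (a : A) :
    f (star a) = star (f a) := by
  letI := CStarAlgebra.spectralOrder A
  letI := CStarAlgebra.spectralOrder B
  haveI := CStarAlgebra.spectralOrderedRing A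
  haveI := CStarAlgebra.spectralOrderedRing B
  obtain ⟨F, rfl⟩ := h.1
  exact StarHomClass.map_star F a

end

section

variable {A H : Type*} [CStarAlgebra A] [NormedAddCommGroup H] [InnerProductSpace ℂ H]
  [CompleteSpace H] {φ : A →⋆ₐ[ℂ] (H →L[ℂ] H)}
  {B K : Type*} [CStarAlgebra B] [NormedAddCommGroup K] [InnerProductSpace ℂ K]
  [CompleteSpace K] {ψ : B →⋆ₐ[ℂ] (K →L[ℂ] K)}
  {B₂ K₂ : Type*} [CStarAlgebra B₂] [NormedAddCommGroup K₂] [InnerProductSpace ℂ K₂]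
  [CompleteSpace K₂] {ψ₂ : B₂ →⋆ₐ[ℂ] (K₂ →L[ℂ] K₂)}
  {π : B →ₗ[ℂ] B₂}

theorem quadForm_gram {I : Type*} [Fintype I] (C : ℝ) (x : I → H) (b : B) (ξ : I → K) :
    quadForm ψ (fun p q => ((C : ℂ) * ⟪x p, x q⟫_ℂ) • b) ξ =
      C * ⟪∑ p, leftTensor (x p) (ξ p), opTensor 1 (ψ b) (∑ p, leftTensor (x p) (ξ p))⟫_ℂ := by
  simp only [quadForm, map_sum, sum_inner, inner_sum, opTensor_leftTensor, inner_leftTensor,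
    Finset.mul_sum, map_smul, smul_apply, inner_smul_right, one_apply_eq_self]
  rw [Finset.sum_comm]
  exact Finset.sum_congr rfl fun p _ => Finset.sum_congr rfl fun q _ => by ring

theorem sum_inner_coeffRight {I J : Type*} [Fintype I] [Fintype J]
    (T : HilbertTensor H K →L[ℂ] HilbertTensor H K) (x : I → H) (y : J → H) (ξ : I → K)
    (η : J → K) :
    ∑ p, ∑ q, ⟪ξ p, coeffRight T (x p) (y q) (η q)⟫_ℂ =
      ⟪∑ p, leftTensor (x p) (ξ p), T (∑ q, leftTensor (y q) (η q))⟫_ℂ := by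
  simp only [map_sum, sum_inner, inner_sum, coeffRight_inner]
  exact Finset.sum_comm

theorem norm_opTensor_le (S : H →L[ℂ] H) (T : K →L[ℂ] K) : ‖opTensor S T‖ ≤ ‖S‖ * ‖T‖ := by
  refine ContinuousLinearMap.opNorm_le_bound _ (by positivity) fun z => ?_
  induction z using UniformSpace.Completion.induction_on with
  | hp => exact isClosed_le (by fun_prop) (by fun_prop)
  | ih z =>
    rw [opTensor, ContinuousLinearMap.completion_apply_coe, UniformSpace.Completion.norm_coe,
      UniformSpace.Completion.norm_coe]
    exact (ContinuousLinearMap.le_opNorm _ _).trans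
      (mul_le_mul_of_nonneg_right (TensorProduct.norm_mapL_le S T) (norm_nonneg z))

theorem norm_map_one_le (hπ : IsCCP π) : ‖ψ₂ (π 1)‖ ≤ 1 := by
  refine (NonUnitalStarAlgHom.norm_apply_le ψ₂ _).trans ((hπ.2 1).trans ?_)
  cases subsingleton_or_nontrivial B
  · rw [Subsingleton.elim (1 : B) 0, norm_zero]; exact zero_le_one
  · exact CStarRing.norm_one.le

/-- The matrix `[C G, b; b*, C G]`, with `G` the Gram matrix of the vectors of `H` and `C = ‖T‖`, is
positive. Applying `π` keeps it positive, with `π 1` in place of the unit; as `‖π 1‖ ≤ 1`, the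
off-diagonal block still has bound `C`. Only finite matrices occur, so no normality is needed. -/
theorem exists_slice (hψ : Function.Injective ψ) (hψ₂ : Function.Injective ψ₂) (hπ : IsCCP π)
    (T : HilbertTensor H K →L[ℂ] HilbertTensor H K) (b : H → H → B)
    (hb : ∀ x x', ψ (b x x') = coeffRight T x x') :
    ∃ R : HilbertTensor H K₂ →L[ℂ] HilbertTensor H K₂,
      (∀ x x', coeffRight R x x' = ψ₂ (π (b x x'))) ∧ ‖R‖ ≤ ‖T‖ := by
  suffices h : ∀ (s : Finset (H × K₂)) (α β : H × K₂ → ℂ),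
      ‖∑ p ∈ s, ∑ q ∈ s, (starRingEnd ℂ) (α p) * β q * ⟪p.2, ψ₂ (π (b p.1 q.1)) q.2⟫_ℂ‖ ≤
        ‖T‖ * ‖∑ p ∈ s, α p • leftTensor p.1 p.2‖ * ‖∑ q ∈ s, β q • leftTensor q.1 q.2‖ by
    obtain ⟨R, hR, hn⟩ := exists_operator_of_kernel
      (fun p : H × K₂ => leftTensor p.1 p.2) dense_span_leftTensor
      (fun p q => ⟪p.2, ψ₂ (π (b p.1 q.1)) q.2⟫_ℂ) (norm_nonneg T) h
    refine ⟨R, fun x x' => ?_, hn⟩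
    ext u
    refine ext_inner_left ℂ fun v => ?_
    rw [coeffRight_inner]
    exact hR (x, v) (x', u)
  intro s α β
  refine norm_le_of_quadratic (norm_nonneg T) (norm_nonneg _) (norm_nonneg _) fun r t => ?_
  set C := ‖T‖
  let x : s → H := fun p => p.1.1
  let P : s → s → B := fun p q => ((C : ℂ) * ⟪x p, x q⟫_ℂ) • 1
  let M := blockMatrix P (fun p q => b (x p) (x q))
  have hM : OpPos ψ M := by
    intro ξ
    rw [quadForm_blockMatrix]
    simp only [P, quadForm_gram, map_one]
    simp only [hb, sum_inner_coeffRight]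
    have e1 : opTensor (1 : H →L[ℂ] H) (1 : K →L[ℂ] K) = 1 :=
      ext_leftTensor fun x y => by rw [opTensor_leftTensor]; rfl
    simp only [e1, one_apply_eq_self]
    set w := ∑ p, leftTensor (x p) (ξ (.inl p))
    set v := ∑ p, leftTensor (x p) (ξ (.inr p))
    rw [inner_self_eq_norm_sq_to_K, inner_self_eq_norm_sq_to_K, add_assoc _ _ ((starRingEnd ℂ) _),
      Complex.add_conj]
    have h1 : -(‖w‖ * (C * ‖v‖)) ≤ (⟪w, T v⟫_ℂ).re := by
      have h2 := (abs_le.1 ((Complex.abs_re_le_norm _).trans (norm_inner_le_norm w (T v)))).1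
      have h3 : ‖w‖ * ‖T v‖ ≤ ‖w‖ * (C * ‖v‖) := by gcongr; exact T.le_opNorm v
      linarith
    have h2 : (0 : ℝ) ≤ C * ‖w‖ ^ 2 + 2 * (⟪w, T v⟫_ℂ).re + C * ‖v‖ ^ 2 := by
      have : 0 ≤ C * (‖w‖ - ‖v‖) ^ 2 := mul_nonneg (norm_nonneg T) (sq_nonneg _)
      nlinarith
    have h3 := Complex.zero_le_real.2 h2
    push_cast at h3 ⊢
    exact h3
  have hπM := hπ.opPos hψ hψ₂ hM
  -- Testing positivity on these vectors produces the two given combinations, weighted by arbitrary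
  -- scalars `r` and `t`, as `norm_le_of_quadratic` demands.
  let ζ : s ⊕ s → K₂ := Sum.elim (fun p => (r * α p) • p.1.2) (fun p => (t * β p) • p.1.2)
  have h0 := hπM ζ
  have e : (fun k l => π (M k l)) = blockMatrix (fun p q => ((C : ℂ) * ⟪x p, x q⟫_ℂ) • π 1)
      (fun p q => π (b (x p) (x q))) := by
    ext k l
    rcases k with p | p <;> rcases l with q | q
    · exact map_smul π _ _
    · rfl
    · exact hπ.map_star _
    · exact map_smul π _ _
  rw [e, quadForm_blockMatrix, quadForm_gram, quadForm_gram] at h0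
  have hw : ∀ c : ℂ, ∀ α : H × K₂ → ℂ, ∑ p : s, leftTensor (x p) ((c * α p) • p.1.2) =
      c • ∑ p ∈ s, α p • leftTensor p.1 p.2 := by
    intro c α
    rw [Finset.smul_sum, ← Finset.sum_coe_sort s]
    refine Finset.sum_congr rfl fun p _ => ?_
    rw [map_smul, smul_smul]
  simp only [ζ, Sum.elim_inl, Sum.elim_inr, hw] at h0
  have hX : ∑ p : s, ∑ q : s, ⟪(r * α p) • p.1.2, ψ₂ (π (b (x p) (x q))) ((t * β q) • q.1.2)⟫_ℂ =
      (starRingEnd ℂ) r * t * ∑ p ∈ s, ∑ q ∈ s,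
        (starRingEnd ℂ) (α p) * β q * ⟪p.2, ψ₂ (π (b p.1 q.1)) q.2⟫_ℂ := by
    rw [Finset.mul_sum, ← Finset.sum_coe_sort s]
    refine Finset.sum_congr rfl fun p _ => ?_
    rw [Finset.mul_sum, ← Finset.sum_coe_sort s]
    refine Finset.sum_congr rfl fun q _ => ?_
    rw [map_smul, inner_smul_left, inner_smul_right, map_mul]
    ring
  rw [hX] at h0
  set X := ∑ p ∈ s, ∑ q ∈ s, (starRingEnd ℂ) (α p) * β q * ⟪p.2, ψ₂ (π (b p.1 q.1)) q.2⟫_ℂ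
  have hre := (Complex.nonneg_iff.1 h0).1
  have hbd : ∀ v : HilbertTensor H K₂, ((C : ℂ) * ⟪v, opTensor 1 (ψ₂ (π 1)) v⟫_ℂ).re ≤
      C * ‖v‖ ^ 2 := by
    intro v
    rw [Complex.re_ofReal_mul]
    refine mul_le_mul_of_nonneg_left ?_ (norm_nonneg T)
    refine (Complex.re_le_norm _).trans ((norm_inner_le_norm _ _).trans ?_)
    rw [sq]
    refine mul_le_mul_of_nonneg_left ?_ (norm_nonneg v)
    refine (ContinuousLinearMap.le_opNorm _ _).trans (mul_le_of_le_one_left (norm_nonneg v) ?_)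
    refine (norm_opTensor_le _ _).trans (mul_le_one₀ ?_ (norm_nonneg _) (norm_map_one_le hπ))
    exact ContinuousLinearMap.norm_id_le
  have b1 := hbd (r • ∑ p ∈ s, α p • leftTensor p.1 p.2)
  have b2 := hbd (t • ∑ p ∈ s, β p • leftTensor p.1 p.2)
  rw [norm_smul] at b1 b2
  simp only [Complex.add_re, Complex.conj_re] at hre
  linarith

end

section Maps

theorem isCCP_of_starAlgHom {A B : Type*} [CStarAlgebra A] [CStarAlgebra B] (f : A →⋆ₙₐ[ℂ] B) :
    IsCCP ({ toFun := f, map_add' := map_add f, map_smul' := map_smul f } : A →ₗ[ℂ] B) := by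
  letI := CStarAlgebra.spectralOrder A
  letI := CStarAlgebra.spectralOrder B
  haveI := CStarAlgebra.spectralOrderedRing A
  haveI := CStarAlgebra.spectralOrderedRing B
  exact ⟨⟨⟨_, fun k M hM => CompletelyPositiveMapClass.map_cstarMatrix_nonneg' f k M hM⟩, rfl⟩,
    NonUnitalStarAlgHom.norm_apply_le f⟩

theorem IsCCP.comp {A B C : Type*} [CStarAlgebra A] [CStarAlgebra B] [CStarAlgebra C]
    {g : B →ₗ[ℂ] C} {f : A →ₗ[ℂ] B} (hg : IsCCP g) (hf : IsCCP f) : IsCCP (g ∘ₗ f) := by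
  letI := CStarAlgebra.spectralOrder A
  letI := CStarAlgebra.spectralOrder B
  letI := CStarAlgebra.spectralOrder C
  haveI := CStarAlgebra.spectralOrderedRing A
  haveI := CStarAlgebra.spectralOrderedRing B
  haveI := CStarAlgebra.spectralOrderedRing C
  obtain ⟨G, hG⟩ := hg.1
  obtain ⟨F, hF⟩ := hf.1
  refine ⟨⟨⟨_, fun k M hM => ?_⟩, rfl⟩, fun a => (hg.2 _).trans (hf.2 a)⟩
  rw [← hG, ← hF]
  exact G.map_cstarMatrix_nonneg' k _ (F.map_cstarMatrix_nonneg' k M hM)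

end Maps

/-! ### Coefficients of operators on a tensor product -/

section Coeff

variable {H K : Type*} [NormedAddCommGroup H] [InnerProductSpace ℂ H]
  [NormedAddCommGroup K] [InnerProductSpace ℂ K]

theorem norm_leftTensor_le (x : H) : ‖leftTensor (K := K) x‖ ≤ ‖x‖ :=
  ContinuousLinearMap.opNorm_le_bound _ (norm_nonneg x) fun y => (norm_leftTensor_apply x y).le

variable [CompleteSpace H] [CompleteSpace K] (S T : HilbertTensor H K →L[ℂ] HilbertTensor H K)
  (x x' : H)

theorem coeffRight_add : coeffRight (S + T) x x' = coeffRight S x x' + coeffRight T x x' := by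
  simp [coeffRight, ContinuousLinearMap.add_comp, ContinuousLinearMap.comp_add]

theorem coeffRight_smul (c : ℂ) : coeffRight (c • T) x x' = c • coeffRight T x x' := by
  simp [coeffRight, ContinuousLinearMap.smul_comp, ContinuousLinearMap.comp_smul]

theorem norm_coeffRight_le : ‖coeffRight T x x'‖ ≤ ‖T‖ * ‖x‖ * ‖x'‖ := by
  refine (ContinuousLinearMap.opNorm_comp_le _ _).trans ?_
  rw [LinearIsometryEquiv.norm_map, mul_comm ‖T‖, mul_assoc]
  refine mul_le_mul (norm_leftTensor_le x) ?_ (norm_nonneg _) (norm_nonneg x)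
  exact (ContinuousLinearMap.opNorm_comp_le _ _).trans
    (mul_le_mul_of_nonneg_left (norm_leftTensor_le x') (norm_nonneg T))

theorem coeffRight_mul_opTensor (y : H →L[ℂ] H) (z : K →L[ℂ] K) :
    coeffRight (T * opTensor y z) x x' = coeffRight T x (y x') * z := by
  ext u
  refine ext_inner_left ℂ fun v => ?_
  rw [coeffRight_inner, mul_apply_eq_comp, opTensor_leftTensor, ← coeffRight_inner]
  rfl

theorem coeffRight_opTensor_mul (y : H →L[ℂ] H) (z : K →L[ℂ] K) :
    coeffRight (opTensor y z * T) x x' = z * coeffRight T (y.adjoint x) x' := by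
  ext u
  refine ext_inner_left ℂ fun v => ?_
  rw [coeffRight_inner, mul_apply_eq_comp, mul_apply_eq_comp,
    ← ContinuousLinearMap.adjoint_inner_left, adjoint_opTensor, opTensor_leftTensor,
    ← coeffRight_inner, ContinuousLinearMap.adjoint_inner_left]

theorem coeffRight_opTensor (y : H →L[ℂ] H) (z : K →L[ℂ] K) :
    coeffRight (opTensor y z) x x' = ⟪x, y x'⟫_ℂ • z := by
  ext u
  refine ext_inner_left ℂ fun v => ?_
  rw [coeffRight_inner, opTensor_leftTensor, inner_leftTensor, smul_apply, inner_smul_right]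

end Coeff

namespace Shortcuts

variable {A H : Type*} [CStarAlgebra A] [NormedAddCommGroup H] [InnerProductSpace ℂ H]
  [CompleteSpace H] {φ : A →⋆ₐ[ℂ] (H →L[ℂ] H)}
  {B K : Type*} [CStarAlgebra B] [NormedAddCommGroup K] [InnerProductSpace ℂ K]
  [CompleteSpace K] {ψ : B →⋆ₐ[ℂ] (K →L[ℂ] K)}
  {A₂ H₂ : Type*} [CStarAlgebra A₂] [NormedAddCommGroup H₂] [InnerProductSpace ℂ H₂]
  [CompleteSpace H₂] {φ₂ : A₂ →⋆ₐ[ℂ] (H₂ →L[ℂ] H₂)}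
  {B₂ K₂ : Type*} [CStarAlgebra B₂] [NormedAddCommGroup K₂] [InnerProductSpace ℂ K₂]
  [CompleteSpace K₂] {ψ₂ : B₂ →⋆ₐ[ℂ] (K₂ →L[ℂ] K₂)}

/-! Shortcuts for instance search. -/

scoped instance : AddCommMonoid (VN φ ψ) := inferInstance

scoped instance : Module ℂ (VN φ ψ) := inferInstance

scoped instance : CoeFun (VN φ ψ →ₗ[ℂ] VN φ₂ ψ₂) fun _ => VN φ ψ → VN φ₂ ψ₂ := ⟨fun f => f⟩

end Shortcuts

open scoped Shortcuts

/-! ### The slice maps `id ⊗ π` -/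

section Slice

variable {A H : Type*} [CStarAlgebra A] [NormedAddCommGroup H] [InnerProductSpace ℂ H]
  [CompleteSpace H] {φ : A →⋆ₐ[ℂ] (H →L[ℂ] H)}
  {B K : Type*} [CStarAlgebra B] [NormedAddCommGroup K] [InnerProductSpace ℂ K]
  [CompleteSpace K] {ψ : B →⋆ₐ[ℂ] (K →L[ℂ] K)}

variable (φ ψ) in
/-- The representation of the von Neumann tensor product on the tensor product. -/
def inclVN : VN φ ψ →⋆ₐ[ℂ] (HilbertTensor H K →L[ℂ] HilbertTensor H K) :=
  (vnTensor φ ψ).toStarSubalgebra.subtype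

theorem inclVN_injective : Function.Injective (inclVN φ ψ) := Subtype.val_injective

theorem isDualRep_inclVN : IsDualRep (inclVN φ ψ) := by
  refine isDualRep_of_centralizer inclVN_injective ?_
  have : Set.range (inclVN φ ψ) =
      (vnTensor φ ψ : Set (HilbertTensor H K →L[ℂ] HilbertTensor H K)) := Subtype.range_val
  rw [this]
  exact (vnTensor φ ψ).centralizer_centralizer

theorem exists_eq_coeffRight (hψ : IsDualRep ψ) (T : VN φ ψ) (x x' : H) :
    ∃ b, ψ b = coeffRight T.1 x x' := by
  have : coeffRight T.1 x x' ∈ Set.range ψ := by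
    rw [← range_map_eq_centralizer hψ]
    intro z hz
    have := congrArg (fun S => coeffRight S x x') ((mem_vnTensor_iff.1 T.2).2 z hz)
    simp only [coeffRight_opTensor_mul, coeffRight_mul_opTensor] at this
    have e : (1 : H →L[ℂ] H).adjoint x = x := by
      rw [← ContinuousLinearMap.star_eq_adjoint, star_one]; rfl
    rw [e] at this
    exact this
  exact this

/-- The coefficients of an element of the tensor product in the second factor. -/
def rcoeff (hψ : IsDualRep ψ) (T : VN φ ψ) (x x' : H) : B := (exists_eq_coeffRight hψ T x x').choose

theorem map_rcoeff (hψ : IsDualRep ψ) (T : VN φ ψ) (x x' : H) :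
    ψ (rcoeff hψ T x x') = coeffRight T.1 x x' := (exists_eq_coeffRight hψ T x x').choose_spec

theorem rcoeff_eq (hψ : IsDualRep ψ) {T : VN φ ψ} {x x' : H} {b : B}
    (h : coeffRight T.1 x x' = ψ b) : rcoeff hψ T x x' = b :=
  hψ.injective ((map_rcoeff hψ T x x').trans h)

theorem rcoeff_add (hψ : IsDualRep ψ) (S T : VN φ ψ) (x x' : H) :
    rcoeff hψ (S + T) x x' = rcoeff hψ S x x' + rcoeff hψ T x x' :=
  rcoeff_eq hψ (by rw [map_add, map_rcoeff, map_rcoeff]; exact coeffRight_add _ _ _ _)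

theorem rcoeff_smul (hψ : IsDualRep ψ) (c : ℂ) (T : VN φ ψ) (x x' : H) :
    rcoeff hψ (c • T) x x' = c • rcoeff hψ T x x' :=
  rcoeff_eq hψ (by rw [map_smul, map_rcoeff]; exact coeffRight_smul _ _ _ _)

theorem rcoeff_tmul (hψ : IsDualRep ψ) (a : A) (b : B) (x x' : H) :
    rcoeff hψ (tmul φ ψ a b) x x' = ⟪x, φ a x'⟫_ℂ • b :=
  rcoeff_eq hψ (by rw [map_smul]; exact coeffRight_opTensor _ _ _ _)

theorem norm_rcoeff_le (hψ : IsDualRep ψ) (T : VN φ ψ) (x x' : H) :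
    ‖rcoeff hψ T x x'‖ ≤ ‖T‖ * ‖x‖ * ‖x'‖ := by
  rw [← hψ.norm_map, map_rcoeff]
  exact norm_coeffRight_le _ _ _

/-- Commutation with `y ⊗ 1` as a relation between coefficients; any map applied to the coefficients
preserves it. -/
theorem rcoeff_commutant (hψ : IsDualRep ψ) (T : VN φ ψ) {y : H →L[ℂ] H}
    (hy : y ∈ Set.centralizer (Set.range φ)) (x x' : H) :
    rcoeff hψ T x (y x') = rcoeff hψ T (y.adjoint x) x' := by
  refine rcoeff_eq hψ ?_
  have := congrArg (fun S => coeffRight S x x') ((mem_vnTensor_iff.1 T.2).1 y hy)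
  simp only [coeffRight_opTensor_mul, coeffRight_mul_opTensor, one_mul, mul_one] at this
  rw [map_rcoeff, this]

theorem ext_rcoeff (hψ : IsDualRep ψ) {S T : VN φ ψ}
    (h : ∀ x x', rcoeff hψ S x x' = rcoeff hψ T x x') : S = T :=
  Subtype.ext (ext_coeffRight fun x x' => by rw [← map_rcoeff hψ, ← map_rcoeff hψ, h])

variable {B₂ K₂ : Type*} [CStarAlgebra B₂] [NormedAddCommGroup K₂] [InnerProductSpace ℂ K₂]
  [CompleteSpace K₂] {ψ₂ : B₂ →⋆ₐ[ℂ] (K₂ →L[ℂ] K₂)} {π : B →ₗ[ℂ] B₂}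

/-- Coefficients in `ψ₂ (B₂)` give commutation with `1 ⊗ z`, and the inherited relation
`rcoeff_commutant` gives commutation with `y ⊗ 1`. -/
theorem exists_slice_mem (hψ : IsDualRep ψ) (hψ₂ : IsDualRep ψ₂) (hπ : IsCCP π) (T : VN φ ψ) :
    ∃ R : VN φ ψ₂, (∀ x x', rcoeff hψ₂ R x x' = π (rcoeff hψ T x x')) ∧ ‖R‖ ≤ ‖T‖ := by
  obtain ⟨R, hR, hn⟩ := exists_slice hψ.injective hψ₂.injective hπ T.1 (rcoeff hψ T)
    (map_rcoeff hψ T)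
  have hmem : R ∈ (vnTensor φ ψ₂).toStarSubalgebra := by
    refine mem_vnTensor_iff.2 ⟨fun y hy => ext_coeffRight fun x x' => ?_,
      fun z hz => ext_coeffRight fun x x' => ?_⟩
    · rw [coeffRight_opTensor_mul, coeffRight_mul_opTensor, one_mul, mul_one, hR, hR,
        rcoeff_commutant hψ T hy]
    · rw [coeffRight_opTensor_mul, coeffRight_mul_opTensor, hR, hR]
      have e : (1 : H →L[ℂ] H).adjoint x = x := by
        rw [← ContinuousLinearMap.star_eq_adjoint, star_one]; rfl
      rw [e]
      exact (hz _ ⟨_, rfl⟩).symm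
  exact ⟨⟨R, hmem⟩, fun x x' => rcoeff_eq hψ₂ (hR x x'), hn⟩

/-- The map `id ⊗ π` between von Neumann tensor products. -/
def idSlice (hψ : IsDualRep ψ) (hψ₂ : IsDualRep ψ₂) (hπ : IsCCP π) : VN φ ψ →ₗ[ℂ] VN φ ψ₂ where
  toFun T := (exists_slice_mem hψ hψ₂ hπ T).choose
  map_add' S T := ext_rcoeff hψ₂ fun x x' => by
    rw [rcoeff_add, (exists_slice_mem hψ hψ₂ hπ _).choose_spec.1,
      (exists_slice_mem hψ hψ₂ hπ _).choose_spec.1, (exists_slice_mem hψ hψ₂ hπ _).choose_spec.1,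
      rcoeff_add, map_add]
  map_smul' c T := ext_rcoeff hψ₂ fun x x' => by
    rw [RingHom.id_apply, rcoeff_smul, (exists_slice_mem hψ hψ₂ hπ _).choose_spec.1,
      (exists_slice_mem hψ hψ₂ hπ _).choose_spec.1, rcoeff_smul, map_smul]

theorem rcoeff_idSlice (hψ : IsDualRep ψ) (hψ₂ : IsDualRep ψ₂) (hπ : IsCCP π) (T : VN φ ψ)
    (x x' : H) : rcoeff hψ₂ (idSlice hψ hψ₂ hπ T) x x' = π (rcoeff hψ T x x') :=
  (exists_slice_mem hψ hψ₂ hπ T).choose_spec.1 x x'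

theorem norm_idSlice_le (hψ : IsDualRep ψ) (hψ₂ : IsDualRep ψ₂) (hπ : IsCCP π) (T : VN φ ψ) :
    ‖idSlice hψ hψ₂ hπ T‖ ≤ ‖T‖ := (exists_slice_mem hψ hψ₂ hπ T).choose_spec.2

theorem idSlice_tmul (hψ : IsDualRep ψ) (hψ₂ : IsDualRep ψ₂) (hπ : IsCCP π) (a : A) (b : B) :
    idSlice hψ hψ₂ hπ (tmul φ ψ a b) = tmul φ ψ₂ a (π b) :=
  ext_rcoeff hψ₂ fun x x' => by
    rw [rcoeff_idSlice, rcoeff_tmul, rcoeff_tmul, map_smul]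

theorem exists_sum_leftTensor {z : HilbertTensor H K}
    (hz : z ∈ Submodule.span ℂ (Set.range fun p : H × K => leftTensor p.1 p.2)) :
    ∃ (s : Finset (H × K)) (u : H × K → K), z = ∑ p : s, leftTensor p.1.1 (u p.1) := by
  obtain ⟨c, rfl⟩ := Finsupp.mem_span_range_iff_exists_finsupp.1 hz
  refine ⟨c.support, fun p => c p • p.2, ?_⟩
  rw [Finset.sum_coe_sort c.support fun p => leftTensor p.1 (c p • p.2)]
  exact Finset.sum_congr rfl fun p _ => (map_smul _ _ _).symm

theorem quadForm_sum {ι : Type*} [Fintype ι] {J : ι → Type*} [∀ k, Fintype (J k)]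
    (hψ : IsDualRep ψ) (T : ι → ι → VN φ ψ) (x : ∀ k, J k → H) (u : ∀ k, J k → K) :
    quadForm ψ (fun p q : Σ k, J k => rcoeff hψ (T p.1 q.1) (x p.1 p.2) (x q.1 q.2))
        (fun p => u p.1 p.2) =
      quadForm (inclVN φ ψ) T (fun k => ∑ p, leftTensor (x k p) (u k p)) := by
  simp only [quadForm, Fintype.sum_sigma, map_rcoeff]
  refine Finset.sum_congr rfl fun k _ => ?_
  rw [Finset.sum_comm]
  refine Finset.sum_congr rfl fun l _ => ?_
  exact sum_inner_coeffRight (T k l).1 (x k) (x l) (u k) (u l)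

/-- On sums of elementary tensors the quadratic form of a matrix over the tensor product is that of
a larger matrix of coefficients (`quadForm_sum`), to which complete positivity of `π` applies. Such
sums are dense. -/
theorem isCCP_idSlice (hψ : IsDualRep ψ) (hψ₂ : IsDualRep ψ₂) (hπ : IsCCP π) :
    IsCCP (idSlice (φ := φ) hψ hψ₂ hπ) := by
  refine isCCP_of_opPos (φ := inclVN φ ψ) (ψ := inclVN φ ψ₂) inclVN_injective inclVN_injective
    (fun n T hT => ?_) (norm_idSlice_le hψ hψ₂ hπ)
  have hclosed : IsClosed {η : Fin n → HilbertTensor H K₂ |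
      0 ≤ quadForm (inclVN φ ψ₂) (fun k l => idSlice hψ hψ₂ hπ (T k l)) η} := by
    refine isClosed_Ici.preimage (f := fun η => quadForm (inclVN φ ψ₂) _ η) ?_
    unfold quadForm
    fun_prop
  have hdense : Dense {η : Fin n → HilbertTensor H K₂ | ∀ k, η k ∈
      Submodule.span ℂ (Set.range fun p : H × K₂ => leftTensor p.1 p.2)} := by
    have := dense_pi (I := Set.univ) (ι := Fin n) (α := fun _ => HilbertTensor H K₂)
      (s := fun _ => (Submodule.span ℂ (Set.range fun p : H × K₂ => leftTensor p.1 p.2) :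
        Set (HilbertTensor H K₂))) fun _ _ =>
      Submodule.dense_iff_topologicalClosure_eq_top.2 dense_span_leftTensor
    simpa [Set.pi] using this
  intro η
  refine (hclosed.closure_subset_iff.2 fun η hη => ?_) (hdense η)
  choose s u hu using fun k => exists_sum_leftTensor (hη k)
  have h1 := quadForm_sum (J := fun k => ↥(s k)) hψ₂ (fun k l => idSlice hψ hψ₂ hπ (T k l))
    (fun k p => p.1.1) (fun k p => u k p.1)
  simp only [← hu, rcoeff_idSlice] at h1
  change 0 ≤ quadForm (inclVN φ ψ₂) (fun k l => idSlice hψ hψ₂ hπ (T k l)) η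
  rw [← h1]
  refine hπ.opPos hψ.injective hψ₂.injective (ψ := ψ₂) (fun ξ => ?_) _
  have h2 := quadForm_sum (J := fun k => ↥(s k)) hψ T (fun k p => p.1.1) (fun k p => ξ ⟨k, p⟩)
  exact (hT _).trans_eq h2.symm

end Slice

/-! ### The flip and the slice maps `θ ⊗ id` -/

section Swap

variable {H K : Type*} [NormedAddCommGroup H] [InnerProductSpace ℂ H]
  [NormedAddCommGroup K] [InnerProductSpace ℂ K]

variable (H K) in
/-- The flip `H ⊗ K → K ⊗ H`. -/
def swapL : HilbertTensor H K →L[ℂ] HilbertTensor K H :=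
  ContinuousLinearMap.completion
    ((TensorProduct.commIsometry ℂ H K).toContinuousLinearEquiv : H ⊗[ℂ] K →L[ℂ] K ⊗[ℂ] H)

theorem swapL_leftTensor (x : H) (y : K) : swapL H K (leftTensor x y) = leftTensor y x := by
  rw [leftTensor_apply, swapL, ContinuousLinearMap.completion_apply_coe]
  rfl

theorem swapL_swapL (z : HilbertTensor H K) : swapL K H (swapL H K z) = z := by
  have : swapL K H ∘L swapL H K = ContinuousLinearMap.id ℂ (HilbertTensor H K) :=
    ext_leftTensor fun x y => by
      rw [ContinuousLinearMap.comp_apply, swapL_leftTensor, swapL_leftTensor]; rfl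
  exact DFunLike.congr_fun this z

variable [CompleteSpace H] [CompleteSpace K]

theorem adjoint_swapL : (swapL H K).adjoint = swapL K H :=
  ext_leftTensor fun y x => eq_of_inner_leftTensor fun x' y' => by
    rw [ContinuousLinearMap.adjoint_inner_right (swapL H K) (leftTensor x' y') (leftTensor y x),
      swapL_leftTensor, swapL_leftTensor, inner_leftTensor, inner_leftTensor, mul_comm]

/-- Conjugation of an operator by the flip. -/
def swapOp (T : HilbertTensor H K →L[ℂ] HilbertTensor H K) :
    HilbertTensor K H →L[ℂ] HilbertTensor K H := swapL H K ∘L T ∘L swapL K H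

theorem swapOp_swapOp (T : HilbertTensor H K →L[ℂ] HilbertTensor H K) : swapOp (swapOp T) = T := by
  ext z
  simp [swapOp, swapL_swapL]

theorem swapOp_mul (S T : HilbertTensor H K →L[ℂ] HilbertTensor H K) :
    swapOp (S * T) = swapOp S * swapOp T := by
  ext z
  simp [swapOp, swapL_swapL, mul_apply_eq_comp]

theorem swapOp_opTensor (S : H →L[ℂ] H) (T : K →L[ℂ] K) :
    swapOp (opTensor S T) = opTensor T S :=
  ext_leftTensor fun x y => by
    simp only [swapOp, ContinuousLinearMap.comp_apply, swapL_leftTensor, opTensor_leftTensor]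

theorem swapOp_star (T : HilbertTensor H K →L[ℂ] HilbertTensor H K) :
    swapOp (star T) = star (swapOp T) := by
  simp [swapOp, ContinuousLinearMap.star_eq_adjoint, ContinuousLinearMap.adjoint_comp,
    ContinuousLinearMap.comp_assoc, adjoint_swapL]

theorem coeffRight_swapOp (T : HilbertTensor H K →L[ℂ] HilbertTensor H K) (y y' : K) :
    coeffRight (swapOp T) y y' = coeffLeft T y y' := by
  ext u
  refine ext_inner_left ℂ fun v => ?_
  rw [coeffRight_inner, coeffLeft_inner, swapOp, ContinuousLinearMap.comp_apply,
    ContinuousLinearMap.comp_apply, swapL_leftTensor, ← adjoint_swapL,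
    ContinuousLinearMap.adjoint_inner_right, swapL_leftTensor]

end Swap

section SwapVN

variable {A H : Type*} [CStarAlgebra A] [NormedAddCommGroup H] [InnerProductSpace ℂ H]
  [CompleteSpace H] {φ : A →⋆ₐ[ℂ] (H →L[ℂ] H)}
  {B K : Type*} [CStarAlgebra B] [NormedAddCommGroup K] [InnerProductSpace ℂ K]
  [CompleteSpace K] {ψ : B →⋆ₐ[ℂ] (K →L[ℂ] K)}

theorem swapOp_mem {T : HilbertTensor H K →L[ℂ] HilbertTensor H K}
    (hT : T ∈ (vnTensor φ ψ).toStarSubalgebra) : swapOp T ∈ (vnTensor ψ φ).toStarSubalgebra := by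
  rw [mem_vnTensor_iff] at hT ⊢
  refine ⟨fun z hz => ?_, fun y hy => ?_⟩
  · rw [← swapOp_opTensor, ← swapOp_mul, ← swapOp_mul, hT.2 z hz]
  · rw [← swapOp_opTensor, ← swapOp_mul, ← swapOp_mul, hT.1 y hy]

variable (φ ψ) in
/-- The flip of a von Neumann tensor product. -/
def swapVN : VN φ ψ →⋆ₐ[ℂ] VN ψ φ where
  toFun T := ⟨swapOp T.1, swapOp_mem T.2⟩
  map_one' := Subtype.ext (by ext z; simp [swapOp, swapL_swapL])
  map_mul' S T := Subtype.ext (swapOp_mul S.1 T.1)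
  map_zero' := Subtype.ext (by ext z; simp [swapOp])
  map_add' S T := Subtype.ext (by ext z; simp [swapOp])
  commutes' c := Subtype.ext (by ext z; simp [swapOp, swapL_swapL, Algebra.algebraMap_eq_smul_one])
  map_star' T := Subtype.ext (swapOp_star T.1)

theorem swapVN_swapVN (T : VN φ ψ) : swapVN ψ φ (swapVN φ ψ T) = T :=
  Subtype.ext (swapOp_swapOp T.1)

theorem swapVN_tmul (a : A) (b : B) : swapVN φ ψ (tmul φ ψ a b) = tmul ψ φ b a :=
  Subtype.ext (swapOp_opTensor _ _)

/-- The linear map underlying a `*`-homomorphism. -/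
def starLin (g : A →⋆ₙₐ[ℂ] B) : A →ₗ[ℂ] B where
  toFun := g
  map_add' := map_add g
  map_smul' := map_smul g

variable (φ ψ) in
/-- The flip of a von Neumann tensor product as a linear map. -/
def swapLin : VN φ ψ →ₗ[ℂ] VN ψ φ := starLin (swapVN φ ψ : VN φ ψ →⋆ₙₐ[ℂ] VN ψ φ)

/-- The coefficients of an element of the tensor product in the first factor. -/
def lcoeff (hφ : IsDualRep φ) (T : VN φ ψ) (y y' : K) : A := rcoeff hφ (swapVN φ ψ T) y y'

theorem map_lcoeff (hφ : IsDualRep φ) (T : VN φ ψ) (y y' : K) :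
    φ (lcoeff hφ T y y') = coeffLeft T.1 y y' :=
  (map_rcoeff hφ _ y y').trans (coeffRight_swapOp T.1 y y')

theorem inner_lcoeff (hφ : IsDualRep φ) (T : VN φ ψ) (y y' : K) (x x' : H) :
    ⟪x, φ (lcoeff hφ T y y') x'⟫_ℂ = ⟪leftTensor x y, T.1 (leftTensor x' y')⟫_ℂ := by
  rw [map_lcoeff]; exact coeffLeft_inner _ _ _ _ _

theorem inner_rcoeff (hψ : IsDualRep ψ) (T : VN φ ψ) (x x' : H) (y y' : K) :
    ⟪y, ψ (rcoeff hψ T x x') y'⟫_ℂ = ⟪leftTensor x y, T.1 (leftTensor x' y')⟫_ℂ := by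
  rw [map_rcoeff]; exact coeffRight_inner _ _ _ _ _

theorem norm_lcoeff_le (hφ : IsDualRep φ) (T : VN φ ψ) (y y' : K) :
    ‖lcoeff hφ T y y'‖ ≤ ‖T‖ * ‖y‖ * ‖y'‖ :=
  (norm_rcoeff_le hφ _ y y').trans (by
    gcongr
    exact NonUnitalStarAlgHom.norm_apply_le (swapVN φ ψ) T)

theorem ext_lcoeff (hφ : IsDualRep φ) {S T : VN φ ψ}
    (h : ∀ y y', lcoeff hφ S y y' = lcoeff hφ T y y') : S = T := by
  rw [← swapVN_swapVN S, ← swapVN_swapVN T, ext_rcoeff hφ h]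

variable {A₂ H₂ : Type*} [CStarAlgebra A₂] [NormedAddCommGroup H₂] [InnerProductSpace ℂ H₂]
  [CompleteSpace H₂] {φ₂ : A₂ →⋆ₐ[ℂ] (H₂ →L[ℂ] H₂)} {θ : A →ₗ[ℂ] A₂}

/-- The map `θ ⊗ id` between von Neumann tensor products. -/
def sliceId (hφ : IsDualRep φ) (hφ₂ : IsDualRep φ₂) (hθ : IsCCP θ) : VN φ ψ →ₗ[ℂ] VN φ₂ ψ :=
  swapLin ψ φ₂ ∘ₗ idSlice hφ hφ₂ hθ ∘ₗ swapLin φ ψ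

theorem sliceId_apply (hφ : IsDualRep φ) (hφ₂ : IsDualRep φ₂) (hθ : IsCCP θ) (T : VN φ ψ) :
    sliceId hφ hφ₂ hθ T = swapVN ψ φ₂ (idSlice hφ hφ₂ hθ (swapVN φ ψ T)) := rfl

theorem lcoeff_sliceId (hφ : IsDualRep φ) (hφ₂ : IsDualRep φ₂) (hθ : IsCCP θ) (T : VN φ ψ)
    (y y' : K) : lcoeff hφ₂ (sliceId hφ hφ₂ hθ T) y y' = θ (lcoeff hφ T y y') := by
  rw [lcoeff, sliceId_apply, swapVN_swapVN, rcoeff_idSlice]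
  rfl

theorem sliceId_tmul (hφ : IsDualRep φ) (hφ₂ : IsDualRep φ₂) (hθ : IsCCP θ) (a : A) (b : B) :
    sliceId hφ hφ₂ hθ (tmul φ ψ a b) = tmul φ₂ ψ (θ a) b := by
  rw [sliceId_apply, swapVN_tmul, idSlice_tmul, swapVN_tmul]

theorem isCCP_sliceId (hφ : IsDualRep φ) (hφ₂ : IsDualRep φ₂) (hθ : IsCCP θ) :
    IsCCP (sliceId (ψ := ψ) hφ hφ₂ hθ) :=
  (isCCP_of_starAlgHom (swapVN ψ φ₂ : VN ψ φ₂ →⋆ₙₐ[ℂ] VN φ₂ ψ)).comp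
    ((isCCP_idSlice hφ hφ₂ hθ).comp
      (isCCP_of_starAlgHom (swapVN φ ψ : VN φ ψ →⋆ₙₐ[ℂ] VN ψ φ)))

end SwapVN

/-! ### Normal maps, normality of slice maps, and their commutation -/

section Normal

variable {A H : Type*} [CStarAlgebra A] [NormedAddCommGroup H] [InnerProductSpace ℂ H]
  [CompleteSpace H] {φ : A →⋆ₐ[ℂ] (H →L[ℂ] H)}
  {B K : Type*} [CStarAlgebra B] [NormedAddCommGroup K] [InnerProductSpace ℂ K]
  [CompleteSpace K] {ψ : B →⋆ₐ[ℂ] (K →L[ℂ] K)}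

/-- Vector functionals depend continuously on each vector, so those of a total set determine the
rest. -/
theorem normalDual_le_of_total {s : Set H} (hs : (Submodule.span ℂ s).topologicalClosure = ⊤)
    {P : Submodule ℂ (StrongDual ℂ A)} (hP : IsClosed (P : Set (StrongDual ℂ A)))
    (h : ∀ x ∈ s, ∀ y ∈ s, vecFun φ x y ∈ P) : normalDual φ ≤ P := by
  let R : H → H →L[ℂ] StrongDual ℂ A := fun x => LinearMap.mkContinuous
    { toFun := fun y => vecFun φ x y
      map_add' := fun y y' => by ext a; simp [vecFun_apply, inner_add_right]
      map_smul' := fun c y => by ext a; simp [vecFun_apply, inner_smul_right] } ‖x‖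
    fun y => norm_vecFun_le φ x y
  let L : H → H →L⋆[ℂ] StrongDual ℂ A := fun y => LinearMap.mkContinuous
    { toFun := fun x => vecFun φ x y
      map_add' := fun y y' => by ext a; simp [vecFun_apply, inner_add_left]
      map_smul' := fun c y => by ext a; simp [vecFun_apply, inner_smul_left, mul_comm] } ‖y‖
    fun x => (norm_vecFun_le φ x y).trans_eq (mul_comm _ _)
  have h1 : ∀ x ∈ s, ∀ y, vecFun φ x y ∈ P := fun x hx y => by
    have : (⊤ : Submodule ℂ H) ≤ P.comap (R x : H →ₗ[ℂ] StrongDual ℂ A) :=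
      hs ▸ Submodule.topologicalClosure_minimal _ (Submodule.span_le.2 fun y hy => h x hx y hy)
        (hP.preimage (R x).continuous)
    exact this (Submodule.mem_top (x := y))
  refine normalDual_le φ hP fun x y => ?_
  have : (⊤ : Submodule ℂ H) ≤ P.comap (L y : H →ₗ⋆[ℂ] StrongDual ℂ A) :=
    hs ▸ Submodule.topologicalClosure_minimal _ (Submodule.span_le.2 fun x hx => h1 x hx y)
      (hP.preimage (L y).continuous)
  exact this (Submodule.mem_top (x := x))

variable (φ ψ) in
/-- A linear map that pulls normal functionals back to normal functionals. -/
def IsNormalMap (f : A →ₗ[ℂ] B) : Prop :=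
  ∀ ω ∈ normalDual ψ, ∃ ω' ∈ normalDual φ, ∀ a, ω' a = ω (f a)

theorem IsNormalMap.comp {C L : Type*} [CStarAlgebra C] [NormedAddCommGroup L]
    [InnerProductSpace ℂ L] [CompleteSpace L] {χ : C →⋆ₐ[ℂ] (L →L[ℂ] L)} {g : B →ₗ[ℂ] C}
    {f : A →ₗ[ℂ] B} (hg : IsNormalMap ψ χ g) (hf : IsNormalMap φ ψ f) :
    IsNormalMap φ χ (g ∘ₗ f) := fun ω hω => by
  obtain ⟨ω', hω', h'⟩ := hg ω hω
  obtain ⟨ω'', hω'', h''⟩ := hf ω' hω'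
  exact ⟨ω'', hω'', fun a => (h'' a).trans (h' _)⟩

theorem isNormalMap_iff_continuous (hφ : IsDualRep φ) (hψ : IsDualRep ψ) {f : A →ₗ[ℂ] B} :
    IsNormalMap φ ψ f ↔ Continuous[repTopology φ, repTopology ψ] f := by
  letI := repTopology φ
  have hω : ∀ ω ∈ normalDual φ, Continuous ω := fun ω h =>
    (hφ.continuous_iff (g := fun a : A => a)).1 continuous_induced_dom ω h
  rw [continuous_induced_rng]
  change _ ↔ Continuous[inferInstance, ultraweak K] fun a => ψ (f a)
  rw [hψ.continuous_iff]
  refine ⟨fun h ω hω' => ?_, fun h ω hω' => ?_⟩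
  · obtain ⟨ω', h1, h2⟩ := h ω hω'
    exact (hω ω' h1).congr h2
  · exact hφ.mem_normalDual_of_continuous ((ω : B →ₗ[ℂ] ℂ) ∘ₗ f) (h ω hω')

theorem isNormalMap_of_total {s : Set K} (hs : (Submodule.span ℂ s).topologicalClosure = ⊤)
    {f : A →ₗ[ℂ] B} (hf : ∀ a, ‖f a‖ ≤ ‖a‖)
    (h : ∀ x ∈ s, ∀ y ∈ s, ∃ ω ∈ normalDual φ, ∀ a, ω a = ⟪x, ψ (f a) y⟫_ℂ) :
    IsNormalMap φ ψ f := by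
  let F : A →L[ℂ] B := f.mkContinuous 1 fun a => (hf a).trans_eq (one_mul _).symm
  let R : StrongDual ℂ B →L[ℂ] StrongDual ℂ A := ContinuousLinearMap.precomp ℂ F
  have : normalDual ψ ≤ (normalDual φ).comap (R : _ →ₗ[ℂ] _) :=
    normalDual_le_of_total hs ((isClosed_normalDual φ).preimage R.continuous) fun x hx y hy => by
      obtain ⟨ω, hω, h'⟩ := h x hx y hy
      have e : R (vecFun ψ x y) = ω := by
        ext a
        exact (h' a).symm
      change R (vecFun ψ x y) ∈ normalDual φ
      rwa [e]
  exact fun ω hω => ⟨R ω, this hω, fun a => rfl⟩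

theorem isNormalMap_swapLin : IsNormalMap (inclVN φ ψ) (inclVN ψ φ) (swapLin φ ψ) := by
  refine isNormalMap_of_total dense_span_leftTensor
    (fun T => NonUnitalStarAlgHom.norm_apply_le (swapVN φ ψ) T) ?_
  rintro _ ⟨p, rfl⟩ _ ⟨q, rfl⟩
  refine ⟨_, vecFun_mem _ (leftTensor p.2 p.1) (leftTensor q.2 q.1), fun T => ?_⟩
  have e1 := coeffRight_inner (swapOp T.1) p.1 q.1 q.2 p.2
  have e2 := coeffLeft_inner T.1 p.1 q.1 q.2 p.2
  rw [coeffRight_swapOp] at e1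
  exact e2.symm.trans e1

section Span

open scoped Pointwise

theorem adjoin_le_span {R : Type*} [Ring R] [StarRing R] [Algebra ℂ R] [StarModule ℂ R] {E : Set R}
    (h1 : 1 ∈ E) (hmul : ∀ S ∈ E, ∀ T ∈ E, S * T ∈ E) (hstar : ∀ T ∈ E, star T ∈ E) {T : R}
    (hT : T ∈ StarAlgebra.adjoin ℂ E) : T ∈ Submodule.span ℂ E := by
  refine StarAlgebra.adjoin_induction (p := fun T _ => T ∈ Submodule.span ℂ E)
    (fun T hT => Submodule.subset_span hT) (fun c => ?_) (fun S T _ _ => Submodule.add_mem _)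
    (fun S T _ _ hS hT => ?_) (fun T _ hT => ?_) hT
  · rw [Algebra.algebraMap_eq_smul_one]
    exact Submodule.smul_mem _ _ (Submodule.subset_span h1)
  · have := Submodule.mul_mem_mul hS hT
    rw [Submodule.span_mul_span] at this
    refine Submodule.span_mono ?_ this
    rintro _ ⟨S, hS, T, hT, rfl⟩
    exact hmul S hS T hT
  · refine Submodule.span_induction (p := fun T _ => star T ∈ Submodule.span ℂ E)
      (fun T hT => Submodule.subset_span (hstar T hT)) ?_ (fun S T _ _ hS hT => ?_)
      (fun c T _ hT => ?_) hT
    · rw [star_zero]; exact Submodule.zero_mem _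
    · rw [star_add]; exact Submodule.add_mem _ hS hT
    · rw [star_smul]; exact Submodule.smul_mem _ _ hT

end Span

theorem hasSum_of_mem_span {L : Type*} [NormedAddCommGroup L] [InnerProductSpace ℂ L]
    {E : Set (L →L[ℂ] L)} {x y : ℕ → L} (h : ∀ T ∈ E, HasSum (fun i => ⟪x i, T (y i)⟫_ℂ) 0)
    {T : L →L[ℂ] L} (hT : T ∈ Submodule.span ℂ E) : HasSum (fun i => ⟪x i, T (y i)⟫_ℂ) 0 := by
  refine Submodule.span_induction (p := fun T _ => HasSum (fun i => ⟪x i, T (y i)⟫_ℂ) 0)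
    h ?_ (fun S T _ _ hS hT => ?_) (fun c T _ hT => ?_) hT
  · simpa using hasSum_zero
  · simpa [inner_add_right] using hS.add hT
  · simpa [inner_smul_right] using hT.mul_left c

theorem star_mem_elementary {T : HilbertTensor H K →L[ℂ] HilbertTensor H K}
    (hT : T ∈ elementary φ ψ) : star T ∈ elementary φ ψ := by
  obtain ⟨p, rfl⟩ := hT
  exact ⟨(star p.1, star p.2), by simp only [star_opTensor, map_star]⟩

theorem one_mem_elementary : (1 : HilbertTensor H K →L[ℂ] HilbertTensor H K) ∈ elementary φ ψ :=
  ⟨(1, 1), ext_leftTensor fun x y => by simp [opTensor_leftTensor]⟩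

theorem mul_mem_elementary {S T : HilbertTensor H K →L[ℂ] HilbertTensor H K}
    (hS : S ∈ elementary φ ψ) (hT : T ∈ elementary φ ψ) : S * T ∈ elementary φ ψ := by
  obtain ⟨p, rfl⟩ := hS
  obtain ⟨q, rfl⟩ := hT
  exact ⟨(p.1 * q.1, p.2 * q.2), by simp only [map_mul, opTensor_mul]⟩

theorem mem_span_elementary {T : HilbertTensor H K →L[ℂ] HilbertTensor H K}
    (hT : T ∈ StarAlgebra.adjoin ℂ (elementary φ ψ)) : T ∈ Submodule.span ℂ (elementary φ ψ) :=
  adjoin_le_span (R := HilbertTensor H K →L[ℂ] HilbertTensor H K) (E := elementary φ ψ)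
    one_mem_elementary (fun _ hS _ hT => mul_mem_elementary hS hT)
    (fun _ hT => star_mem_elementary hT) hT

theorem mem_bicommutant_elementary (T : VN φ ψ) : T.1 ∈ Set.centralizer (Set.centralizer
    (Set.range (StarAlgebra.adjoin ℂ (elementary φ ψ)).subtype)) := by
  intro S hS
  have hE : ∀ R ∈ elementary φ ψ, R * S = S * R := fun R hR =>
    hS R ⟨⟨R, StarAlgebra.subset_adjoin ℂ _ hR⟩, rfl⟩
  exact ((StarSubalgebra.mem_centralizer_iff ℂ).1 T.2 S
    ((StarSubalgebra.mem_centralizer_iff ℂ).2 fun R hR =>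
      ⟨hE R hR, hE _ (star_mem_elementary hR)⟩)).1

/-- Ultraweak density of the elementary tensors: they span the `*`-algebra that they generate, and
the double commutant theorem extends the vanishing of a normal functional from it to the
bicommutant. -/
theorem eq_zero_of_tmul {ω : StrongDual ℂ (VN φ ψ)} (hω : ω ∈ normalDual (inclVN φ ψ))
    (h : ∀ a b, ω (tmul φ ψ a b) = 0) : ω = 0 := by
  obtain ⟨x, y, hx, hy, hs⟩ := (mem_normalDual_iff isDualRep_inclVN).1 hω
  have hsum : ∀ T ∈ elementary φ ψ, HasSum (fun i => ⟪x i, T (y i)⟫_ℂ) 0 := by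
    rintro _ ⟨p, rfl⟩
    rw [← h p.1 p.2]
    exact hs (tmul φ ψ p.1 p.2)
  have hD : ∀ d : StarAlgebra.adjoin ℂ (elementary φ ψ),
      ∑' i, ⟪x i, (StarAlgebra.adjoin ℂ (elementary φ ψ)).subtype d (y i)⟫_ℂ = 0 := fun d =>
    (hasSum_of_mem_span hsum (mem_span_elementary d.2)).tsum_eq
  ext T
  rw [← (hs T).tsum_eq]
  exact tsum_eq_zero_of_mem_centralizer (StarAlgebra.adjoin ℂ (elementary φ ψ)).subtype hx hy
    hD (mem_bicommutant_elementary T)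

theorem IsNormalMap.ext {C L : Type*} [CStarAlgebra C] [NormedAddCommGroup L]
    [InnerProductSpace ℂ L] [CompleteSpace L] {χ : C →⋆ₐ[ℂ] (L →L[ℂ] L)} (hχ : IsDualRep χ)
    {f g : VN φ ψ →ₗ[ℂ] C} (hf : IsNormalMap (inclVN φ ψ) χ f) (hg : IsNormalMap (inclVN φ ψ) χ g)
    (h : ∀ a b, f (tmul φ ψ a b) = g (tmul φ ψ a b)) : f = g := by
  refine LinearMap.ext fun T => hχ.injective (ContinuousLinearMap.ext fun y =>
    ext_inner_left ℂ fun x => ?_)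
  obtain ⟨ω, hω, h1⟩ := hf _ (vecFun_mem χ x y)
  obtain ⟨ω', hω', h2⟩ := hg _ (vecFun_mem χ x y)
  have := eq_zero_of_tmul (Submodule.sub_mem _ hω hω') fun a b => by
    rw [sub_apply, h1, h2, h, sub_self]
  rw [← vecFun_apply, ← vecFun_apply, ← h1, ← h2, sub_eq_zero.1 this]

variable {B₂ K₂ : Type*} [CStarAlgebra B₂] [NormedAddCommGroup K₂] [InnerProductSpace ℂ K₂]
  [CompleteSpace K₂] {ψ₂ : B₂ →⋆ₐ[ℂ] (K₂ →L[ℂ] K₂)} {π : B →ₗ[ℂ] B₂}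
  {A₂ H₂ : Type*} [CStarAlgebra A₂] [NormedAddCommGroup H₂] [InnerProductSpace ℂ H₂]
  [CompleteSpace H₂] {φ₂ : A₂ →⋆ₐ[ℂ] (H₂ →L[ℂ] H₂)} {θ : A →ₗ[ℂ] A₂}

theorem summable_norm_leftTensor (x : H) {u : ℕ → K} (hu : Summable fun n => ‖u n‖ ^ 2) :
    Summable fun n => ‖leftTensor x (u n)‖ ^ 2 := by
  simp only [norm_leftTensor_apply, mul_pow]
  exact hu.mul_left _

theorem exists_normal_rcoeff (hψ : IsDualRep ψ) {ω : StrongDual ℂ B} (hω : ω ∈ normalDual ψ)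
    (x x' : H) : ∃ ω' ∈ normalDual (inclVN φ ψ), ∀ T, ω' T = ω (rcoeff hψ T x x') := by
  obtain ⟨u, v, hu, hv, hs⟩ := (mem_normalDual_iff hψ).1 hω
  obtain ⟨ω', hω', h2⟩ := exists_mem_normalDual_hasSum (inclVN φ ψ)
    (summable_norm_leftTensor x hu) (summable_norm_leftTensor x' hv)
  exact ⟨ω', hω', fun T => (h2 T).unique
    ((hs _).congr_fun' fun i => (inner_rcoeff hψ T x x' (u i) (v i)).symm)⟩

theorem inner_idSlice (hψ : IsDualRep ψ) (hψ₂ : IsDualRep ψ₂) (hπ : IsCCP π) (T : VN φ ψ)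
    (x x' : H) (y y' : K₂) :
    ⟪leftTensor x y, inclVN φ ψ₂ (idSlice hψ hψ₂ hπ T) (leftTensor x' y')⟫_ℂ =
      ⟪y, ψ₂ (π (rcoeff hψ T x x')) y'⟫_ℂ := by
  rw [← rcoeff_idSlice hψ hψ₂ hπ]
  exact (inner_rcoeff hψ₂ (idSlice hψ hψ₂ hπ T) x x' y y').symm

theorem isNormalMap_idSlice (hψ : IsDualRep ψ) (hψ₂ : IsDualRep ψ₂) (hπ : IsCCP π)
    (h : IsNormalMap ψ ψ₂ π) :
    IsNormalMap (inclVN φ ψ) (inclVN φ ψ₂) (idSlice hψ hψ₂ hπ) := by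
  refine isNormalMap_of_total (φ := inclVN φ ψ) (ψ := inclVN φ ψ₂) (f := idSlice hψ hψ₂ hπ)
    (s := Set.range fun p : H × K₂ => leftTensor p.1 p.2)
    dense_span_leftTensor (norm_idSlice_le hψ hψ₂ hπ) ?_
  rintro _ ⟨p, rfl⟩ _ ⟨q, rfl⟩
  obtain ⟨ω, hω, h1⟩ := h _ (vecFun_mem ψ₂ p.2 q.2)
  obtain ⟨ω', hω', h2⟩ := exists_normal_rcoeff (φ := φ) hψ hω p.1 q.1
  refine ⟨ω', hω', fun T => ?_⟩
  refine (h2 T).trans ((h1 _).trans ?_)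
  exact (inner_idSlice hψ hψ₂ hπ T p.1 q.1 p.2 q.2).symm

theorem isNormalMap_sliceId (hφ : IsDualRep φ) (hφ₂ : IsDualRep φ₂) (hθ : IsCCP θ)
    (h : IsNormalMap φ φ₂ θ) :
    IsNormalMap (inclVN φ ψ) (inclVN φ₂ ψ) (sliceId hφ hφ₂ hθ) :=
  IsNormalMap.comp (φ := inclVN φ ψ) (ψ := inclVN ψ φ₂) (χ := inclVN φ₂ ψ) (g := swapLin ψ φ₂)
    (f := idSlice hφ hφ₂ hθ ∘ₗ swapLin φ ψ) isNormalMap_swapLin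
    (IsNormalMap.comp (φ := inclVN φ ψ) (ψ := inclVN ψ φ) (χ := inclVN ψ φ₂)
      (g := idSlice hφ hφ₂ hθ) (f := swapLin φ ψ)
      (isNormalMap_idSlice hφ hφ₂ hθ h) isNormalMap_swapLin)

/-- A normal `θ` pulls a vector functional back to a sum of vector functionals. The coefficients of
`(θ ⊗ id) T` are then norm convergent series of coefficients of `T`. -/
theorem hasSum_rcoeff_sliceId (hφ : IsDualRep φ) (hφ₂ : IsDualRep φ₂) (hθ : IsCCP θ)
    (hψ : IsDualRep ψ) {x x' : H₂} {u v : ℕ → H} (hu : Summable fun n => ‖u n‖ ^ 2)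
    (hv : Summable fun n => ‖v n‖ ^ 2)
    (h : ∀ a, HasSum (fun n => ⟪u n, φ a (v n)⟫_ℂ) ⟪x, φ₂ (θ a) x'⟫_ℂ) (T : VN φ ψ) :
    HasSum (fun n => rcoeff hψ T (u n) (v n)) (rcoeff hψ (sliceId hφ hφ₂ hθ T) x x') := by
  have hsm : Summable fun n => rcoeff hψ T (u n) (v n) := by
    refine Summable.of_norm_bounded ((summable_inner_apply hu hv).mul_left ‖T‖) fun n => ?_
    rw [← mul_assoc]
    exact norm_rcoeff_le hψ T (u n) (v n)
  convert hsm.hasSum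
  refine hψ.injective (ContinuousLinearMap.ext fun b => ext_inner_left ℂ fun a => ?_)
  rw [inner_rcoeff, ← inner_lcoeff hφ₂, lcoeff_sliceId, ← vecFun_apply]
  refine (h _).unique ((hsm.hasSum.mapL (vecFun ψ a b)).congr_fun' fun n => ?_)
  rw [vecFun_apply, inner_rcoeff, inner_lcoeff]

/-- By norm convergence of that series, the bounded map `π` may be applied term by term; hence
normality of `θ` alone suffices. -/
theorem idSlice_sliceId (hφ : IsDualRep φ) (hφ₂ : IsDualRep φ₂) (hθ : IsCCP θ)
    (h : IsNormalMap φ φ₂ θ) (hψ : IsDualRep ψ) (hψ₂ : IsDualRep ψ₂) (hπ : IsCCP π) (T : VN φ ψ) :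
    idSlice hψ hψ₂ hπ (sliceId hφ hφ₂ hθ T) = sliceId hφ hφ₂ hθ (idSlice hψ hψ₂ hπ T) := by
  refine ext_rcoeff hψ₂ fun x x' => ?_
  rw [rcoeff_idSlice]
  obtain ⟨ω, hω, h1⟩ := h _ (vecFun_mem φ₂ x x')
  obtain ⟨u, v, hu, hv, hs⟩ := (mem_normalDual_iff hφ).1 hω
  have hs' : ∀ a, HasSum (fun n => ⟪u n, φ a (v n)⟫_ℂ) ⟪x, φ₂ (θ a) x'⟫_ℂ := fun a => by
    rw [← vecFun_apply, ← h1]; exact hs a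
  have hπc : Continuous π := (π.mkContinuous 1 fun a => (hπ.2 a).trans_eq (one_mul _).symm).continuous
  refine ((hasSum_rcoeff_sliceId hφ hφ₂ hθ hψ hu hv hs' T).map π hπc).unique
    ((hasSum_rcoeff_sliceId hφ hφ₂ hθ hψ₂ hu hv hs' _).congr_fun' fun n => ?_)
  exact (rcoeff_idSlice hψ hψ₂ hπ T _ _).symm

end Normal

/-! ### Order-continuous functionals are normal -/

section OrderNormal

open Filter

theorem exists_inner_eq {H V : Type*} [NormedAddCommGroup H] [InnerProductSpace ℂ H]
    [CompleteSpace H] [AddCommGroup V] [Module ℂ V] (u : V →ₗ[ℂ] H)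
    (g : V →ₗ[ℂ] ℂ) {C : ℝ} (h : ∀ v, ‖g v‖ ≤ C * ‖u v‖) : ∃ ζ : H, ∀ v, g v = ⟪ζ, u v⟫_ℂ := by
  have hker : LinearMap.ker u ≤ LinearMap.ker g := fun v hv => by
    have := h v
    rw [LinearMap.mem_ker.1 hv, norm_zero, mul_zero] at this
    exact norm_le_zero_iff.1 this
  let G : LinearMap.range u →ₗ[ℂ] ℂ :=
    (LinearMap.ker u).liftQ g hker ∘ₗ (u.quotKerEquivRange.symm : _ →ₗ[ℂ] _)
  have hG : ∀ v, G ⟨u v, v, rfl⟩ = g v := by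
    intro v
    have : u.quotKerEquivRange.symm ⟨u v, v, rfl⟩ = Submodule.Quotient.mk v := by
      rw [LinearEquiv.symm_apply_eq]; rfl
    change (LinearMap.ker u).liftQ g hker (u.quotKerEquivRange.symm ⟨u v, v, rfl⟩) = g v
    rw [this]
    exact Submodule.liftQ_apply _ _ _
  let G' : StrongDual ℂ (LinearMap.range u) := G.mkContinuous C (by
    rintro ⟨_, v, rfl⟩
    rw [hG]; exact h v)
  obtain ⟨F, hF, -⟩ := exists_extension_norm_eq (LinearMap.range u) G'
  refine ⟨(InnerProductSpace.toDual ℂ H).symm F, fun v => ?_⟩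
  rw [InnerProductSpace.toDual_symm_apply, ← hG]
  exact (hF ⟨u v, v, rfl⟩).symm

variable {A H : Type*} [CStarAlgebra A] [PartialOrder A] [StarOrderedRing A]
  [NormedAddCommGroup H] [InnerProductSpace ℂ H] [CompleteSpace H] {φ : A →⋆ₐ[ℂ] (H →L[ℂ] H)}
  {f : StrongDual ℂ A}

/-- The Cauchy–Schwarz inequality in the GNS space of `f`. -/
theorem norm_sq_apply_mul_le (hf : ∀ a, 0 ≤ a → 0 ≤ f a) (a b : A) :
    ‖f (a * b)‖ ^ 2 ≤ (f (a * star a)).re * (f (star b * b)).re := by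
  let g := PositiveLinearMap.mk₀ (f : A →ₗ[ℂ] ℂ) hf
  have h := norm_inner_le_norm (𝕜 := ℂ) (g.toPreGNS (star a)) (g.toPreGNS b)
  have hn : ∀ c : A, ‖g.toPreGNS c‖ ^ 2 = (f (star c * c)).re := fun c => by
    rw [PositiveLinearMap.preGNS_norm_def, Real.sq_sqrt]
    · rfl
    · exact (Complex.le_def.1 (hf _ (star_mul_self_nonneg c))).1
  have e : ⟪g.toPreGNS (star a), g.toPreGNS b⟫_ℂ = f (a * b) := by
    rw [PositiveLinearMap.preGNS_inner_def]
    change f (star (star a) * b) = _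
    rw [star_star]
  rw [e] at h
  calc _ ≤ (‖g.toPreGNS (star a)‖ * ‖g.toPreGNS b‖) ^ 2 := by gcongr
    _ = _ := by rw [mul_pow, hn, hn, star_star]

theorem re_apply_mono (hf : ∀ a, 0 ≤ a → 0 ≤ f a) {a b : A} (h : a ≤ b) :
    (f a).re ≤ (f b).re := by
  have := (Complex.le_def.1 (hf _ (sub_nonneg.2 h))).1
  rw [map_sub] at this
  simpa using this

theorem re_apply_nonneg (hf : ∀ a, 0 ≤ a → 0 ≤ f a) {a : A} (h : 0 ≤ a) : 0 ≤ (f a).re :=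
  (Complex.le_def.1 (hf _ h)).1

theorem le_iff_inner (hφ : Function.Injective φ) {a b : A} :
    a ≤ b ↔ ∀ ξ, ⟪ξ, φ a ξ⟫_ℂ ≤ ⟪ξ, φ b ξ⟫_ℂ := by
  rw [← sub_nonneg, nonneg_iff_inner hφ]
  simp only [map_sub, sub_apply, inner_sub_right, sub_nonneg]

theorem norm_le_one_of_mem_Icc {a : A} (h : a ∈ Set.Icc (0 : A) 1) : ‖a‖ ≤ 1 :=
  (CStarAlgebra.norm_le_one_iff_of_nonneg a h.1).2 h.2

theorem mul_self_le {a : A} (h : a ∈ Set.Icc (0 : A) 1) : a * a ≤ a := by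
  have hn := norm_le_one_of_mem_Icc h
  obtain ⟨r, rfl⟩ := exists_eq_star_mul_self h.1
  -- With `a = r* r`, one has `a² = r* (r r*) r ≤ ‖r r*‖ a ≤ a`.
  have e : star r * r * (star r * r) = star r * (r * star r) * r := by noncomm_ring
  rw [e]
  refine (CStarAlgebra.star_left_conjugate_le_norm_smul (IsSelfAdjoint.mul_star_self r)).trans ?_
  rw [CStarRing.norm_self_mul_star, ← CStarRing.norm_star_mul_self]
  exact (smul_le_smul_of_nonneg_right hn h.1).trans_eq (one_smul _ _)

/-- A functional that preserves suprema of chains. -/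
def ChainNormal (f : StrongDual ℂ A) : Prop :=
  ∀ S : Set A, S.Nonempty → IsChain (· ≤ ·) S → S ⊆ Set.Icc 0 1 → ∀ b, IsLUB S b →
    ∀ ε > 0, ∃ s ∈ S, ‖f (b - s)‖ < ε

/-- Limits along an ultrafilter finer than the order filter of the chain define a bounded functional
on the predual, hence an element `b`. Order is tested by vector functionals, so `b` is the supremum.
-/
theorem exists_isLUB (hφ : IsDualRep φ) {S : Set A} (hne : S.Nonempty) (hS : IsChain (· ≤ ·) S)
    (h01 : S ⊆ Set.Icc 0 1) : ∃ b, IsLUB S b ∧ ∃ U : Filter A, U.NeBot ∧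
      (∀ ω ∈ normalDual φ, Tendsto ω U (𝓝 (ω b))) ∧ ∀ s ∈ S, ∀ᶠ t in U, t ∈ S ∧ s ≤ t := by
  haveI : Nonempty S := hne.to_subtype
  haveI : IsDirectedOrder S := directedOn_univ_iff.1 (by
    rintro ⟨a, ha⟩ - ⟨b, hb⟩ -
    obtain ⟨c, hc, h1, h2⟩ := hS.directedOn a ha b hb
    exact ⟨⟨c, hc⟩, trivial, h1, h2⟩)
  let U : Ultrafilter S := Ultrafilter.of atTop
  have hev : ∀ s : S, ∀ᶠ t in (U : Filter S), s ≤ t := fun s =>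
    Ultrafilter.of_le atTop (eventually_ge_atTop s)
  have hlim : ∀ ω : StrongDual ℂ A, ∃ c ∈ Metric.closedBall (0 : ℂ) ‖ω‖,
      Tendsto (fun s : S => ω s) U (𝓝 c) := fun ω => by
    refine (isCompact_closedBall (0 : ℂ) ‖ω‖).ultrafilter_le_nhds
      (U.map fun s : S => ω s) (le_principal_iff.2 (Filter.mem_map.2 (univ_mem' fun s => ?_)))
    refine mem_closedBall_zero_iff.2 ((ω.le_opNorm _).trans ?_)
    exact mul_le_of_le_one_right (norm_nonneg _) (norm_le_one_of_mem_Icc (h01 s.2))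
  choose L hLm hL using hlim
  let F : StrongDual ℂ (NormalDual φ) := LinearMap.mkContinuous
    { toFun := fun w => L w.val
      map_add' := fun v w => by
        rw [map_add]
        exact tendsto_nhds_unique (hL _) ((hL v.val).add (hL w.val))
      map_smul' := fun c w => by
        rw [map_smul]
        exact tendsto_nhds_unique (hL _) ((hL w.val).const_mul c) } 1 fun w =>
    (mem_closedBall_zero_iff.1 (hLm w.val)).trans_eq (one_mul _).symm
  obtain ⟨b, hb⟩ := hφ.exists_eq F
  have ht : ∀ ω ∈ normalDual φ, Tendsto (fun s : S => ω s) U (𝓝 (ω b)) := fun ω hω => by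
    have := hb (.mk ω hω)
    rw [NormalDual.val_mk] at this
    rw [← this]
    exact hL ω
  refine ⟨b, ⟨fun s hs => ?_, fun c hc => ?_⟩, (U : Filter S).map Subtype.val, inferInstance,
    fun ω hω => ht ω hω, fun s hs => ?_⟩
  · refine (le_iff_inner hφ.injective).2 fun ξ => ge_of_tendsto (ht _ (vecFun_mem φ ξ ξ)) ?_
    exact (hev ⟨s, hs⟩).mono fun t h => (le_iff_inner hφ.injective).1 h ξ
  · refine (le_iff_inner hφ.injective).2 fun ξ => le_of_tendsto (ht _ (vecFun_mem φ ξ ξ)) ?_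
    exact Eventually.of_forall fun t => (le_iff_inner hφ.injective).1 (hc t.2) ξ
  · exact (hev ⟨s, hs⟩).mono fun t h => ⟨t.2, h⟩

theorem chainNormal_of_mem (hφ : IsDualRep φ) {ω : StrongDual ℂ A} (hω : ω ∈ normalDual φ) :
    ChainNormal ω := by
  intro S hne hS h01 b hb ε hε
  obtain ⟨b', hb', U, hU, ht, hev⟩ := exists_isLUB hφ hne hS h01
  obtain rfl := hb.unique hb'
  obtain ⟨s₀, hs₀⟩ := hne
  obtain ⟨s, hs, hd⟩ := ((hev s₀ hs₀).and (Metric.tendsto_nhds.1 (ht ω hω) ε hε)).exists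
  refine ⟨s, hs.1, ?_⟩
  rwa [map_sub, ← dist_eq_norm, dist_comm]

/-- The functional `a ↦ f (a * d)`. -/
def mulFun (f : StrongDual ℂ A) (d : A) : StrongDual ℂ A :=
  f ∘L (ContinuousLinearMap.mul ℂ A).flip d

omit [PartialOrder A] [StarOrderedRing A] in
theorem mulFun_apply (d a : A) : mulFun f d a = f (a * d) := rfl

omit [PartialOrder A] [StarOrderedRing A] in
theorem mulFun_sub (d e : A) : mulFun f (d - e) = mulFun f d - mulFun f e := by
  ext a
  simp [mulFun_apply, mul_sub]

omit [PartialOrder A] [StarOrderedRing A] in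
theorem mulFun_add (d e : A) : mulFun f (d + e) = mulFun f d + mulFun f e := by
  ext a
  simp [mulFun_apply, mul_add]

theorem norm_mulFun_le (hf : ∀ a, 0 ≤ a → 0 ≤ f a) {d : A} (hd : d ∈ Set.Icc (0 : A) 1) :
    ‖mulFun f d‖ ^ 2 ≤ (f 1).re * (f d).re := by
  have h1 := re_apply_nonneg hf zero_le_one
  have h2 := re_apply_nonneg hf hd.1
  have : ‖mulFun f d‖ ≤ √((f 1).re * (f d).re) := by
    refine ContinuousLinearMap.opNorm_le_bound _ (Real.sqrt_nonneg _) fun a => ?_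
    refine abs_le_of_sq_le_sq' ?_ (by positivity) |>.2
    rw [mulFun_apply, mul_pow, Real.sq_sqrt (by positivity)]
    refine (norm_sq_apply_mul_le hf a d).trans ?_
    have h3 : (f (a * star a)).re ≤ ‖a‖ ^ 2 * (f 1).re := by
      refine (re_apply_mono hf CStarAlgebra.mul_star_le_algebraMap_norm_sq).trans_eq ?_
      rw [Algebra.algebraMap_eq_smul_one, ← Complex.coe_smul, map_smul, smul_eq_mul,
        Complex.re_ofReal_mul]
    have h4 : (f (star d * d)).re ≤ (f d).re := by
      rw [(IsSelfAdjoint.of_nonneg hd.1).star_eq]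
      exact re_apply_mono hf (mul_self_le hd)
    calc _ ≤ ‖a‖ ^ 2 * (f 1).re * (f d).re :=
          mul_le_mul h3 h4 (re_apply_nonneg hf (star_mul_self_nonneg d)) (by positivity)
      _ = _ := by ring
  calc _ ≤ √((f 1).re * (f d).re) ^ 2 := by gcongr
    _ = _ := Real.sq_sqrt (by positivity)

theorem mulFun_mem_of_isLUB (hf : ∀ a, 0 ≤ a → 0 ≤ f a) (hn : ChainNormal f) {S : Set A}
    (hne : S.Nonempty) (hS : IsChain (· ≤ ·) S) (h01 : S ⊆ Set.Icc 0 1) {b : A} (hb : IsLUB S b)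
    (h : ∀ s ∈ S, mulFun f s ∈ normalDual φ) : mulFun f b ∈ normalDual φ := by
  have h1 := re_apply_nonneg hf zero_le_one
  refine (isClosed_normalDual φ).closure_subset (Metric.mem_closure_iff.2 fun ε hε => ?_)
  obtain ⟨s, hs, hd⟩ := hn S hne hS h01 b hb (ε ^ 2 / ((f 1).re + 1)) (by positivity)
  refine ⟨_, h s hs, ?_⟩
  rw [dist_eq_norm, ← mulFun_sub]
  have hbs : b - s ∈ Set.Icc (0 : A) 1 :=
    ⟨sub_nonneg.2 (hb.1 hs), (sub_le_self b (h01 hs).1).trans (hb.2 fun t ht => (h01 ht).2)⟩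
  refine lt_of_pow_lt_pow_left₀ 2 hε.le ((norm_mulFun_le hf hbs).trans_lt ?_)
  rw [lt_div_iff₀ (by positivity)] at hd
  have h2 : (f (b - s)).re ≤ ‖f (b - s)‖ := Complex.re_le_norm _
  nlinarith [norm_nonneg (f (b - s)), h2, h1]

/-- By Zorn's lemma there is a maximal `x ≤ c` at which the vector functional is at most `f`. Any
violation of domination below `c - x` could be added to `x`; and `c - x ≠ 0` since the inequality is
reversed at `c`. -/
theorem exists_dominated (hφ : IsDualRep φ) (hf : ∀ a, 0 ≤ a → 0 ≤ f a) {c : A}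
    (hc : c ∈ Set.Icc (0 : A) 1) {ξ : H} (hξ : (f c).re < (vecFun φ ξ ξ c).re) :
    ∃ e, 0 ≤ e ∧ e ≤ c ∧ e ≠ 0 ∧ ∀ a, 0 ≤ a → a ≤ e → (f a).re ≤ (vecFun φ ξ ξ a).re := by
  let E : Set A := {x | x ∈ Set.Icc 0 c ∧ (vecFun φ ξ ξ x).re ≤ (f x).re}
  have hE1 : E ⊆ Set.Icc 0 1 := fun x hx => ⟨hx.1.1, hx.1.2.trans hc.2⟩
  obtain ⟨x, -, hx⟩ := zorn_le_nonempty₀ E (fun S hS hch y hy => by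
    obtain ⟨b, hb, U, hU, ht, hev⟩ := exists_isLUB hφ ⟨y, hy⟩ hch (hS.trans hE1)
    refine ⟨b, ⟨⟨(hS hy).1.1.trans (hb.1 hy), hb.2 fun s hs => (hS hs).1.2⟩, ?_⟩, hb.1⟩
    refine le_of_tendsto ((Complex.continuous_re.tendsto _).comp (ht _ (vecFun_mem φ ξ ξ)))
      ((hev y hy).mono fun t h => ?_)
    exact (hS h.1).2.trans (re_apply_mono hf (hb.1 h.1))) 0
    ⟨⟨le_rfl, hc.1⟩, by simp⟩
  refine ⟨c - x, sub_nonneg.2 hx.1.1.2, sub_le_self c hx.1.1.1, fun h => ?_, fun a ha hae => ?_⟩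
  · rw [sub_eq_zero] at h
    have := hx.1.2
    rw [← h] at this
    exact hξ.not_ge this
  · by_contra! hlt
    have hmem : x + a ∈ E := by
      refine ⟨⟨add_nonneg hx.1.1.1 ha, ?_⟩, ?_⟩
      · exact (add_le_add_right hae x).trans_eq (by abel)
      · rw [map_add, map_add, Complex.add_re, Complex.add_re]
        exact add_le_add hx.1.2 hlt.le
    have h0 : a ≤ 0 := by simpa using hx.2 hmem (le_add_of_nonneg_right ha)
    rw [le_antisymm h0 ha] at hlt
    simp at hlt

/-- Since `(a e)* (a e)` is at most a multiple of `e`, domination and Cauchy–Schwarz bound `f (a e)`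
by a constant times `‖a e ξ‖`; the Riesz theorem makes it a vector functional. -/
theorem mulFun_mem_of_dominated (hf : ∀ a, 0 ≤ a → 0 ≤ f a) {e : A} (he : e ∈ Set.Icc (0 : A) 1)
    {ξ : H} (h : ∀ a, 0 ≤ a → a ≤ e → (f a).re ≤ (vecFun φ ξ ξ a).re) :
    mulFun f e ∈ normalDual φ := by
  have hes : star e = e := (IsSelfAdjoint.of_nonneg he.1).star_eq
  have h1 := re_apply_nonneg hf zero_le_one
  let u : A →ₗ[ℂ] H :=
    { toFun := fun a => φ a (φ e ξ)
      map_add' := fun a b => by rw [map_add]; rfl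
      map_smul' := fun c a => by rw [map_smul]; rfl }
  have key : ∀ a, (f (star (a * e) * (a * e))).re ≤ ‖u a‖ ^ 2 := by
    intro a
    -- The added `1` makes the scalar invertible when `a = 0`.
    set r : ℝ := ‖a‖ ^ 2 + 1
    have hr : 0 < r := by positivity
    have hle : star (a * e) * (a * e) ≤ r • e := by
      have e1 : star (a * e) * (a * e) = star e * (star a * a) * e := by
        rw [star_mul]; noncomm_ring
      rw [e1]
      refine (CStarAlgebra.star_left_conjugate_le_norm_smul (IsSelfAdjoint.star_mul_self a)).trans ?_
      rw [hes]
      refine (smul_le_smul_of_nonneg_left (mul_self_le he) (norm_nonneg _)).trans ?_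
      refine smul_le_smul_of_nonneg_right ?_ he.1
      rw [CStarRing.norm_star_mul_self, ← sq]
      exact le_add_of_nonneg_right zero_le_one
    have h2 := h (r⁻¹ • (star (a * e) * (a * e)))
      (smul_nonneg (inv_nonneg.2 hr.le) (star_mul_self_nonneg _))
      ((smul_le_smul_of_nonneg_left hle (inv_nonneg.2 hr.le)).trans_eq
        (inv_smul_smul₀ hr.ne' e))
    rw [← Complex.coe_smul, map_smul, map_smul, smul_eq_mul, smul_eq_mul, Complex.re_ofReal_mul,
      Complex.re_ofReal_mul] at h2
    refine (le_of_mul_le_mul_left h2 (inv_pos.2 hr)).trans_eq ?_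
    rw [vecFun_apply, map_mul, mul_apply_eq_comp, inner_map_eq_inner_star, star_star, map_mul,
      mul_apply_eq_comp]
    exact inner_self_eq_norm_sq (𝕜 := ℂ) _
  obtain ⟨ζ, hζ⟩ := exists_inner_eq u (mulFun f e : A →ₗ[ℂ] ℂ) (C := √(f 1).re) fun a => by
    refine abs_le_of_sq_le_sq' ?_ (by positivity) |>.2
    rw [mul_pow, Real.sq_sqrt h1]
    have := norm_sq_apply_mul_le hf 1 (a * e)
    rw [star_one, one_mul, one_mul] at this
    exact this.trans (mul_le_mul_of_nonneg_left (key a) h1)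
  have : mulFun f e = vecFun φ ζ (φ e ξ) := by
    ext a
    exact hζ a
  rw [this]
  exact vecFun_mem _ _ _

theorem exists_inner_pos (hφ : Function.Injective φ) {c : A} (hc : 0 ≤ c) (hc0 : c ≠ 0) (r : ℝ) :
    ∃ ξ, r < (vecFun φ ξ ξ c).re := by
  obtain ⟨ξ, hξ⟩ : ∃ ξ, 0 < (vecFun φ ξ ξ c).re := by
    by_contra! h
    refine hc0 (le_antisymm (neg_nonneg.1 ((nonneg_iff_inner hφ _).2 fun ξ => ?_)) hc)
    have h1 := Complex.le_def.1 ((nonneg_iff_inner hφ _).1 hc ξ)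
    have h2 := h ξ
    rw [vecFun_apply] at h2
    rw [map_neg, neg_apply, inner_neg_right, neg_nonneg]
    exact Complex.le_def.2 ⟨h2, h1.2.symm⟩
  set q := (vecFun φ ξ ξ c).re
  set t : ℝ := |r| / q + 1
  have ht : 1 ≤ t := le_add_of_nonneg_left (by positivity)
  refine ⟨(t : ℂ) • ξ, ?_⟩
  have e : vecFun φ ((t : ℂ) • ξ) ((t : ℂ) • ξ) c = ((t * t : ℝ) : ℂ) * vecFun φ ξ ξ c := by
    simp only [vecFun_apply, map_smul, inner_smul_left, inner_smul_right, Complex.conj_ofReal]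
    push_cast; ring
  rw [e, Complex.re_ofReal_mul]
  have h3 : t * q = |r| + q := by simp only [t]; field_simp
  calc r ≤ |r| := le_abs_self r
    _ < t * q := by rw [h3]; exact lt_add_of_pos_right _ hξ
    _ ≤ t * t * q := by gcongr; nlinarith

/-- Zorn's lemma gives a maximal `d` in `[0, 1]` with `f (· d)` normal. If `1 - d ≠ 0`, a large
multiple of a vector makes its functional exceed `f` there, and the dominated piece `e` enlarges
`d`. So `d = 1`. -/
theorem ChainNormal.mem_normalDual (hφ : IsDualRep φ) (hf : ∀ a, 0 ≤ a → 0 ≤ f a)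
    (hn : ChainNormal f) : f ∈ normalDual φ := by
  let D : Set A := {d | d ∈ Set.Icc 0 1 ∧ mulFun f d ∈ normalDual φ}
  obtain ⟨d, -, hd⟩ := zorn_le_nonempty₀ D (fun S hS hch y hy => by
    have h01 : S ⊆ Set.Icc 0 1 := fun s hs => (hS hs).1
    obtain ⟨b, hb, -⟩ := exists_isLUB hφ ⟨y, hy⟩ hch h01
    refine ⟨b, ⟨⟨(h01 hy).1.trans (hb.1 hy), hb.2 fun s hs => (h01 hs).2⟩, ?_⟩, hb.1⟩
    exact mulFun_mem_of_isLUB hf hn ⟨y, hy⟩ hch h01 hb fun s hs => (hS hs).2) 0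
    ⟨⟨le_rfl, zero_le_one⟩, by
      rw [show mulFun f (0 : A) = 0 by ext a; simp [mulFun_apply]]; exact Submodule.zero_mem _⟩
  have hc : 1 - d ∈ Set.Icc (0 : A) 1 := ⟨sub_nonneg.2 hd.1.1.2, sub_le_self 1 hd.1.1.1⟩
  have h1 : 1 - d = 0 := by
    by_contra hc0
    obtain ⟨ξ, hξ⟩ := exists_inner_pos hφ.injective hc.1 hc0 (f (1 - d)).re
    obtain ⟨e, he0, hec, hne, hdom⟩ := exists_dominated hφ hf hc hξ
    have hmem : d + e ∈ D := by
      refine ⟨⟨add_nonneg hd.1.1.1 he0, (add_le_add_right hec d).trans_eq (by abel)⟩, ?_⟩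
      rw [mulFun_add]
      exact Submodule.add_mem _ hd.1.2 (mulFun_mem_of_dominated hf ⟨he0, hec.trans hc.2⟩ hdom)
    exact hne (le_antisymm (by simpa using hd.2 hmem (le_add_of_nonneg_right he0)) he0)
  have e : mulFun f d = f := by
    rw [← sub_eq_zero.1 h1]; ext a; simp [mulFun_apply]
  rw [← e]
  exact hd.1.2

end OrderNormal

/-! ### Isomorphisms are normal -/

section Isomorphism

variable {A H : Type*} [CStarAlgebra A] [NormedAddCommGroup H] [InnerProductSpace ℂ H]
  [CompleteSpace H] {φ : A →⋆ₐ[ℂ] (H →L[ℂ] H)}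
  {B K : Type*} [CStarAlgebra B] [NormedAddCommGroup K] [InnerProductSpace ℂ K]
  [CompleteSpace K] {ψ : B →⋆ₐ[ℂ] (K →L[ℂ] K)}

theorem normalDual_le_of_diagonal {P : Submodule ℂ (StrongDual ℂ A)}
    (hP : IsClosed (P : Set (StrongDual ℂ A))) (h : ∀ x, vecFun φ x x ∈ P) :
    normalDual φ ≤ P := by
  refine normalDual_le φ hP fun x y => ?_
  have e : vecFun φ x y = (1 / 4 : ℂ) • (vecFun φ (x + y) (x + y) - vecFun φ (x - y) (x - y) -
      Complex.I • (vecFun φ (x + Complex.I • y) (x + Complex.I • y) -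
        vecFun φ (x - Complex.I • y) (x - Complex.I • y))) := by
    ext a
    simp only [vecFun_apply, smul_apply, sub_apply, map_add, map_sub, map_smul, inner_add_left,
      inner_add_right, inner_sub_left, inner_sub_right, inner_smul_left, inner_smul_right,
      smul_eq_mul, Complex.conj_I]
    linear_combination ((1 / 2 : ℂ) * (⟪x, φ a y⟫_ℂ - ⟪y, φ a x⟫_ℂ)) * Complex.I_sq
  rw [e]
  exact P.smul_mem _ (P.sub_mem (P.sub_mem (h _) (h _)) (P.smul_mem _ (P.sub_mem (h _) (h _))))

theorem ChainNormal.comp_starAlgEquiv [PartialOrder A] [StarOrderedRing A] [PartialOrder B]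
    [StarOrderedRing B] {ω : StrongDual ℂ B} (hω : ChainNormal ω) (α : A ≃⋆ₐ[ℂ] B)
    {f : StrongDual ℂ A} (hf : ∀ a, f a = ω (α a)) : ChainNormal f := by
  intro S hne hS h01 b hb ε hε
  let e : A ≃o B := OrderIsoClass.toOrderIso α
  obtain ⟨_, ⟨s, hs, rfl⟩, h⟩ := hω (e '' S) (hne.image e)
    (hS.image_of_map_rel _ _ e fun x y h => e.monotone h) (by
      rintro _ ⟨s, hs, rfl⟩
      exact ⟨(map_zero α).symm.trans_le (e.monotone (h01 hs).1),
        (e.monotone (h01 hs).2).trans_eq (map_one α)⟩) (e b) (e.isLUB_image'.2 hb) ε hε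
  refine ⟨s, hs, ?_⟩
  rw [hf, map_sub]
  exact h

/-- An isomorphism preserves order and suprema, so it pulls a diagonal vector functional back to a
positive functional respecting suprema of chains, which is normal. Polarisation gives the other
functionals. -/
theorem isNormalMap_of_starAlgEquiv (hφ : IsDualRep φ) (hψ : IsDualRep ψ) (α : A ≃⋆ₐ[ℂ] B) :
    IsNormalMap φ ψ (starLin (α : A →⋆ₙₐ[ℂ] B)) := by
  letI := CStarAlgebra.spectralOrder A
  letI := CStarAlgebra.spectralOrder B
  haveI := CStarAlgebra.spectralOrderedRing A
  haveI := CStarAlgebra.spectralOrderedRing B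
  let F : A →L[ℂ] B := (starLin (α : A →⋆ₙₐ[ℂ] B)).mkContinuous 1 fun a =>
    (NonUnitalStarAlgHom.norm_apply_le (α : A →⋆ₙₐ[ℂ] B) a).trans_eq (one_mul _).symm
  let R : StrongDual ℂ B →L[ℂ] StrongDual ℂ A := ContinuousLinearMap.precomp ℂ F
  have : normalDual ψ ≤ (normalDual φ).comap (R : _ →ₗ[ℂ] _) := by
    refine normalDual_le_of_diagonal ((isClosed_normalDual φ).preimage R.continuous) fun x => ?_
    refine ChainNormal.mem_normalDual (f := R (vecFun ψ x x)) hφ (fun a ha => ?_)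
      ((chainNormal_of_mem hψ (vecFun_mem ψ x x)).comp_starAlgEquiv α fun a => rfl)
    refine (nonneg_iff_inner hψ.injective _).1 ?_ x
    exact (map_zero α).symm.trans_le (OrderHomClass.mono α ha)
  exact fun ω hω => ⟨R ω, this hω, fun a => rfl⟩

end Isomorphism

/-! ### Norm continuity of the action on the predual -/

section PredualAction

open Filter MeasureTheory

variable {A : Type*} [CStarAlgebra A]

/-- The action of an automorphism on functionals. -/
def dualAct (α : A ≃⋆ₐ[ℂ] A) : StrongDual ℂ A →L[ℂ] StrongDual ℂ A :=
  ContinuousLinearMap.precomp ℂ ((starLin (α : A →⋆ₙₐ[ℂ] A)).mkContinuous 1 fun a =>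
    (NonUnitalStarAlgHom.norm_apply_le (α : A →⋆ₙₐ[ℂ] A) a).trans_eq (one_mul _).symm)

theorem dualAct_apply (α : A ≃⋆ₐ[ℂ] A) (ω : StrongDual ℂ A) (a : A) :
    dualAct α ω a = ω (α a) := rfl

theorem norm_starAlgEquiv_apply_le (α : A ≃⋆ₐ[ℂ] A) (a : A) : ‖α a‖ ≤ ‖a‖ :=
  NonUnitalStarAlgHom.norm_apply_le (α : A →⋆ₙₐ[ℂ] A) a

theorem norm_dualAct_le (α : A ≃⋆ₐ[ℂ] A) (ω : StrongDual ℂ A) : ‖dualAct α ω‖ ≤ ‖ω‖ :=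
  ContinuousLinearMap.opNorm_le_bound _ (norm_nonneg _) fun a => by
    rw [dualAct_apply]
    exact (ω.le_opNorm _).trans (by gcongr; exact norm_starAlgEquiv_apply_le α a)

variable {G : Type*} [Group G] [TopologicalSpace G]

/-- The functionals on which the action is norm continuous. -/
def continuousDual (γ : G →* (A ≃⋆ₐ[ℂ] A)) : Submodule ℂ (StrongDual ℂ A) where
  carrier := {ω | Continuous fun t => dualAct (γ t) ω}
  zero_mem' := by
    simp only [Set.mem_ofPred_eq, map_zero]
    exact continuous_const
  add_mem' {ω ω'} h h' := by
    simp only [Set.mem_ofPred_eq, map_add]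
    exact h.add h'
  smul_mem' c ω h := by
    simp only [Set.mem_ofPred_eq, map_smul]
    exact Continuous.const_smul h c

theorem isClosed_continuousDual (γ : G →* (A ≃⋆ₐ[ℂ] A)) :
    IsClosed (continuousDual γ : Set (StrongDual ℂ A)) := by
  refine isClosed_of_closure_subset fun ω hω => ?_
  refine continuous_of_uniform_approx_of_continuous fun u hu => ?_
  obtain ⟨ε, hε, hu⟩ := Metric.mem_uniformity_dist.1 hu
  obtain ⟨ω', hω', hd⟩ := Metric.mem_closure_iff.1 hω ε hε
  refine ⟨fun t => dualAct (γ t) ω', hω', fun t => hu ?_⟩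
  rw [dist_eq_norm, ← map_sub]
  rw [dist_eq_norm] at hd
  exact (norm_dualAct_le _ _).trans_lt hd

variable [IsTopologicalGroup G] [LocallyCompactSpace G] [T2Space G] {γ : G →* (A ≃⋆ₐ[ℂ] A)}
  {ω : StrongDual ℂ A}

section Mean

variable [MeasurableSpace G] [BorelSpace G] (μ : Measure G) [IsFiniteMeasureOnCompacts μ]
  {f : G → ℝ}

omit [IsFiniteMeasureOnCompacts μ] [T2Space G] [LocallyCompactSpace G] [MeasurableSpace G]
  [BorelSpace G] in
theorem continuous_mean (hω : ∀ a, Continuous fun t => ω (γ t a)) (hf : Continuous f) (a : A) :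
    Continuous fun t => (f t : ℂ) * ω (γ t⁻¹ a) :=
  (Complex.continuous_ofReal.comp hf).mul ((hω a).comp continuous_inv)

omit [T2Space G] [LocallyCompactSpace G] in
theorem integrable_mean (hω : ∀ a, Continuous fun t => ω (γ t a)) (hf : Continuous f)
    (hc : HasCompactSupport f) (a : A) : Integrable (fun t => (f t : ℂ) * ω (γ t⁻¹ a)) μ := by
  refine (continuous_mean hω hf a).integrable_of_hasCompactSupport ?_
  refine hc.mono fun t ht => ?_
  contrapose! ht
  simp [Function.notMem_support.1 ht]

omit [T2Space G] [LocallyCompactSpace G] in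
theorem norm_mean_le (hf : Continuous f) (hc : HasCompactSupport f) (a : A) :
    ‖∫ t, (f t : ℂ) * ω (γ t⁻¹ a) ∂μ‖ ≤ (∫ t, ‖f t‖ ∂μ) * ‖ω‖ * ‖a‖ := by
  rw [mul_assoc, ← integral_mul_const]
  refine norm_integral_le_of_norm_le
    ((hf.integrable_of_hasCompactSupport hc).norm.mul_const _) (Eventually.of_forall fun t => ?_)
  rw [norm_mul, Complex.norm_real]
  refine mul_le_mul_of_nonneg_left ((ω.le_opNorm _).trans ?_) (norm_nonneg _)
  exact mul_le_mul_of_nonneg_left (norm_starAlgEquiv_apply_le _ _) (norm_nonneg _)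

omit [T2Space G] [LocallyCompactSpace G] in
theorem exists_mean (hω : ∀ a, Continuous fun t => ω (γ t a)) (hf : Continuous f)
    (hc : HasCompactSupport f) :
    ∃ Ω : StrongDual ℂ A, ∀ a, Ω a = ∫ t, (f t : ℂ) * ω (γ t⁻¹ a) ∂μ := by
  refine ⟨LinearMap.mkContinuous
    { toFun := fun a => ∫ t, (f t : ℂ) * ω (γ t⁻¹ a) ∂μ
      map_add' := fun a b => ?_
      map_smul' := fun c a => ?_ } _ fun a => norm_mean_le μ hf hc a, fun a => rfl⟩
  · rw [← integral_add (integrable_mean μ hω hf hc a) (integrable_mean μ hω hf hc b)]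
    exact integral_congr_ae (Eventually.of_forall fun t => by simp [mul_add])
  · rw [RingHom.id_apply, smul_eq_mul, ← integral_const_mul]
    exact integral_congr_ae (Eventually.of_forall fun t => by
      simp only [map_smul, smul_eq_mul]; ring)

theorem tendsto_integral_norm_sub (hf : Continuous f) (hc : HasCompactSupport f) (s₀ : G) :
    Tendsto (fun s => ∫ t, ‖f (s * t) - f (s₀ * t)‖ ∂μ) (𝓝 s₀) (𝓝 0) := by
  obtain ⟨V, hV, hs₀⟩ := exists_compact_mem_nhds s₀
  have hk : IsCompact ((fun p : G × G => p.1⁻¹ * p.2) '' (V ×ˢ tsupport f)) :=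
    (hV.prod hc).image (by fun_prop)
  have h0 : ∀ s ∈ V, ∀ t, t ∉ (fun p : G × G => p.1⁻¹ * p.2) '' (V ×ˢ tsupport f) →
      f (s * t) = 0 := fun s hs t ht => by
    by_contra h
    exact ht ⟨(s, s * t), ⟨hs, subset_tsupport f h⟩, by simp⟩
  have := continuousOn_integral_of_compact_support (μ := μ) (s := V)
    (f := fun s t => ‖f (s * t) - f (s₀ * t)‖) hk (Continuous.continuousOn (by
      simp only [Function.uncurry_def]; fun_prop)) fun s t hs ht => by
      rw [h0 s hs t ht, h0 s₀ (mem_of_mem_nhds hs₀) t ht, sub_zero, norm_zero]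
  have := (this.continuousAt hs₀).tendsto
  simpa using this

/-- Left invariance moves the action of `s` onto the weight, as the translate `f (s t)`; translation
is continuous in the integral norm. -/
theorem mean_mem_continuousDual [μ.IsMulLeftInvariant] (hω : ∀ a, Continuous fun t => ω (γ t a))
    (hf : Continuous f) (hc : HasCompactSupport f) {Ω : StrongDual ℂ A}
    (hΩ : ∀ a, Ω a = ∫ t, (f t : ℂ) * ω (γ t⁻¹ a) ∂μ) : Ω ∈ continuousDual γ := by
  have hc' : ∀ s, HasCompactSupport fun t => f (s * t) := fun s =>
    hc.comp_homeomorph (Homeomorph.mulLeft s)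
  have hf' : ∀ s, Continuous fun t => f (s * t) := fun s => hf.comp (continuous_const_mul s)
  have key : ∀ s a, Ω (γ s a) = ∫ t, (f (s * t) : ℂ) * ω (γ t⁻¹ a) ∂μ := fun s a => by
    rw [hΩ, ← integral_mul_left_eq_self _ s]
    refine integral_congr_ae (Eventually.of_forall fun t => ?_)
    simp only [mul_inv_rev, map_mul]
    change _ * ω (γ t⁻¹ (γ s⁻¹ (γ s a))) = _
    rw [← StarAlgEquiv.mul_apply (γ s⁻¹), ← map_mul, inv_mul_cancel, map_one]
    rfl
  refine continuous_iff_continuousAt.2 fun s₀ => ?_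
  refine tendsto_iff_norm_sub_tendsto_zero.2 ?_
  refine squeeze_zero (fun _ => norm_nonneg _) (fun s => ?_)
    (by simpa using (tendsto_integral_norm_sub μ hf hc s₀).mul_const ‖ω‖)
  refine ContinuousLinearMap.opNorm_le_bound _ (by positivity) fun a => ?_
  rw [sub_apply, dualAct_apply, dualAct_apply, key, key,
    ← integral_sub (integrable_mean μ hω (hf' s) (hc' s) a)
      (integrable_mean μ hω (hf' s₀) (hc' s₀) a)]
  refine le_trans (le_of_eq ?_) (norm_mean_le (γ := γ) μ ((hf' s).sub (hf' s₀))
    ((hc' s).sub (hc' s₀)) a)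
  refine congrArg _ (integral_congr_ae (Eventually.of_forall fun t => ?_))
  simp [sub_mul]

section Order

variable [PartialOrder A] [StarOrderedRing A]

omit [IsTopologicalGroup G] [LocallyCompactSpace G] [T2Space G] [MeasurableSpace G] [BorelSpace G]
  [TopologicalSpace G] in
theorem nonneg_apply_smul (hpos : ∀ a, 0 ≤ a → 0 ≤ ω a) (t : G) {a : A} (ha : 0 ≤ a) :
    0 ≤ ω (γ t a) :=
  hpos _ ((map_zero (γ t)).symm.trans_le (OrderHomClass.mono (γ t) ha))

omit [StarOrderedRing A] in
theorem norm_apply_le_of_le {ω : StrongDual ℂ A} [StarOrderedRing A]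
    (hpos : ∀ a, 0 ≤ a → 0 ≤ ω a) {a b : A} (ha : 0 ≤ a) (hab : a ≤ b) : ‖ω a‖ ≤ ‖ω b‖ := by
  have h := hpos _ (sub_nonneg.2 hab)
  rw [map_sub, sub_nonneg] at h
  exact CStarAlgebra.norm_le_norm_of_nonneg_of_le (hpos a ha) h

-- A Dini argument: convergence along the chain is monotone and each value is continuous in `t`, so
-- it is uniform on compact sets.
omit [LocallyCompactSpace G] [T2Space G] [MeasurableSpace G] [BorelSpace G] in
theorem exists_uniform_of_chain (hω : ∀ a, Continuous fun t => ω (γ t a))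
    (hpos : ∀ a, 0 ≤ a → 0 ≤ ω a) (hn : ChainNormal ω) {S : Set A} (hne : S.Nonempty)
    (hS : IsChain (· ≤ ·) S) (h01 : S ⊆ Set.Icc 0 1) {b : A} (hb : IsLUB S b) {ε : ℝ} (hε : 0 < ε)
    {k : Set G} (hk : IsCompact k) : ∃ s ∈ S, ∀ t ∈ k, ‖ω (γ t⁻¹ (b - s))‖ < ε := by
  refine hk.induction_on (p := fun k => ∃ s ∈ S, ∀ t ∈ k, ‖ω (γ t⁻¹ (b - s))‖ < ε) ?_ ?_ ?_ ?_
  · obtain ⟨s, hs⟩ := hne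
    exact ⟨s, hs, fun t ht => ht.elim⟩
  · rintro k k' hkk' ⟨s, hs, h⟩
    exact ⟨s, hs, fun t ht => h t (hkk' ht)⟩
  · rintro k k' ⟨s, hs, h⟩ ⟨s', hs', h'⟩
    have aux : ∀ r ∈ S, ∀ r' ∈ S, r ≤ r' → ∀ t : G,
        ‖ω (γ t⁻¹ (b - r'))‖ ≤ ‖ω (γ t⁻¹ (b - r))‖ := fun r hr r' hr' hle t =>
      norm_apply_le_of_le (fun a ha => hpos a ha)
        ((map_zero (γ t⁻¹)).symm.trans_le (OrderHomClass.mono (γ t⁻¹) (sub_nonneg.2 (hb.1 hr'))))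
        (OrderHomClass.mono (γ t⁻¹) (sub_le_sub_left hle b))
    rcases hS.total hs hs' with hle | hle
    · exact ⟨s', hs', fun t ht => ht.elim
        (fun ht => (aux s hs s' hs' hle t).trans_lt (h t ht)) (h' t)⟩
    · exact ⟨s, hs, fun t ht => ht.elim (h t)
        fun ht => (aux s' hs' s hs hle t).trans_lt (h' t ht)⟩
  · intro t _
    obtain ⟨s, hs, h⟩ := (hn.comp_starAlgEquiv (γ t⁻¹) (f := dualAct (γ t⁻¹) ω) fun a => rfl)
      S hne hS h01 b hb ε hε
    refine ⟨_, mem_nhdsWithin_of_mem_nhds (IsOpen.mem_nhds (isOpen_lt (f := fun t : G =>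
      ‖ω (γ t⁻¹ (b - s))‖) (g := fun _ => ε) ((hω _).comp continuous_inv).norm
        continuous_const) h), s, hs, fun t ht => ht⟩

-- The mean is only a weak integral, so its normality is obtained through chains, by uniform
-- convergence on the support of the weight.
omit [LocallyCompactSpace G] [T2Space G] in
theorem mean_chainNormal (hω : ∀ a, Continuous fun t => ω (γ t a))
    (hpos : ∀ a, 0 ≤ a → 0 ≤ ω a) (hn : ChainNormal ω) (hf : Continuous f)
    (hc : HasCompactSupport f) {Ω : StrongDual ℂ A}
    (hΩ : ∀ a, Ω a = ∫ t, (f t : ℂ) * ω (γ t⁻¹ a) ∂μ) : ChainNormal Ω := by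
  intro S hne hS h01 b hb ε hε
  have h0 : 0 ≤ ∫ t, ‖f t‖ ∂μ := integral_nonneg fun t => norm_nonneg _
  obtain ⟨s, hs, h⟩ := exists_uniform_of_chain hω hpos hn hne hS h01 hb
    (ε := ε / ((∫ t, ‖f t‖ ∂μ) + 1)) (by positivity) hc
  refine ⟨s, hs, ?_⟩
  rw [hΩ]
  have h1 : ‖∫ t, (f t : ℂ) * ω (γ t⁻¹ (b - s)) ∂μ‖ ≤
      ∫ t, ‖f t‖ * (ε / ((∫ t, ‖f t‖ ∂μ) + 1)) ∂μ := by
    refine norm_integral_le_of_norm_le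
      ((hf.integrable_of_hasCompactSupport hc).norm.mul_const _) (Eventually.of_forall fun t => ?_)
    rw [norm_mul, Complex.norm_real]
    by_cases ht : t ∈ tsupport f
    · exact mul_le_mul_of_nonneg_left (h t ht).le (norm_nonneg _)
    · rw [image_eq_zero_of_notMem_tsupport ht, norm_zero, zero_mul, zero_mul]
  refine h1.trans_lt ?_
  rw [integral_mul_const, ← mul_div_assoc, div_lt_iff₀ (by positivity)]
  nlinarith

omit [LocallyCompactSpace G] [T2Space G] in
theorem mean_nonneg (hω : ∀ a, Continuous fun t => ω (γ t a)) (hpos : ∀ a, 0 ≤ a → 0 ≤ ω a)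
    (hf : Continuous f) (hc : HasCompactSupport f) (hf0 : ∀ t, 0 ≤ f t) {Ω : StrongDual ℂ A}
    (hΩ : ∀ a, Ω a = ∫ t, (f t : ℂ) * ω (γ t⁻¹ a) ∂μ) (a : A) (ha : 0 ≤ a) : 0 ≤ Ω a := by
  have h : ∀ t, (f t : ℂ) * ω (γ t⁻¹ a) = ((f t * (ω (γ t⁻¹ a)).re : ℝ) : ℂ) := fun t => by
    have := (Complex.le_def.1 (nonneg_apply_smul (γ := γ) hpos t⁻¹ ha)).2
    apply Complex.ext
    · simp
    · rw [Complex.im_ofReal_mul, ← this, Complex.zero_im, mul_zero, Complex.ofReal_im]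
  rw [hΩ, integral_congr_ae (Eventually.of_forall h), integral_complex_ofReal]
  exact Complex.zero_le_real.2 (integral_nonneg fun t => mul_nonneg (hf0 t)
    (Complex.le_def.1 (nonneg_apply_smul (γ := γ) hpos t⁻¹ ha)).1)

end Order

end Mean

variable {H : Type*} [NormedAddCommGroup H] [InnerProductSpace ℂ H] [CompleteSpace H]
  {φ : A →⋆ₐ[ℂ] (H →L[ℂ] H)}

theorem exists_mean_ne_zero (hφ : IsDualRep φ)
    (hγ : ∀ ω ∈ normalDual φ, ∀ a, Continuous fun t => ω (γ t a)) (x : H) {a : A}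
    (ha : vecFun φ x x a ≠ 0) :
    ∃ Ω ∈ normalDual φ, Ω ∈ continuousDual γ ∧ Ω a ≠ 0 := by
  letI := CStarAlgebra.spectralOrder A
  haveI := CStarAlgebra.spectralOrderedRing A
  letI : MeasurableSpace G := borel G
  haveI : BorelSpace G := ⟨rfl⟩
  let μ : Measure G := Measure.haar
  have hm := vecFun_mem φ x x
  set ω := vecFun φ x x
  have hω := hγ ω hm
  have hpos : ∀ a, 0 ≤ a → 0 ≤ ω a := fun a ha => (nonneg_iff_inner hφ.injective a).1 ha x
  let h : G → ℝ := fun t => ((starRingEnd ℂ) (ω a) * ω (γ t⁻¹ a)).re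
  have hh : Continuous h :=
    Complex.continuous_re.comp (((hω a).comp continuous_inv).const_mul _)
  have h1 : 0 < h 1 := by
    have : h 1 = ‖ω a‖ ^ 2 := by
      simp only [h, inv_one, map_one, StarAlgEquiv.one_apply]
      rw [← Complex.normSq_eq_conj_mul_self, Complex.ofReal_re, Complex.normSq_eq_norm_sq]
    rw [this]
    have := norm_pos_iff.2 ha
    positivity
  -- The weight equals `1` at the identity and vanishes where `h ≤ 0`, so the integral of `f * h`, a
  -- real part of a multiple of `Ω a`, is positive.
  obtain ⟨f, hf1, hf0, hfc, hf⟩ := exists_continuous_one_zero_of_isCompact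
    (isCompact_singleton (x := (1 : G))) (isClosed_le hh (continuous_const (y := (0 : ℝ))))
    (Set.disjoint_singleton_left.2 fun h' => h1.not_ge h')
  obtain ⟨Ω, hΩ⟩ := exists_mean μ hω f.continuous hfc
  refine ⟨Ω, ?_, mean_mem_continuousDual μ hω f.continuous hfc hΩ, fun h0 => ?_⟩
  · exact (mean_chainNormal μ hω hpos (chainNormal_of_mem hφ hm) f.continuous hfc hΩ).mem_normalDual
      hφ (mean_nonneg μ hω hpos f.continuous hfc (fun t => (hf t).1) hΩ)
  · have hint : 0 < ∫ t, f t * h t ∂μ := by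
      refine Continuous.integral_pos_of_hasCompactSupport_nonneg_nonzero (x := 1)
        (f.continuous.mul hh) hfc.mul_right (fun t => ?_) ?_
      · change 0 ≤ f t * h t
        by_cases ht : h t ≤ 0
        · rw [hf0 ht]; simp
        · exact mul_nonneg (hf t).1 (not_le.1 ht).le
      · rw [hf1 rfl]; simpa using h1.ne'
    have e : ∫ t, f t * h t ∂μ = ((starRingEnd ℂ) (ω a) * Ω a).re := by
      rw [hΩ, ← integral_const_mul, ← RCLike.re_eq_complex_re, ← integral_re]
      · refine integral_congr_ae (Eventually.of_forall fun t => ?_)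
        change f t * h t = ((starRingEnd ℂ) (ω a) * ((f t : ℂ) * ω (γ t⁻¹ a))).re
        rw [mul_left_comm, Complex.re_ofReal_mul]
      · exact (integrable_mean μ hω f.continuous hfc a).const_mul _
    rw [e, h0, mul_zero, Complex.zero_re] at hint
    exact lt_irrefl _ hint

theorem continuous_dualAct (hφ : IsDualRep φ)
    (hγ : ∀ ω ∈ normalDual φ, ∀ a, Continuous fun t => ω (γ t a)) {ω : StrongDual ℂ A}
    (hω : ω ∈ normalDual φ) : Continuous fun t => dualAct (γ t) ω := by
  suffices h : normalDual φ ≤ continuousDual γ from h hω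
  refine normalDual_le_of_diagonal (isClosed_continuousDual γ) fun x => ?_
  let N : Submodule ℂ (NormalDual φ) :=
    (continuousDual γ).comap (NormalDual.val (φ := φ) : NormalDual φ →ₗ[ℂ] StrongDual ℂ A)
  have hN : IsClosed (N : Set (NormalDual φ)) :=
    (isClosed_continuousDual γ).preimage NormalDual.val.continuous
  -- Otherwise Hahn–Banach gives an element `a` annihilated by all norm continuous normal
  -- functionals but not by the vector functional; a suitable mean contradicts this.
  by_contra hx
  obtain ⟨F, hF, hFx⟩ := exists_dual_eq_zero_ne_zero hN
    (x := NormalDual.mk (vecFun φ x x) (vecFun_mem φ x x)) hx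
  obtain ⟨a, ha⟩ := hφ.exists_eq F
  rw [ha, NormalDual.val_mk] at hFx
  obtain ⟨Ω, h1, h2, h3⟩ := exists_mean_ne_zero hφ hγ x hFx
  refine h3 ?_
  rw [← NormalDual.val_mk Ω h1, ← ha]
  exact hF _ h2

end PredualAction

section Abstract

open Filter

variable {A H : Type*} [CStarAlgebra A] [NormedAddCommGroup H] [InnerProductSpace ℂ H]
  [CompleteSpace H] {φ : A →⋆ₐ[ℂ] (H →L[ℂ] H)}
  {B K : Type*} [CStarAlgebra B] [NormedAddCommGroup K] [InnerProductSpace ℂ K]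
  [CompleteSpace K] {ψ : B →⋆ₐ[ℂ] (K →L[ℂ] K)}

/-! ### Multiplicativity of normal maps -/

theorem isNormalMap_of_clm (F : A →L[ℂ] A)
    (h : ∀ x y, ∃ ω ∈ normalDual φ, ∀ a, ω a = ⟪x, φ (F a) y⟫_ℂ) :
    IsNormalMap φ φ (F : A →ₗ[ℂ] A) := by
  let R : StrongDual ℂ A →L[ℂ] StrongDual ℂ A := ContinuousLinearMap.precomp ℂ F
  have : normalDual φ ≤ (normalDual φ).comap (R : _ →ₗ[ℂ] _) :=
    normalDual_le φ ((isClosed_normalDual φ).preimage R.continuous) fun x y => by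
      obtain ⟨ω, hω, h'⟩ := h x y
      have e : R (vecFun φ x y) = ω := by
        ext a
        exact (h' a).symm
      change R (vecFun φ x y) ∈ normalDual φ
      rwa [e]
  exact fun ω hω => ⟨R ω, this hω, fun a => rfl⟩

theorem isNormalMap_mulLeft (b : A) : IsNormalMap φ φ (LinearMap.mulLeft ℂ b) :=
  isNormalMap_of_clm (ContinuousLinearMap.mul ℂ A b) fun x y =>
    ⟨_, vecFun_mem φ (φ (star b) x) y, fun a => by
      rw [vecFun_apply, ContinuousLinearMap.mul_apply', map_mul, mul_apply_eq_comp,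
        inner_map_eq_inner_star b]⟩

theorem isNormalMap_mulRight (b : A) : IsNormalMap φ φ (LinearMap.mulRight ℂ b) :=
  isNormalMap_of_clm ((ContinuousLinearMap.mul ℂ A).flip b) fun x y =>
    ⟨_, vecFun_mem φ x (φ b y), fun a => by
      rw [vecFun_apply, ContinuousLinearMap.flip_apply, ContinuousLinearMap.mul_apply', map_mul,
        mul_apply_eq_comp]⟩

/-- Both sides are normal in each variable separately, so the identity extends from the set `s` one
variable at a time. -/
theorem map_mul_of_total {τ : A →ₗ[ℂ] B} (hτ : IsNormalMap φ ψ τ) {s : Set A}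
    (hs : ∀ f g : A →ₗ[ℂ] B, IsNormalMap φ ψ f → IsNormalMap φ ψ g → (∀ e ∈ s, f e = g e) → f = g)
    (hmul : ∀ e ∈ s, ∀ e' ∈ s, τ (e * e') = τ e * τ e') (a b : A) : τ (a * b) = τ a * τ b := by
  have h1 : ∀ e ∈ s, ∀ b, τ (e * b) = τ e * τ b := fun e he b =>
    LinearMap.congr_fun (hs (τ ∘ₗ LinearMap.mulLeft ℂ e) (LinearMap.mulLeft ℂ (τ e) ∘ₗ τ)
      (hτ.comp (isNormalMap_mulLeft e)) ((isNormalMap_mulLeft (τ e)).comp hτ)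
      fun e' he' => hmul e he e' he') b
  exact LinearMap.congr_fun (hs (τ ∘ₗ LinearMap.mulRight ℂ b) (LinearMap.mulRight ℂ (τ b) ∘ₗ τ)
      (hτ.comp (isNormalMap_mulRight b)) ((isNormalMap_mulRight (τ b)).comp hτ)
      fun e he => h1 e he b) a

/-! ### Continuity of bounded maps into an algebra of operators -/

theorem continuous_apply_of_total {X : Type*} [TopologicalSpace X] {s : Set H}
    (hs : (Submodule.span ℂ s).topologicalClosure = ⊤) {g : X → A} {C : ℝ} (hg : ∀ t, ‖g t‖ ≤ C)
    (h : ∀ x ∈ s, ∀ y ∈ s, Continuous fun t => vecFun φ x y (g t)) {ω : StrongDual ℂ A}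
    (hω : ω ∈ normalDual φ) : Continuous fun t => ω (g t) := by
  let P : Submodule ℂ (StrongDual ℂ A) :=
    { carrier := {ω | Continuous fun t => ω (g t)}
      zero_mem' := continuous_const
      add_mem' := fun h h' => Continuous.add h h'
      smul_mem' := fun c ω h => Continuous.const_smul h c }
  have hP : IsClosed (P : Set (StrongDual ℂ A)) := by
    refine isClosed_of_closure_subset fun ω hω => ?_
    refine continuous_of_uniform_approx_of_continuous fun u hu => ?_
    obtain ⟨ε, hε, hu⟩ := Metric.mem_uniformity_dist.1 hu
    have hC : 0 < |C| + 1 := by positivity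
    obtain ⟨ω', hω', hd⟩ := Metric.mem_closure_iff.1 hω (ε / (|C| + 1)) (by positivity)
    refine ⟨fun t => ω' (g t), hω', fun t => hu ?_⟩
    rw [dist_eq_norm] at hd ⊢
    rw [← sub_apply]
    rw [lt_div_iff₀ hC] at hd
    refine (ContinuousLinearMap.le_opNorm _ _).trans_lt (lt_of_le_of_lt ?_ hd)
    refine mul_le_mul_of_nonneg_left ?_ (norm_nonneg _)
    exact (hg t).trans ((le_abs_self C).trans (le_add_of_nonneg_right zero_le_one))
  exact normalDual_le_of_total hs hP h hω

/-- Norm continuity of `W` together with boundedness of `m` upgrades separate continuity to joint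
continuity. -/
theorem continuous_apply_prod {X Y : Type*} [TopologicalSpace X] [TopologicalSpace Y]
    {W : X → StrongDual ℂ A} (hW : Continuous W) {m : Y → A} {C : ℝ} (hm : ∀ t, ‖m t‖ ≤ C)
    (h : ∀ s, Continuous fun t => W s (m t)) : Continuous fun p : X × Y => W p.1 (m p.2) := by
  refine continuous_iff_continuousAt.2 fun p => ?_
  have h1 : Tendsto (fun q : X × Y => (W q.1 - W p.1) (m q.2)) (𝓝 p) (𝓝 0) := by
    refine squeeze_zero_norm (a := fun q : X × Y => ‖W q.1 - W p.1‖ * C) (fun q => ?_) ?_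
    · exact (ContinuousLinearMap.le_opNorm _ _).trans
        (mul_le_mul_of_nonneg_left (hm _) (norm_nonneg _))
    · have : Continuous fun q : X × Y => ‖W q.1 - W p.1‖ * C := by fun_prop
      simpa using this.tendsto p
  have h2 : Tendsto (fun q : X × Y => W p.1 (m q.2)) (𝓝 p) (𝓝 (W p.1 (m p.2))) :=
    ((h p.1).comp continuous_snd).tendsto p
  have h3 := h1.add h2
  rw [zero_add] at h3
  refine h3.congr fun q => ?_
  rw [sub_apply, sub_add_cancel]

/-! ### Conditional expectations -/

theorem IsCCP.norm_sq_map_le {f : A →ₗ[ℂ] B} (hf : IsCCP f) (hφ : Function.Injective φ)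
    (hψ : Function.Injective ψ) (a : A) (ξ : K) :
    ‖ψ (f a) ξ‖ ^ 2 ≤ (⟪ξ, ψ (f (star a * a)) ξ⟫_ℂ).re := by
  let r : Fin 2 → A := ![1, a]
  have h0 : OpPos φ fun k l => star (r k) * r l := fun η => by
    have : quadForm φ (fun k l => star (r k) * r l) η =
        ⟪∑ k, φ (r k) (η k), ∑ k, φ (r k) (η k)⟫_ℂ := by
      simp only [quadForm, sum_inner, inner_sum, map_mul, mul_apply_eq_comp]
      refine Finset.sum_comm.trans (Finset.sum_congr rfl fun k _ => Finset.sum_congr rfl fun l _ => ?_)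
      rw [inner_map_eq_inner_star, star_star]
    rw [this, inner_self_eq_norm_sq_to_K]
    exact ofReal_sq_nonneg _
  -- The positive matrix `[1, a; a*, a* a]` is tested on the vector `(-f(a) ξ, ξ)`; the term with `f
  -- 1` is controlled by `‖f 1‖ ≤ 1`.
  have h1 := hf.opPos hφ hψ h0 ![-ψ (f a) ξ, ξ]
  simp only [quadForm, Fin.sum_univ_two, r, Matrix.cons_val_zero, Matrix.cons_val_one, star_one,
    one_mul, mul_one, hf.map_star] at h1
  rw [inner_map_eq_inner_star (star (f a)), star_star] at h1
  have h2 := (Complex.le_def.1 h1).1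
  simp only [map_neg, inner_neg_left, inner_neg_right, neg_neg, Complex.add_re, Complex.neg_re,
    Complex.zero_re] at h2
  rw [show star (f 1) = f 1 by rw [← hf.map_star, star_one]] at h2
  have h3 : (⟪ψ (f a) ξ, ψ (f a) ξ⟫_ℂ).re = ‖ψ (f a) ξ‖ ^ 2 := inner_self_eq_norm_sq (𝕜 := ℂ) _
  have h4 : (⟪ψ (f a) ξ, ψ (f 1) (ψ (f a) ξ)⟫_ℂ).re ≤ ‖ψ (f a) ξ‖ ^ 2 := by
    refine (Complex.re_le_norm _).trans ((norm_inner_le_norm _ _).trans ?_)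
    rw [sq]
    refine mul_le_mul_of_nonneg_left ?_ (norm_nonneg _)
    exact (ContinuousLinearMap.le_opNorm _ _).trans
      (mul_le_of_le_one_left (norm_nonneg _) (norm_map_one_le hf))
  linarith

theorem eq_zero_of_forall_re {q : ℝ} {d : ℂ}
    (h : ∀ t : ℂ, 0 ≤ q + 2 * ((starRingEnd ℂ) t * d).re) : d = 0 := by
  by_contra hd
  have hd' : 0 < ‖d‖ ^ 2 := by have := norm_pos_iff.2 hd; positivity
  obtain ⟨n, hn⟩ := exists_nat_gt (q / ‖d‖ ^ 2)
  rw [div_lt_iff₀ hd'] at hn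
  have h1 := h (-((n : ℝ) : ℂ) * d)
  have e : (starRingEnd ℂ) (-((n : ℝ) : ℂ) * d) * d = ((-(n * ‖d‖ ^ 2) : ℝ) : ℂ) := by
    rw [map_mul, map_neg, Complex.conj_ofReal, mul_assoc, ← Complex.normSq_eq_conj_mul_self,
      Complex.normSq_eq_norm_sq]
    push_cast
    ring
  rw [e, Complex.ofReal_re] at h1
  nlinarith [mul_nonneg (Nat.cast_nonneg (α := ℝ) n) hd'.le]

/-- Choi's multiplicative domain argument: in the Schwarz inequality for `a + t z` the terms
quadratic in `t` cancel, and what is linear in `t` must vanish as `t` is arbitrary. -/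
theorem map_star_mul_of_multiplicative {f : A →ₗ[ℂ] B} (hf : IsCCP f) (hφ : Function.Injective φ)
    (hψ : Function.Injective ψ) {z : A} (hz : f (star z * z) = star (f z) * f z) (a : A) :
    f (star z * a) = star (f z) * f a := by
  have key : ∀ ξ, ⟪ξ, ψ (f (star z * a)) ξ⟫_ℂ - ⟪ψ (f z) ξ, ψ (f a) ξ⟫_ℂ = 0 := fun ξ => by
    refine eq_zero_of_forall_re
      (q := (⟪ξ, ψ (f (star a * a)) ξ⟫_ℂ).re - ‖ψ (f a) ξ‖ ^ 2) fun t => ?_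
    have h := hf.norm_sq_map_le hφ hψ (a + t • z) ξ
    have e1 : star (a + t • z) * (a + t • z) = star a * a + (starRingEnd ℂ) t • (star z * a) +
        t • star (star z * a) + ((starRingEnd ℂ) t * t) • (star z * z) := by
      simp only [star_add, star_smul, add_mul, mul_add, smul_mul_assoc, mul_smul_comm, star_mul,
        star_star, ← Complex.star_def]
      module
    have e2 : (‖ψ (f (a + t • z)) ξ‖ ^ 2 : ℝ) = (⟪ψ (f a) ξ, ψ (f a) ξ⟫_ℂ +
        (starRingEnd ℂ) t * ⟪ψ (f z) ξ, ψ (f a) ξ⟫_ℂ + t * ⟪ψ (f a) ξ, ψ (f z) ξ⟫_ℂ +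
        (starRingEnd ℂ) t * t * ⟪ψ (f z) ξ, ψ (f z) ξ⟫_ℂ).re := by
      rw [← inner_self_eq_norm_sq (𝕜 := ℂ), RCLike.re_eq_complex_re]
      congr 1
      simp only [map_add, map_smul, add_apply, smul_apply, inner_add_left, inner_add_right,
        inner_smul_left, inner_smul_right]
      ring
    have e3 : ⟪ξ, ψ (f (star (star z * a))) ξ⟫_ℂ =
        (starRingEnd ℂ) ⟪ξ, ψ (f (star z * a)) ξ⟫_ℂ := by
      rw [hf.map_star, inner_map_eq_inner_star, star_star, inner_conj_symm]
    have e4 : ⟪ξ, ψ (f (star z * z)) ξ⟫_ℂ = ⟪ψ (f z) ξ, ψ (f z) ξ⟫_ℂ := by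
      rw [hz, map_mul, mul_apply_eq_comp, inner_map_eq_inner_star, star_star]
    have e5 : ⟪ψ (f a) ξ, ψ (f z) ξ⟫_ℂ = (starRingEnd ℂ) ⟪ψ (f z) ξ, ψ (f a) ξ⟫_ℂ :=
      (inner_conj_symm _ _).symm
    have e6 : (⟪ψ (f a) ξ, ψ (f a) ξ⟫_ℂ).re = ‖ψ (f a) ξ‖ ^ 2 := inner_self_eq_norm_sq (𝕜 := ℂ) _
    rw [e2, e1] at h
    simp only [map_add, map_smul, add_apply, smul_apply, inner_add_right, inner_smul_right, e3, e4,
      e5, Complex.add_re] at h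
    have e7 : ∀ w : ℂ, (t * (starRingEnd ℂ) w).re = ((starRingEnd ℂ) t * w).re := fun w => by
      simp [Complex.mul_re]
    rw [e7, e7, e6] at h
    rw [mul_sub, Complex.sub_re]
    linarith
  refine sub_eq_zero.1 (hψ ?_)
  rw [map_zero]
  ext ξ
  have := (inner_map_self_eq_zero (ψ (f (star z * a) - star (f z) * f a) : K →ₗ[ℂ] K)).1 fun ξ => by
    rw [← inner_conj_symm]
    refine (congrArg _ ?_).trans (map_zero _)
    refine Eq.trans ?_ (key ξ)
    change ⟪ξ, ψ (f (star z * a) - star (f z) * f a) ξ⟫_ℂ = _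
    rw [map_sub, sub_apply, inner_sub_right, map_mul ψ (star (f z)) (f a), mul_apply_eq_comp,
      inner_map_eq_inner_star (star (f z)), star_star]
  exact DFunLike.congr_fun this ξ

/-- The image of `j` lies in the multiplicative domain of `f`. The right module property follows by
taking adjoints. -/
theorem isConditionalExpectation_of_leftInverse {f : A →ₗ[ℂ] B} (hf : IsCCP f)
    (hφ : Function.Injective φ) (hψ : Function.Injective ψ) (j : B →⋆ₙₐ[ℂ] A)
    (h : ∀ b, f (j b) = b) : IsConditionalExpectation j f := by
  have h1 : ∀ b a, f (j b * a) = b * f a := fun b a => by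
    have := map_star_mul_of_multiplicative hf hφ hψ (z := j (star b)) (by
      rw [← map_star, ← map_mul, h, h, star_star]) a
    rwa [← map_star, star_star, h, star_star] at this
  have h2 : ∀ a b, f (a * j b) = f a * b := fun a b => by
    have := congrArg star (h1 (star b) (star a))
    rwa [← hf.map_star, star_mul, star_mul, ← hf.map_star, star_star, star_star, map_star,
      star_star] at this
  exact ⟨hf, h, fun b a b' => by rw [h2, h1]⟩

end Abstract

/-! ### Composition of slice maps -/

section Slices

variable {A H : Type*} [CStarAlgebra A] [NormedAddCommGroup H] [InnerProductSpace ℂ H]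
  [CompleteSpace H] {φ : A →⋆ₐ[ℂ] (H →L[ℂ] H)}
  {B K : Type*} [CStarAlgebra B] [NormedAddCommGroup K] [InnerProductSpace ℂ K]
  [CompleteSpace K] {ψ : B →⋆ₐ[ℂ] (K →L[ℂ] K)}
  {A₂ H₂ : Type*} [CStarAlgebra A₂] [NormedAddCommGroup H₂] [InnerProductSpace ℂ H₂]
  [CompleteSpace H₂] {φ₂ : A₂ →⋆ₐ[ℂ] (H₂ →L[ℂ] H₂)}
  {B₂ K₂ : Type*} [CStarAlgebra B₂] [NormedAddCommGroup K₂] [InnerProductSpace ℂ K₂]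
  [CompleteSpace K₂] {ψ₂ : B₂ →⋆ₐ[ℂ] (K₂ →L[ℂ] K₂)}
  {A₃ H₃ : Type*} [CStarAlgebra A₃] [NormedAddCommGroup H₃] [InnerProductSpace ℂ H₃]
  [CompleteSpace H₃] {φ₃ : A₃ →⋆ₐ[ℂ] (H₃ →L[ℂ] H₃)}
  {B₃ K₃ : Type*} [CStarAlgebra B₃] [NormedAddCommGroup K₃] [InnerProductSpace ℂ K₃]
  [CompleteSpace K₃] {ψ₃ : B₃ →⋆ₐ[ℂ] (K₃ →L[ℂ] K₃)}
  {A₄ H₄ : Type*} [CStarAlgebra A₄] [NormedAddCommGroup H₄] [InnerProductSpace ℂ H₄]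
  [CompleteSpace H₄] {φ₄ : A₄ →⋆ₐ[ℂ] (H₄ →L[ℂ] H₄)}
  {B₄ K₄ : Type*} [CStarAlgebra B₄] [NormedAddCommGroup K₄] [InnerProductSpace ℂ K₄]
  [CompleteSpace K₄] {ψ₄ : B₄ →⋆ₐ[ℂ] (K₄ →L[ℂ] K₄)}

theorem idSlice_comm (hψ : IsDualRep ψ) (hψ₂ : IsDualRep ψ₂) (hψ₃ : IsDualRep ψ₃)
    (hψ₄ : IsDualRep ψ₄) {f : B →ₗ[ℂ] B₂} (hf : IsCCP f) {g : B₂ →ₗ[ℂ] B₄} (hg : IsCCP g)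
    {f' : B →ₗ[ℂ] B₃} (hf' : IsCCP f') {g' : B₃ →ₗ[ℂ] B₄} (hg' : IsCCP g')
    (h : ∀ b, g (f b) = g' (f' b)) (T : VN φ ψ) :
    idSlice hψ₂ hψ₄ hg (idSlice hψ hψ₂ hf T) = idSlice hψ₃ hψ₄ hg' (idSlice hψ hψ₃ hf' T) :=
  ext_rcoeff hψ₄ fun x x' => by
    rw [rcoeff_idSlice, rcoeff_idSlice, rcoeff_idSlice, rcoeff_idSlice, h]

theorem sliceId_comm (hφ : IsDualRep φ) (hφ₂ : IsDualRep φ₂) (hφ₃ : IsDualRep φ₃)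
    (hφ₄ : IsDualRep φ₄) {f : A →ₗ[ℂ] A₂} (hf : IsCCP f) {g : A₂ →ₗ[ℂ] A₄} (hg : IsCCP g)
    {f' : A →ₗ[ℂ] A₃} (hf' : IsCCP f') {g' : A₃ →ₗ[ℂ] A₄} (hg' : IsCCP g')
    (h : ∀ a, g (f a) = g' (f' a)) (T : VN φ ψ) :
    sliceId hφ₂ hφ₄ hg (sliceId hφ hφ₂ hf T) = sliceId hφ₃ hφ₄ hg' (sliceId hφ hφ₃ hf' T) :=
  ext_lcoeff hφ₄ fun y y' => by
    rw [lcoeff_sliceId, lcoeff_sliceId, lcoeff_sliceId, lcoeff_sliceId, h]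

theorem idSlice_idSlice_of_leftInverse (hψ : IsDualRep ψ) (hψ₂ : IsDualRep ψ₂) {f : B →ₗ[ℂ] B₂}
    (hf : IsCCP f) {g : B₂ →ₗ[ℂ] B} (hg : IsCCP g) (h : ∀ b, g (f b) = b) (T : VN φ ψ) :
    idSlice hψ₂ hψ hg (idSlice hψ hψ₂ hf T) = T :=
  ext_rcoeff hψ fun x x' => by rw [rcoeff_idSlice, rcoeff_idSlice, h]

theorem sliceId_sliceId_of_leftInverse (hφ : IsDualRep φ) (hφ₂ : IsDualRep φ₂) {f : A →ₗ[ℂ] A₂}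
    (hf : IsCCP f) {g : A₂ →ₗ[ℂ] A} (hg : IsCCP g) (h : ∀ a, g (f a) = a) (T : VN φ ψ) :
    sliceId hφ₂ hφ hg (sliceId hφ hφ₂ hf T) = T :=
  ext_lcoeff hφ fun y y' => by rw [lcoeff_sliceId, lcoeff_sliceId, h]

theorem sliceId_idSlice (hφ : IsDualRep φ) (hφ₂ : IsDualRep φ₂) {θ : A →ₗ[ℂ] A₂} (hθ : IsCCP θ)
    (hψ : IsDualRep ψ) (hψ₂ : IsDualRep ψ₂) {π : B →ₗ[ℂ] B₂} (hπ : IsCCP π)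
    (h : IsNormalMap ψ ψ₂ π) (T : VN φ ψ) :
    sliceId hφ hφ₂ hθ (idSlice hψ hψ₂ hπ T) = idSlice hψ hψ₂ hπ (sliceId hφ hφ₂ hθ T) := by
  have e := idSlice_sliceId hψ hψ₂ hπ h hφ hφ₂ hθ (swapVN φ ψ T)
  rw [sliceId_apply, sliceId_apply, swapVN_swapVN] at e
  rw [sliceId_apply, e, swapVN_swapVN, sliceId_apply]

/-! ### Tensor products of completely positive maps -/

/-- The tensor product of two contractive completely positive maps. -/
def tensorCCP (hφ : IsDualRep φ) (hφ₂ : IsDualRep φ₂) (hψ : IsDualRep ψ) (hψ₂ : IsDualRep ψ₂)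
    {θ : A →ₗ[ℂ] A₂} (hθ : IsCCP θ) {π : B →ₗ[ℂ] B₂} (hπ : IsCCP π) : VN φ ψ →ₗ[ℂ] VN φ₂ ψ₂ :=
  sliceId hφ hφ₂ hθ ∘ₗ idSlice hψ hψ₂ hπ

variable (hφ : IsDualRep φ) (hφ₂ : IsDualRep φ₂) (hψ : IsDualRep ψ) (hψ₂ : IsDualRep ψ₂)
    {θ : A →ₗ[ℂ] A₂} (hθ : IsCCP θ) {π : B →ₗ[ℂ] B₂} (hπ : IsCCP π)

theorem tensorCCP_apply (T : VN φ ψ) :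
    tensorCCP hφ hφ₂ hψ hψ₂ hθ hπ T = sliceId hφ hφ₂ hθ (idSlice hψ hψ₂ hπ T) := rfl

theorem isCCP_tensorCCP : IsCCP (tensorCCP hφ hφ₂ hψ hψ₂ hθ hπ) :=
  (isCCP_sliceId hφ hφ₂ hθ).comp (isCCP_idSlice hψ hψ₂ hπ)

theorem tensorCCP_tmul (a : A) (b : B) :
    tensorCCP hφ hφ₂ hψ hψ₂ hθ hπ (tmul φ ψ a b) = tmul φ₂ ψ₂ (θ a) (π b) := by
  rw [tensorCCP_apply, idSlice_tmul, sliceId_tmul]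

theorem isNormalMap_tensorCCP (h : IsNormalMap φ φ₂ θ) (h' : IsNormalMap ψ ψ₂ π) :
    IsNormalMap (inclVN φ ψ) (inclVN φ₂ ψ₂) (tensorCCP hφ hφ₂ hψ hψ₂ hθ hπ) :=
  IsNormalMap.comp (φ := inclVN φ ψ) (ψ := inclVN φ ψ₂) (χ := inclVN φ₂ ψ₂)
    (g := sliceId hφ hφ₂ hθ) (f := idSlice hψ hψ₂ hπ)
    (isNormalMap_sliceId hφ hφ₂ hθ h) (isNormalMap_idSlice hψ hψ₂ hπ h')

theorem tmul_mul_tmul (a a' : A) (b b' : B) :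
    tmul φ ψ a b * tmul φ ψ a' b' = tmul φ ψ (a * a') (b * b') :=
  Subtype.ext (by
    change opTensor _ _ * opTensor _ _ = opTensor _ _
    rw [← opTensor_mul, map_mul, map_mul])

theorem tensorCCP_mul (h : IsNormalMap φ φ₂ θ) (h' : IsNormalMap ψ ψ₂ π)
    (hm : ∀ a a', θ (a * a') = θ a * θ a') (hm' : ∀ b b', π (b * b') = π b * π b')
    (S T : VN φ ψ) : tensorCCP hφ hφ₂ hψ hψ₂ hθ hπ (S * T) =
      tensorCCP hφ hφ₂ hψ hψ₂ hθ hπ S * tensorCCP hφ hφ₂ hψ hψ₂ hθ hπ T := by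
  refine map_mul_of_total (φ := inclVN φ ψ) (ψ := inclVN φ₂ ψ₂)
    (isNormalMap_tensorCCP hφ hφ₂ hψ hψ₂ hθ hπ h h')
    (s := Set.range fun p : A × B => tmul φ ψ p.1 p.2)
    (fun f g hf hg he => hf.ext isDualRep_inclVN hg fun a b => he _ ⟨(a, b), rfl⟩) ?_ S T
  rintro _ ⟨p, rfl⟩ _ ⟨q, rfl⟩
  rw [tmul_mul_tmul, tensorCCP_tmul, tensorCCP_tmul, tensorCCP_tmul, tmul_mul_tmul, hm, hm']

theorem isCCP_starLin (j : A →⋆ₙₐ[ℂ] A₂) : IsCCP (starLin j) := isCCP_of_starAlgHom j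

/-- The tensor product of two normal `*`-homomorphisms. -/
def tensorHom (j : A →⋆ₙₐ[ℂ] A₂) (k : B →⋆ₙₐ[ℂ] B₂) (hj : IsNormalMap φ φ₂ (starLin j))
    (hk : IsNormalMap ψ ψ₂ (starLin k)) : VN φ ψ →⋆ₙₐ[ℂ] VN φ₂ ψ₂ where
  toFun := tensorCCP hφ hφ₂ hψ hψ₂ (isCCP_starLin j) (isCCP_starLin k)
  map_smul' := map_smul _
  map_zero' := map_zero _
  map_add' := map_add _
  map_mul' := tensorCCP_mul hφ hφ₂ hψ hψ₂ _ _ hj hk (map_mul j) (map_mul k)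
  map_star' := (isCCP_tensorCCP hφ hφ₂ hψ hψ₂ (isCCP_starLin j)
    (isCCP_starLin k)).map_star

theorem tensorHom_apply (j : A →⋆ₙₐ[ℂ] A₂) (k : B →⋆ₙₐ[ℂ] B₂) (hj : IsNormalMap φ φ₂ (starLin j))
    (hk : IsNormalMap ψ ψ₂ (starLin k)) (T : VN φ ψ) :
    tensorHom hφ hφ₂ hψ hψ₂ j k hj hk T = sliceId hφ hφ₂ (isCCP_starLin j)
      (idSlice hψ hψ₂ (isCCP_starLin k) T) := rfl

/-- The maps `θ` and `π` need not be normal, but `j` is: the two inner slices may be exchanged,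
after which each factor cancels separately. -/
theorem tensorCCP_tensorHom {j : A₂ →⋆ₙₐ[ℂ] A} {k : B₂ →⋆ₙₐ[ℂ] B}
    (hj : IsNormalMap φ₂ φ (starLin j)) (hk : IsNormalMap ψ₂ ψ (starLin k))
    (h1 : ∀ a, θ (j a) = a) (h2 : ∀ b, π (k b) = b) (T : VN φ₂ ψ₂) :
    tensorCCP hφ hφ₂ hψ hψ₂ hθ hπ (tensorHom hφ₂ hφ hψ₂ hψ j k hj hk T) = T := by
  rw [tensorCCP_apply, tensorHom_apply, idSlice_sliceId hφ₂ hφ _ hj,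
    idSlice_idSlice_of_leftInverse hψ₂ hψ (isCCP_starLin k) hπ h2,
    sliceId_sliceId_of_leftInverse hφ₂ hφ (isCCP_starLin j) hθ h1]

theorem isCCP_starAlgEquiv (α : A ≃⋆ₐ[ℂ] A) : IsCCP (starLin (α : A →⋆ₙₐ[ℂ] A)) :=
  isCCP_starLin (α : A →⋆ₙₐ[ℂ] A)

/-- The tensor product of two automorphisms. -/
def tensorEquiv (α : A ≃⋆ₐ[ℂ] A) (β : B ≃⋆ₐ[ℂ] B) : VN φ ψ ≃⋆ₐ[ℂ] VN φ ψ where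
  toFun := tensorHom hφ hφ hψ hψ (α : A →⋆ₙₐ[ℂ] A) (β : B →⋆ₙₐ[ℂ] B)
    (isNormalMap_of_starAlgEquiv hφ hφ α) (isNormalMap_of_starAlgEquiv hψ hψ β)
  invFun := tensorHom hφ hφ hψ hψ (α.symm : A →⋆ₙₐ[ℂ] A) (β.symm : B →⋆ₙₐ[ℂ] B)
    (isNormalMap_of_starAlgEquiv hφ hφ α.symm) (isNormalMap_of_starAlgEquiv hψ hψ β.symm)
  left_inv := tensorCCP_tensorHom hφ hφ hψ hψ (isCCP_starAlgEquiv α.symm)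
    (isCCP_starAlgEquiv β.symm) (isNormalMap_of_starAlgEquiv hφ hφ α)
    (isNormalMap_of_starAlgEquiv hψ hψ β) α.symm_apply_apply β.symm_apply_apply
  right_inv := tensorCCP_tensorHom hφ hφ hψ hψ (isCCP_starAlgEquiv α)
    (isCCP_starAlgEquiv β) (isNormalMap_of_starAlgEquiv hφ hφ α.symm)
    (isNormalMap_of_starAlgEquiv hψ hψ β.symm) α.apply_symm_apply β.apply_symm_apply
  map_mul' := map_mul _
  map_add' := map_add _
  map_star' := map_star _
  map_smul' := map_smul _

theorem tensorEquiv_apply (α : A ≃⋆ₐ[ℂ] A) (β : B ≃⋆ₐ[ℂ] B) (T : VN φ ψ) :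
    tensorEquiv hφ hψ α β T = sliceId hφ hφ (isCCP_starAlgEquiv α)
      (idSlice hψ hψ (isCCP_starAlgEquiv β) T) := rfl

theorem tensorEquiv_mul (α α' : A ≃⋆ₐ[ℂ] A) (β β' : B ≃⋆ₐ[ℂ] B) :
    tensorEquiv hφ hψ (α * α') (β * β') = tensorEquiv hφ hψ α β * tensorEquiv hφ hψ α' β' := by
  refine DFunLike.ext _ _ fun T => ?_
  rw [StarAlgEquiv.mul_apply, tensorEquiv_apply, tensorEquiv_apply, tensorEquiv_apply,
    idSlice_sliceId hφ hφ _ (isNormalMap_of_starAlgEquiv hφ hφ α')]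
  have e1 : ∀ T : VN φ ψ, idSlice hψ hψ (isCCP_starAlgEquiv (β * β')) T =
      idSlice hψ hψ (isCCP_starAlgEquiv β) (idSlice hψ hψ (isCCP_starAlgEquiv β') T) := fun T =>
    ext_rcoeff hψ fun x x' => by rw [rcoeff_idSlice, rcoeff_idSlice, rcoeff_idSlice]; rfl
  have e2 : ∀ T : VN φ ψ, sliceId hφ hφ (isCCP_starAlgEquiv (α * α')) T =
      sliceId hφ hφ (isCCP_starAlgEquiv α) (sliceId hφ hφ (isCCP_starAlgEquiv α') T) := fun T =>
    ext_lcoeff hφ fun x x' => by rw [lcoeff_sliceId, lcoeff_sliceId, lcoeff_sliceId]; rfl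
  rw [e1, e2]

end Slices

/-! ### Tensor products of actions -/

section Actions

variable {A H : Type*} [CStarAlgebra A] [NormedAddCommGroup H] [InnerProductSpace ℂ H]
  [CompleteSpace H] {φ : A →⋆ₐ[ℂ] (H →L[ℂ] H)}
  {B K : Type*} [CStarAlgebra B] [NormedAddCommGroup K] [InnerProductSpace ℂ K]
  [CompleteSpace K] {ψ : B →⋆ₐ[ℂ] (K →L[ℂ] K)}
  {G₁ G₂ : Type*} [Group G₁] [Group G₂]

theorem dualAct_mem (hφ : IsDualRep φ) (α : A ≃⋆ₐ[ℂ] A) {ω : StrongDual ℂ A}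
    (hω : ω ∈ normalDual φ) : dualAct α ω ∈ normalDual φ := by
  obtain ⟨ω', h, h'⟩ := isNormalMap_of_starAlgEquiv hφ hφ α ω hω
  have e : dualAct α ω = ω' := ContinuousLinearMap.ext fun a => (h' a).symm
  rwa [e]

/-- The tensor product of two actions. -/
def tensorAction (hφ : IsDualRep φ) (hψ : IsDualRep ψ) (γ₁ : G₁ →* (A ≃⋆ₐ[ℂ] A))
    (γ₂ : G₂ →* (B ≃⋆ₐ[ℂ] B)) : G₁ × G₂ →* (VN φ ψ ≃⋆ₐ[ℂ] VN φ ψ) :=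
  MonoidHom.mk' (fun t => tensorEquiv hφ hψ (γ₁ t.1) (γ₂ t.2)) fun s t => by
    rw [Prod.fst_mul, Prod.snd_mul, map_mul, map_mul, tensorEquiv_mul]

variable (hφ : IsDualRep φ) (hψ : IsDualRep ψ) (γ₁ : G₁ →* (A ≃⋆ₐ[ℂ] A))
  (γ₂ : G₂ →* (B ≃⋆ₐ[ℂ] B))

theorem tensorAction_apply (t : G₁ × G₂) (T : VN φ ψ) :
    tensorAction hφ hψ γ₁ γ₂ t T = sliceId hφ hφ (isCCP_starAlgEquiv (γ₁ t.1))
      (idSlice hψ hψ (isCCP_starAlgEquiv (γ₂ t.2)) T) := rfl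

theorem inner_tensorAction (t : G₁ × G₂) (T : VN φ ψ) (x x' : H) (y y' : K) :
    ⟪leftTensor x y, inclVN φ ψ (tensorAction hφ hψ γ₁ γ₂ t T) (leftTensor x' y')⟫_ℂ =
      dualAct (γ₁ t.1) (vecFun φ x x')
        (lcoeff hφ (idSlice hψ hψ (isCCP_starAlgEquiv (γ₂ t.2)) T) y y') := by
  have h := inner_lcoeff hφ (tensorAction hφ hψ γ₁ γ₂ t T) y y' x x'
  rw [tensorAction_apply, lcoeff_sliceId] at h
  exact h.symm

theorem inner_lcoeff_idSlice (β : B ≃⋆ₐ[ℂ] B) (T : VN φ ψ) (x x' : H) (y y' : K) :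
    vecFun φ x x' (lcoeff hφ (idSlice hψ hψ (isCCP_starAlgEquiv β) T) y y') =
      vecFun ψ y y' (β (rcoeff hψ T x x')) := by
  rw [vecFun_apply, vecFun_apply, inner_lcoeff, ← inner_rcoeff hψ, rcoeff_idSlice]
  rfl

theorem norm_lcoeff_idSlice_le (β : B ≃⋆ₐ[ℂ] B) (T : VN φ ψ) (y y' : K) :
    ‖lcoeff hφ (idSlice hψ hψ (isCCP_starAlgEquiv β) T) y y'‖ ≤ ‖T‖ * ‖y‖ * ‖y'‖ :=
  (norm_lcoeff_le hφ _ y y').trans (by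
    gcongr
    exact norm_idSlice_le hψ hψ (isCCP_starAlgEquiv β) T)

variable {γ₁ γ₂} [TopologicalSpace G₁] [TopologicalSpace G₂]

theorem continuous_lcoeff_idSlice
    (hγ₂ : ∀ ω ∈ normalDual ψ, ∀ b, Continuous fun t => ω (γ₂ t b)) (T : VN φ ψ) (y y' : K)
    {ω : StrongDual ℂ A} (hω : ω ∈ normalDual φ) : Continuous fun t =>
      ω (lcoeff hφ (idSlice hψ hψ (isCCP_starAlgEquiv (γ₂ t)) T) y y') := by
  refine continuous_apply_of_total (φ := φ) (s := Set.univ)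
    (by rw [Submodule.span_univ]; exact top_le_iff.1 (Submodule.le_topologicalClosure ⊤)) (C := ‖T‖ * ‖y‖ * ‖y'‖)
    (fun t => norm_lcoeff_idSlice_le hφ hψ _ T y y') (fun x _ x' _ => ?_) hω
  refine (hγ₂ _ (vecFun_mem ψ y y') (rcoeff hψ T x x')).congr fun t => ?_
  exact (inner_lcoeff_idSlice hφ hψ (γ₂ t) T x x' y y').symm

/-- On elementary vectors the matrix coefficient is the translate of a normal functional under `γ₁`,
norm continuous in `t₁`, evaluated at a bounded family that is weak-star continuous in `t₂`. -/
theorem continuous_tensorAction [IsTopologicalGroup G₁] [LocallyCompactSpace G₁] [T2Space G₁]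
    (hγ₁ : ∀ ω ∈ normalDual φ, ∀ a, Continuous fun t => ω (γ₁ t a))
    (hγ₂ : ∀ ω ∈ normalDual ψ, ∀ b, Continuous fun t => ω (γ₂ t b)) (T : VN φ ψ)
    {ω : StrongDual ℂ (VN φ ψ)} (hω : ω ∈ normalDual (inclVN φ ψ)) :
    Continuous fun t => ω (tensorAction hφ hψ γ₁ γ₂ t T) := by
  refine continuous_apply_of_total (φ := inclVN φ ψ)
    (s := Set.range fun p : H × K => leftTensor p.1 p.2) dense_span_leftTensor (C := ‖T‖)
    (g := fun t => tensorAction hφ hψ γ₁ γ₂ t T)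
    (fun t => norm_starAlgEquiv_apply_le (tensorAction hφ hψ γ₁ γ₂ t) T) ?_ hω
  rintro _ ⟨⟨x, y⟩, rfl⟩ _ ⟨⟨x', y'⟩, rfl⟩
  have hm := vecFun_mem φ x x'
  have := continuous_apply_prod (continuous_dualAct hφ hγ₁ hm)
    (m := fun t => lcoeff hφ (idSlice hψ hψ (isCCP_starAlgEquiv (γ₂ t)) T) y y')
    (C := ‖T‖ * ‖y‖ * ‖y'‖) (fun t => norm_lcoeff_idSlice_le hφ hψ _ T y y')
    fun s => continuous_lcoeff_idSlice hφ hψ hγ₂ T y y' (dualAct_mem hφ (γ₁ s) hm)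
  exact this.congr fun t => (inner_tensorAction hφ hψ γ₁ γ₂ t T x x' y y').symm

theorem tensorAction_tmul (t : G₁ × G₂) (a : A) (b : B) :
    tensorAction hφ hψ γ₁ γ₂ t (tmul φ ψ a b) = tmul φ ψ (γ₁ t.1 a) (γ₂ t.2 b) := by
  rw [tensorAction_apply, idSlice_tmul, sliceId_tmul]
  rfl

theorem continuous_starAlgEquiv_VN (α : VN φ ψ ≃⋆ₐ[ℂ] VN φ ψ) :
    Continuous[ultraweakOn (vnTensor φ ψ), ultraweakOn (vnTensor φ ψ)] α :=
  (isNormalMap_iff_continuous (φ := inclVN φ ψ) (ψ := inclVN φ ψ) isDualRep_inclVN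
    isDualRep_inclVN).1 (isNormalMap_of_starAlgEquiv (φ := inclVN φ ψ) (ψ := inclVN φ ψ)
      isDualRep_inclVN isDualRep_inclVN α)

theorem isWStarAction_iff {C L : Type*} [CStarAlgebra C] [NormedAddCommGroup L]
    [InnerProductSpace ℂ L] [CompleteSpace L] {χ : C →⋆ₐ[ℂ] (L →L[ℂ] L)} (hχ : IsDualRep χ)
    {γ : G₁ →* (C ≃⋆ₐ[ℂ] C)} : IsWStarAction (repTopology χ) γ ↔
      ∀ ω ∈ normalDual χ, ∀ a, Continuous fun t => ω (γ t a) := by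
  have : ∀ a, Continuous[inferInstance, repTopology χ] (fun t => γ t a) ↔
      ∀ ω ∈ normalDual χ, Continuous fun t => ω (γ t a) := fun a => by
    rw [continuous_induced_rng]
    exact hχ.continuous_iff
  exact ⟨fun h ω hω a => (this a).1 (h a) ω hω, fun h a => (this a).2 fun ω hω => h ω hω a⟩

theorem isTensorAction_tensorAction [IsTopologicalGroup G₁] [LocallyCompactSpace G₁] [T2Space G₁]
    (hγ₁ : IsWStarAction (repTopology φ) γ₁) (hγ₂ : IsWStarAction (repTopology ψ) γ₂) :
    IsTensorAction φ ψ γ₁ γ₂ (tensorAction hφ hψ γ₁ γ₂) where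
  isWStarAction := (isWStarAction_iff (χ := inclVN φ ψ) isDualRep_inclVN).2 fun _ hω T =>
    continuous_tensorAction hφ hψ ((isWStarAction_iff hφ).1 hγ₁) ((isWStarAction_iff hψ).1 hγ₂) T hω
  normal _ := continuous_starAlgEquiv_VN _
  apply_tmul := tensorAction_tmul hφ hψ

/-- Automorphisms are normal, so the elementary tensors determine them; this yields uniqueness of
the tensor product action. -/
theorem starAlgEquiv_VN_ext {α β : VN φ ψ ≃⋆ₐ[ℂ] VN φ ψ}
    (h : ∀ a b, α (tmul φ ψ a b) = β (tmul φ ψ a b)) : α = β :=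
  DFunLike.ext _ _ fun T => LinearMap.congr_fun
    (IsNormalMap.ext (χ := inclVN φ ψ) (f := starLin (α : VN φ ψ →⋆ₙₐ[ℂ] VN φ ψ))
      (g := starLin (β : VN φ ψ →⋆ₙₐ[ℂ] VN φ ψ)) isDualRep_inclVN
      (isNormalMap_of_starAlgEquiv (φ := inclVN φ ψ) (ψ := inclVN φ ψ) isDualRep_inclVN
        isDualRep_inclVN α)
      (isNormalMap_of_starAlgEquiv (φ := inclVN φ ψ) (ψ := inclVN φ ψ) isDualRep_inclVN
        isDualRep_inclVN β) h) T

theorem IsTensorAction.eq_tensorAction {Γ : G₁ × G₂ →* (VN φ ψ ≃⋆ₐ[ℂ] VN φ ψ)}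
    (h : IsTensorAction φ ψ γ₁ γ₂ Γ) : Γ = tensorAction hφ hψ γ₁ γ₂ :=
  MonoidHom.ext fun t => starAlgEquiv_VN_ext fun a b => by
    rw [h.apply_tmul, tensorAction_tmul]

theorem isIdTensor_idSlice (β : B ≃⋆ₐ[ℂ] B) (T : VN φ ψ) :
    IsIdTensor ψ β T.1 (idSlice hψ hψ (isCCP_starAlgEquiv β) T).1 := fun x x' =>
  ⟨rcoeff hψ T x x', (map_rcoeff hψ T x x').symm, by
    rw [← map_rcoeff hψ, rcoeff_idSlice]; rfl⟩

theorem isTensorId_sliceId (α : A ≃⋆ₐ[ℂ] A) (T : VN φ ψ) :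
    IsTensorId φ α T.1 (sliceId hφ hφ (isCCP_starAlgEquiv α) T).1 := fun y y' =>
  ⟨lcoeff hφ T y y', (map_lcoeff hφ T y y').symm, by
    rw [← map_lcoeff hφ, lcoeff_sliceId]; rfl⟩

end Actions

/-! ### Equivariance, normality and embeddings for the tensor product map -/

section Equivariance

variable {A H : Type*} [CStarAlgebra A] [NormedAddCommGroup H] [InnerProductSpace ℂ H]
  [CompleteSpace H] {φ : A →⋆ₐ[ℂ] (H →L[ℂ] H)}
  {B K : Type*} [CStarAlgebra B] [NormedAddCommGroup K] [InnerProductSpace ℂ K]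
  [CompleteSpace K] {ψ : B →⋆ₐ[ℂ] (K →L[ℂ] K)}
  {A₂ H₂ : Type*} [CStarAlgebra A₂] [NormedAddCommGroup H₂] [InnerProductSpace ℂ H₂]
  [CompleteSpace H₂] {φ₂ : A₂ →⋆ₐ[ℂ] (H₂ →L[ℂ] H₂)}
  {B₂ K₂ : Type*} [CStarAlgebra B₂] [NormedAddCommGroup K₂] [InnerProductSpace ℂ K₂]
  [CompleteSpace K₂] {ψ₂ : B₂ →⋆ₐ[ℂ] (K₂ →L[ℂ] K₂)}
  (hφ : IsDualRep φ) (hφ₂ : IsDualRep φ₂) (hψ : IsDualRep ψ) (hψ₂ : IsDualRep ψ₂)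
  {θ : A →ₗ[ℂ] A₂} (hθ : IsCCP θ) {π : B →ₗ[ℂ] B₂} (hπ : IsCCP π)

/-- Each exchange of slices in different factors involves an automorphism, which is normal; `θ` and
`π` only meet automorphisms of their own factor, through the given equivariance. -/
theorem tensorCCP_tensorEquiv {α : A ≃⋆ₐ[ℂ] A} {β : B ≃⋆ₐ[ℂ] B} {α₂ : A₂ ≃⋆ₐ[ℂ] A₂}
    {β₂ : B₂ ≃⋆ₐ[ℂ] B₂} (hα : ∀ a, θ (α a) = α₂ (θ a)) (hβ : ∀ b, π (β b) = β₂ (π b))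
    (T : VN φ ψ) : tensorCCP hφ hφ₂ hψ hψ₂ hθ hπ (tensorEquiv hφ hψ α β T) =
      tensorEquiv hφ₂ hψ₂ α₂ β₂ (tensorCCP hφ hφ₂ hψ hψ₂ hθ hπ T) := by
  rw [tensorCCP_apply, tensorCCP_apply, tensorEquiv_apply, tensorEquiv_apply,
    idSlice_sliceId hφ hφ _ (isNormalMap_of_starAlgEquiv hφ hφ α),
    idSlice_comm hψ hψ hψ₂ hψ₂ (isCCP_starAlgEquiv β) hπ hπ (isCCP_starAlgEquiv β₂) hβ,
    sliceId_comm hφ hφ hφ₂ hφ₂ (isCCP_starAlgEquiv α) hθ hθ (isCCP_starAlgEquiv α₂) hα,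
    sliceId_idSlice hφ hφ₂ hθ hψ₂ hψ₂ _ (isNormalMap_of_starAlgEquiv hψ₂ hψ₂ β₂)]

theorem continuous_tensorCCP (h : Continuous[repTopology φ, repTopology φ₂] θ)
    (h' : Continuous[repTopology ψ, repTopology ψ₂] π) :
    Continuous[ultraweakOn (vnTensor φ ψ), ultraweakOn (vnTensor φ₂ ψ₂)]
      (tensorCCP hφ hφ₂ hψ hψ₂ hθ hπ) :=
  (isNormalMap_iff_continuous (φ := inclVN φ ψ) (ψ := inclVN φ₂ ψ₂) isDualRep_inclVN
    isDualRep_inclVN).1 (isNormalMap_tensorCCP hφ hφ₂ hψ hψ₂ hθ hπ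
      ((isNormalMap_iff_continuous hφ hφ₂).2 h) ((isNormalMap_iff_continuous hψ hψ₂).2 h'))

theorem exists_wStarEmbedding {j : A₂ →⋆ₙₐ[ℂ] A} {k : B₂ →⋆ₙₐ[ℂ] B}
    (hj : Continuous[repTopology φ₂, repTopology φ] j)
    (hk : Continuous[repTopology ψ₂, repTopology ψ] k)
    (h1 : ∀ a, θ (j a) = a) (h2 : ∀ b, π (k b) = b) :
    ∃ J : VN φ₂ ψ₂ →⋆ₙₐ[ℂ] VN φ ψ,
      IsWStarEmbedding (ultraweakOn (vnTensor φ₂ ψ₂)) (ultraweakOn (vnTensor φ ψ)) J ∧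
      (∀ a b, J (tmul φ₂ ψ₂ a b) = tmul φ ψ (j a) (k b)) ∧
      IsConditionalExpectation J (tensorCCP hφ hφ₂ hψ hψ₂ hθ hπ) := by
  have hj' : IsNormalMap φ₂ φ (starLin j) := (isNormalMap_iff_continuous hφ₂ hφ).2 hj
  have hk' : IsNormalMap ψ₂ ψ (starLin k) := (isNormalMap_iff_continuous hψ₂ hψ).2 hk
  have hl := tensorCCP_tensorHom hφ hφ₂ hψ hψ₂ hθ hπ hj' hk' h1 h2
  exact ⟨tensorHom hφ₂ hφ hψ₂ hψ j k hj' hk',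
    ⟨Function.LeftInverse.injective hl,
      continuous_tensorCCP hφ₂ hφ hψ₂ hψ (isCCP_starLin j) (isCCP_starLin k) hj hk⟩,
    tensorCCP_tmul hφ₂ hφ hψ₂ hψ (isCCP_starLin j) (isCCP_starLin k),
    isConditionalExpectation_of_leftInverse (φ := inclVN φ ψ) (ψ := inclVN φ₂ ψ₂)
      (isCCP_tensorCCP hφ hφ₂ hψ hψ₂ hθ hπ) inclVN_injective inclVN_injective _ hl⟩

end Equivariance

end VNTensor

end

open VNTensor

set_option maxHeartbeats 2000000 in
theorem mainTheorem12
    {G₁ G₂ M₁ M₂ N₁ N₂ X₁ X₂ Y₁ Y₂ : Type*}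
    -- the (locally compact Hausdorff) groups
    [Group G₁] [TopologicalSpace G₁] [IsTopologicalGroup G₁] [LocallyCompactSpace G₁] [T2Space G₁]
    [Group G₂] [TopologicalSpace G₂] [IsTopologicalGroup G₂] [LocallyCompactSpace G₂] [T2Space G₂]
    -- the W*-algebras
    [CStarAlgebra M₁] [WStarAlgebra M₁] [CStarAlgebra M₂] [WStarAlgebra M₂]
    [CStarAlgebra N₁] [WStarAlgebra N₁] [CStarAlgebra N₂] [WStarAlgebra N₂]
    -- arbitrary faithful normal representations, on which the tensor products are realized
    [NormedAddCommGroup X₁] [InnerProductSpace ℂ X₁] [CompleteSpace X₁]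
    [NormedAddCommGroup X₂] [InnerProductSpace ℂ X₂] [CompleteSpace X₂]
    [NormedAddCommGroup Y₁] [InnerProductSpace ℂ Y₁] [CompleteSpace Y₁]
    [NormedAddCommGroup Y₂] [InnerProductSpace ℂ Y₂] [CompleteSpace Y₂]
    (φ₁ : M₁ →⋆ₐ[ℂ] (X₁ →L[ℂ] X₁)) (hφ₁ : IsFaithfulNormal φ₁)
    (φ₂ : M₂ →⋆ₐ[ℂ] (X₂ →L[ℂ] X₂)) (hφ₂ : IsFaithfulNormal φ₂)
    (ψ₁ : N₁ →⋆ₐ[ℂ] (Y₁ →L[ℂ] Y₁)) (hψ₁ : IsFaithfulNormal ψ₁)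
    (ψ₂ : N₂ →⋆ₐ[ℂ] (Y₂ →L[ℂ] Y₂)) (hψ₂ : IsFaithfulNormal ψ₂)
    -- the W*-actions
    (γ₁ : G₁ →* (M₁ ≃⋆ₐ[ℂ] M₁)) (hγ₁ : IsWStarAction (weakStar M₁) γ₁)
    (γ₂ : G₂ →* (M₂ ≃⋆ₐ[ℂ] M₂)) (hγ₂ : IsWStarAction (weakStar M₂) γ₂)
    (δ₁ : G₁ →* (N₁ ≃⋆ₐ[ℂ] N₁)) (hδ₁ : IsWStarAction (weakStar N₁) δ₁)
    (δ₂ : G₂ →* (N₂ ≃⋆ₐ[ℂ] N₂)) (hδ₂ : IsWStarAction (weakStar N₂) δ₂)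
    -- the equivariant ccp maps
    (π₁ : M₁ →ₗ[ℂ] N₁) (hπ₁ : IsCCP π₁) (hequiv₁ : ∀ t m, π₁ (γ₁ t m) = δ₁ t (π₁ m))
    (π₂ : M₂ →ₗ[ℂ] N₂) (hπ₂ : IsCCP π₂) (hequiv₂ : ∀ t m, π₂ (γ₂ t m) = δ₂ t (π₂ m)) :
    -- the tensor product actions exist and are unique
    (∃! Γ, IsTensorAction φ₁ φ₂ γ₁ γ₂ Γ) ∧
    (∃! Δ, IsTensorAction ψ₁ ψ₂ δ₁ δ₂ Δ) ∧
    ∀ Γ Δ, IsTensorAction φ₁ φ₂ γ₁ γ₂ Γ → IsTensorAction ψ₁ ψ₂ δ₁ δ₂ Δ →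
      -- `Γ (t₁, t₂) T = (γ₁ t₁ ⊗ id) ((id ⊗ γ₂ t₂) T)`
      (∀ (t₁ : G₁) (t₂ : G₂) (T : VN φ₁ φ₂), ∃ R : VN φ₁ φ₂,
        IsIdTensor φ₂ (γ₂ t₂) (T : HilbertTensor X₁ X₂ →L[ℂ] HilbertTensor X₁ X₂) R ∧
        IsTensorId φ₁ (γ₁ t₁) (R : HilbertTensor X₁ X₂ →L[ℂ] HilbertTensor X₁ X₂)
          (Γ (t₁, t₂) T)) ∧
      ∃ ρ : VN φ₁ φ₂ →ₗ[ℂ] VN ψ₁ ψ₂,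
        IsCCP ρ ∧
        (∀ t T, ρ (Γ t T) = Δ t (ρ T)) ∧
        (∀ m₁ m₂, ρ (tmul φ₁ φ₂ m₁ m₂) = tmul ψ₁ ψ₂ (π₁ m₁) (π₂ m₂)) ∧
        -- normality
        (Continuous[weakStar M₁, weakStar N₁] π₁ → Continuous[weakStar M₂, weakStar N₂] π₂ →
          Continuous[ultraweakOn (vnTensor φ₁ φ₂), ultraweakOn (vnTensor ψ₁ ψ₂)] ρ) ∧
        -- conditional expectations onto W*-subalgebras
        (∀ (j₁ : N₁ →⋆ₙₐ[ℂ] M₁) (j₂ : N₂ →⋆ₙₐ[ℂ] M₂),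
          IsWStarEmbedding (weakStar N₁) (weakStar M₁) j₁ →
          IsWStarEmbedding (weakStar N₂) (weakStar M₂) j₂ →
          IsConditionalExpectation j₁ π₁ → IsConditionalExpectation j₂ π₂ →
          ∃ J : VN ψ₁ ψ₂ →⋆ₙₐ[ℂ] VN φ₁ φ₂,
            IsWStarEmbedding (ultraweakOn (vnTensor ψ₁ ψ₂)) (ultraweakOn (vnTensor φ₁ φ₂)) J ∧
            (∀ n₁ n₂, J (tmul ψ₁ ψ₂ n₁ n₂) = tmul φ₁ φ₂ (j₁ n₁) (j₂ n₂)) ∧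
            IsConditionalExpectation J ρ) := by
  have d₁ := hφ₁.isDualRep
  have d₂ := hφ₂.isDualRep
  have e₁ := hψ₁.isDualRep
  have e₂ := hψ₂.isDualRep
  -- The weak-star topologies are replaced by those induced from the representations, where
  -- normality means preservation of normal functionals.
  rw [hφ₁.weakStar_eq] at hγ₁ ⊢
  rw [hφ₂.weakStar_eq] at hγ₂ ⊢
  rw [hψ₁.weakStar_eq] at hδ₁ ⊢
  rw [hψ₂.weakStar_eq] at hδ₂ ⊢
  refine ⟨⟨_, isTensorAction_tensorAction d₁ d₂ hγ₁ hγ₂, fun Γ h => h.eq_tensorAction d₁ d₂⟩,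
    ⟨_, isTensorAction_tensorAction e₁ e₂ hδ₁ hδ₂, fun Δ h => h.eq_tensorAction e₁ e₂⟩,
    fun Γ Δ hΓ hΔ => ?_⟩
  -- By uniqueness it suffices to treat the constructed actions.
  rw [hΓ.eq_tensorAction d₁ d₂, hΔ.eq_tensorAction e₁ e₂]
  exact ⟨fun t₁ t₂ T => ⟨_, isIdTensor_idSlice d₂ (γ₂ t₂) T, isTensorId_sliceId d₁ (γ₁ t₁) _⟩,
    tensorCCP d₁ e₁ d₂ e₂ hπ₁ hπ₂, isCCP_tensorCCP d₁ e₁ d₂ e₂ hπ₁ hπ₂,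
    fun t => tensorCCP_tensorEquiv d₁ e₁ d₂ e₂ hπ₁ hπ₂ (hequiv₁ t.1) (hequiv₂ t.2),
    tensorCCP_tmul d₁ e₁ d₂ e₂ hπ₁ hπ₂, continuous_tensorCCP d₁ e₁ d₂ e₂ hπ₁ hπ₂,
    fun j₁ j₂ hj₁ hj₂ h₁ h₂ => exists_wStarEmbedding d₁ e₁ d₂ e₂ hπ₁ hπ₂ hj₁.normal hj₂.normal
      h₁.apply_coe h₂.apply_coe⟩
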